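/- Let $p,q\in[0,1]$ and put $\alpha=2p-1$. Let $(X_k)_{k\ge1}$ be the steps of the elephant random walk: $P(X_1=1)=q=1-P(X_1=-1)$ and, for $n\ge1$, $X_{n+1}=\xi_nX_{U_n}$, where $U_n$ is uniformly distributed on $\{1,\dots,n\}$, $P(\xi_n=1)=p=1-P(\xi_n=-1)$, and the random variables $X_1,U_1,\xi_1,U_2,\xi_2,\dots$ are independent. Let $\mathcal F_n$ be the $\sigma$-algebra generated by $X_1,\dots,X_n$ ($\mathcal F_0$ is trivial). For $\gamma>0$ let $S_n=\sum_{k=1}^n k^{-\gamma}X_k$ be the elephant random walk with polynomially decaying steps and let $$M_n=\sum_{k=1}^n\frac{X_k-E[X_k\mid\mathcal F_{k-1}]}{k^\gamma}$$ be the martingale part of its Doob decomposition. Write $\xrightarrow{d}$ for convergence in distribution, $N(0,\sigma^2)$ for the centred normal law with variance $\sigma^2$; a statement with $\pm$ is claimed for both signs. Suppose that $\alpha\in[-1,1)$. (i) If $\gamma<1/2$, then $$\frac{M_n}{n^{1/2-\gamma}}\xrightarrow{d}N\Bigl(0,\frac1{1-2\gamma}\Bigr)\quad\text{and}\quad \limsup_{n\to\infty}\pm\frac{M_n}{\sqrt{2n^{1-2\gamma}\log\log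 n}}=\frac1{\sqrt{1-2\gamma}}\ \text{ a.s.}$$ (ii) If $\gamma=1/2$, then $$\frac{M_n}{\sqrt{\log n}}\xrightarrow{d}N(0,1)\quad\text{and}\quad \limsup_{n\to\infty}\pm\frac{M_n}{\sqrt{2\log n\,\log\log\log n}}=1\ \text{ a.s.}$$ (iii) If $\gamma>1/2$, then $M_n$ converges almost surely and in $L^2$ to a random variable $M_\infty$ with positive variance, and $$\frac{M_n-M_\infty}{n^{1/2-\gamma}}\xrightarrow{d}N\Bigl(0,\frac1{2\gamma-1}\Bigr)\quad\text{and}\quad \limsup_{n\to\infty}\pm\frac{M_n-M_\infty}{\sqrt{2n^{1-2\gamma}\log\log n}}=\frac1{\sqrt{2\gamma-1}}\ \text{ a.s.}$$ -/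

import Mathlib

open MeasureTheory ProbabilityTheory Filter Topology

namespace ERW

/-- `X 1, X 2, …` are the steps of the elephant random walk with memory parameter `p` and
first-step parameter `q`, driven by the choices `U n` (uniform on `{1, …, n}`) and the signs
`ξ n` (`+1` with probability `p`, `-1` with probability `1 - p`), `n ≥ 1`.  The first step, the
choices and the signs are all independent.  The values at index `0` play no role. -/
structure IsElephantRandomWalk {Ω : Type*} [MeasurableSpace Ω] (μ : Measure Ω) (p q : ℝ)
    (X : ℕ → Ω → ℝ) (U : ℕ → Ω → ℕ) (ξ : ℕ → Ω → ℝ) : Prop where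
  measurable_step : ∀ n, 1 ≤ n → Measurable (X n)
  measurable_choice : ∀ n, 1 ≤ n → Measurable (U n)
  measurable_sign : ∀ n, 1 ≤ n → Measurable (ξ n)
  first_pos : μ.real {ω | X 1 ω = 1} = q
  first_neg : μ.real {ω | X 1 ω = -1} = 1 - q
  choice_uniform : ∀ n, 1 ≤ n → ∀ j, 1 ≤ j → j ≤ n → μ.real {ω | U n ω = j} = 1 / (n : ℝ)
  sign_pos : ∀ n, 1 ≤ n → μ.real {ω | ξ n ω = 1} = p
  sign_neg : ∀ n, 1 ≤ n → μ.real {ω | ξ n ω = -1} = 1 - p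
  indep_choice_sign : ∀ n, 1 ≤ n → IndepFun (U n) (ξ n) μ
  indep_times : iIndepFun (fun (n : ℕ) (ω : Ω) => (U (n + 1) ω, ξ (n + 1) ω)) μ
  indep_first : IndepFun (X 1) (fun (ω : Ω) (n : ℕ) => (U (n + 1) ω, ξ (n + 1) ω)) μ
  step : ∀ n, 1 ≤ n → ∀ᵐ ω ∂μ, X (n + 1) ω = ξ n ω * X (U n ω) ω

/-- The σ-algebra `F_n` generated by `X 1, …, X n`; `F_0` is trivial. -/
@[reducible] def history {Ω : Type*} (X : ℕ → Ω → ℝ) (n : ℕ) : MeasurableSpace Ω :=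
  ⨆ k ∈ Finset.Icc 1 n, MeasurableSpace.comap (X k) inferInstance

/-- The walk with polynomially decaying steps, `S_n = ∑_{k=1}^n X_k / k^γ`. -/
noncomputable def position {Ω : Type*} (γ : ℝ) (X : ℕ → Ω → ℝ) (n : ℕ) (ω : Ω) : ℝ :=
  ∑ k ∈ Finset.Icc 1 n, X k ω / (k : ℝ) ^ γ

/-- The martingale part of the Doob decomposition of `S_n`,
`M_n = ∑_{k=1}^n (X_k - E[X_k | F_{k-1}]) / k^γ`. -/
noncomputable def martPart {Ω : Type*} [MeasurableSpace Ω] (μ : Measure Ω) (γ : ℝ)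
    (X : ℕ → Ω → ℝ) (n : ℕ) (ω : Ω) : ℝ :=
  ∑ k ∈ Finset.Icc 1 n, (X k ω - (μ[X k | history X (k - 1)]) ω) / (k : ℝ) ^ γ

/-- The predictable part of the Doob decomposition of `S_n`,
`A_n = ∑_{k=1}^n E[X_k | F_{k-1}] / k^γ`. -/
noncomputable def predPart {Ω : Type*} [MeasurableSpace Ω] (μ : Measure Ω) (γ : ℝ)
    (X : ℕ → Ω → ℝ) (n : ℕ) (ω : Ω) : ℝ :=
  ∑ k ∈ Finset.Icc 1 n, (μ[X k | history X (k - 1)]) ω / (k : ℝ) ^ γ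

/-- The decomposition `S_n = M_n + A_n`. -/
theorem position_eq {Ω : Type*} [MeasurableSpace Ω] (μ : Measure Ω) (γ : ℝ)
    (X : ℕ → Ω → ℝ) (n : ℕ) (ω : Ω) :
    position γ X n ω = martPart μ γ X n ω + predPart μ γ X n ω := by
  simp only [position, martPart, predPart, ← Finset.sum_add_distrib]
  exact Finset.sum_congr rfl fun k _ => by ring

/-- `Y n` converges in distribution to the normal law with mean `0` and variance `v` (used for
`v ≥ 0` only). -/
def CLT {Ω : Type*} [MeasurableSpace Ω] (μ : Measure Ω) [IsProbabilityMeasure μ]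
    (Y : ℕ → Ω → ℝ) (v : ℝ) : Prop :=
  TendstoInDistribution Y atTop (id : ℝ → ℝ) (fun _ => μ) (gaussianReal 0 v.toNNReal)

/-- `limsup ± y n = c` (both signs), the upper limits being taken in the extended reals. -/
def LimsupPM (y : ℕ → ℝ) (c : ℝ) : Prop :=
  limsup (fun n => ((y n : ℝ) : EReal)) atTop = (c : EReal) ∧
    limsup (fun n => ((-y n : ℝ) : EReal)) atTop = (c : EReal)

end ERW

set_option linter.unusedSectionVars false

/-! Given the past, the step `X (k + 1)` is a random sign with mean `m k = (α / k) * (X 1 + ... + X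
k)`. The second moment of `X 1 + ... + X k` satisfies a linear recursion (`integral_sum_sq_le`), and
because `α < 1` it follows that `E[m k ^ 2]` decays like a negative power of `k`
(`integral_signPred_sq_le`). The conditional variance `1 - m k ^ 2` of a centred step is therefore
close to `1`, and `M_n` behaves like a sum of independent signs with weights `k ^ (-γ)`. The limit
theorems are proved for abstract `IsPredictedSigns` and use only this mean-square decay; no almost
sure information on the walk is needed.

Central limit theorem: the conditional characteristic function of a centred sign is Gaussian up to a
third-order error and an error proportional to `m ^ 2` (`norm_twoPointMGF_sub_le`). Replacing the
factors one at a time makes these errors add up (`norm_charFun_centredSum_sub_le`). For `γ > 1/2`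
the martingale is bounded in `L²`, and the remainder `M_∞ - M_n` inherits the estimates of the
finite blocks `n ≤ k < n + l` as `l → ∞`.

Law of the iterated logarithm: the variance is of order `φ ^ β` for a clock `φ`, with `φ n = n`, `β
= 1 - 2γ` when `γ ≠ 1/2`, and `φ n = log n`, `β = 1` when `γ = 1/2`. Time is cut where `φ` reaches
`ρ ^ j`. For the upper half, Hoeffding's lemma gives sub-Gaussian tails at the cutting times and,
through Doob's inequality, inside the blocks; Borel-Cantelli is applied with `ρ` close to `1`. For
the lower half, `le_measure_inter_large_centredSum` bounds below the probability of a large block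
sum uniformly over past events, up to a summable error; `ae_frequently_of_le_measure_inter` then
yields infinitely many large blocks, and for large `ρ` one block carries almost all the variance.
The case `β < 0` is treated together with `β > 0`: the remainder is fed by the blocks to its right,
so the two ends of a block exchange roles. -/

namespace ERW

section

/-! ### The centred two-point law -/

/-- The moment generating function of `x - m`, where `x = ±1` has mean `m`. -/
noncomputable def twoPointMGF (z : ℂ) (m : ℝ) : ℂ :=
  Complex.exp (-(z * m)) * (Complex.cosh z + m * Complex.sinh z)

/-- The real form of `twoPointMGF`. -/
noncomputable def twoPointMGFReal (θ m : ℝ) : ℝ :=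
  Real.exp (-(θ * m)) * (Real.cosh θ + m * Real.sinh θ)

theorem ofReal_twoPointMGFReal (θ m : ℝ) :
    ((twoPointMGFReal θ m : ℝ) : ℂ) = twoPointMGF θ m := by
  simp [twoPointMGFReal, twoPointMGF]

theorem twoPointMGF_eq (z : ℂ) (m : ℝ) :
    twoPointMGF z m = (1 + m) / 2 * Complex.exp (z * (1 - m)) +
      (1 - m) / 2 * Complex.exp (-(z * (1 + m))) := by
  have h1 : Complex.exp (z * (1 - m)) = Complex.exp (-(z * m)) * Complex.exp z := by
    rw [← Complex.exp_add]; ring_nf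
  have h2 : Complex.exp (-(z * (1 + m))) = Complex.exp (-(z * m)) * Complex.exp (-z) := by
    rw [← Complex.exp_add]; ring_nf
  rw [h1, h2, twoPointMGF, Complex.cosh, Complex.sinh]
  ring

theorem twoPointMGFReal_eq (θ m : ℝ) :
    twoPointMGFReal θ m = (1 + m) / 2 * Real.exp (θ * (1 - m)) +
      (1 - m) / 2 * Real.exp (-(θ * (1 + m))) := by
  have := twoPointMGF_eq θ m
  rw [← ofReal_twoPointMGFReal] at this
  exact_mod_cast this

theorem norm_exp_sub_quadratic_le {u : ℂ} (hu : ‖u‖ ≤ 2) :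
    ‖Complex.exp u - (1 + u + u ^ 2 / 2)‖ ≤ 8 * ‖u‖ ^ 3 := by
  have h := Complex.norm_exp_sub_sum_le_norm_mul_exp u 3
  have h8 : Real.exp ‖u‖ ≤ 8 := by
    calc Real.exp ‖u‖ ≤ Real.exp 2 := Real.exp_le_exp.2 hu
      _ = Real.exp 1 ^ 2 := by rw [← Real.exp_nat_mul]; norm_num
      _ ≤ 2.7182818286 ^ 2 := by
        gcongr; exact Real.exp_one_lt_d9.le
      _ ≤ 8 := by norm_num
  have e : ∑ k ∈ Finset.range 3, u ^ k / (k.factorial : ℂ) = 1 + u + u ^ 2 / 2 := by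
    simp [Finset.sum_range_succ, Nat.factorial]
  rw [e] at h
  calc _ ≤ ‖u‖ ^ 3 * Real.exp ‖u‖ := h
    _ ≤ ‖u‖ ^ 3 * 8 := by gcongr
    _ = _ := by ring

/-- The law has mean `0` and variance `1 - m ^ 2`, so a second-order Taylor expansion gives `exp (z
^ 2 / 2)` with a defect `z ^ 2 * m ^ 2 / 2` and a cubic remainder. Imaginary `z` serves the central
limit theorem, real `z` the lower bound for exponential moments. -/
theorem norm_twoPointMGF_sub_le {z : ℂ} {m : ℝ} (hz : ‖z‖ ≤ 1) (hm : |m| ≤ 1) :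
    ‖twoPointMGF z m - Complex.exp (z ^ 2 / 2)‖ ≤ 65 * (‖z‖ ^ 3 + ‖z‖ ^ 2 * m ^ 2) := by
  obtain ⟨hm1, hm2⟩ := abs_le.1 hm
  have n1 : ‖(1 + m : ℂ)‖ = 1 + m := by
    rw [show (1 + m : ℂ) = ((1 + m : ℝ) : ℂ) by push_cast; rfl, Complex.norm_real,
      Real.norm_of_nonneg (by linarith)]
  have n2 : ‖(1 - m : ℂ)‖ = 1 - m := by
    rw [show (1 - m : ℂ) = ((1 - m : ℝ) : ℂ) by push_cast; rfl, Complex.norm_real,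
      Real.norm_of_nonneg (by linarith)]
  have hz0 := norm_nonneg z
  set u : ℂ := z * (1 - m)
  set v : ℂ := -(z * (1 + m))
  have hu : ‖u‖ ≤ 2 * ‖z‖ := by rw [norm_mul, n2]; nlinarith
  have hv : ‖v‖ ≤ 2 * ‖z‖ := by rw [norm_neg, norm_mul, n1]; nlinarith
  have bu := norm_exp_sub_quadratic_le (u := u) (by linarith)
  have bv := norm_exp_sub_quadratic_le (u := v) (by linarith)
  have bw : ‖Complex.exp (z ^ 2 / 2) - 1 - z ^ 2 / 2‖ ≤ ‖z ^ 2 / 2‖ ^ 2 :=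
    Complex.norm_exp_sub_one_sub_id_le (by
      rw [norm_div, norm_pow]; norm_num; nlinarith)
  -- The linear terms cancel, and `(1 + m) / 2 * (1 - m) ^ 2 + (1 - m) / 2 * (1 + m) ^ 2 = 1 - m ^
  -- 2`.
  have key : twoPointMGF z m - Complex.exp (z ^ 2 / 2) =
      (1 + m) / 2 * (Complex.exp u - (1 + u + u ^ 2 / 2)) +
      (1 - m) / 2 * (Complex.exp v - (1 + v + v ^ 2 / 2)) -
      (Complex.exp (z ^ 2 / 2) - 1 - z ^ 2 / 2) - z ^ 2 * m ^ 2 / 2 := by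
    rw [twoPointMGF_eq]
    simp only [u, v]
    ring
  have cu : ‖u‖ ^ 3 ≤ 8 * ‖z‖ ^ 3 := by
    calc ‖u‖ ^ 3 ≤ (2 * ‖z‖) ^ 3 := by gcongr
      _ = _ := by ring
  have cv : ‖v‖ ^ 3 ≤ 8 * ‖z‖ ^ 3 := by
    calc ‖v‖ ^ 3 ≤ (2 * ‖z‖) ^ 3 := by gcongr
      _ = _ := by ring
  have d1 : ‖(1 + m : ℂ) / 2 * (Complex.exp u - (1 + u + u ^ 2 / 2))‖ ≤
      (1 + m) / 2 * (64 * ‖z‖ ^ 3) := by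
    rw [norm_mul, norm_div, n1, Complex.norm_ofNat]
    exact mul_le_mul_of_nonneg_left (by linarith) (by linarith)
  have d2 : ‖(1 - m : ℂ) / 2 * (Complex.exp v - (1 + v + v ^ 2 / 2))‖ ≤
      (1 - m) / 2 * (64 * ‖z‖ ^ 3) := by
    rw [norm_mul, norm_div, n2, Complex.norm_ofNat]
    exact mul_le_mul_of_nonneg_left (by linarith) (by linarith)
  have d3 : ‖z ^ 2 / 2‖ ^ 2 ≤ ‖z‖ ^ 3 := by
    rw [norm_div, norm_pow, Complex.norm_ofNat]
    have : ‖z‖ ^ 4 ≤ ‖z‖ ^ 3 := pow_le_pow_of_le_one hz0 hz (by norm_num)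
    nlinarith [pow_nonneg hz0 3]
  have d4 : ‖z ^ 2 * (m : ℂ) ^ 2 / 2‖ = ‖z‖ ^ 2 * m ^ 2 / 2 := by
    rw [norm_div, norm_mul, norm_pow, norm_pow, Complex.norm_real, Real.norm_eq_abs, sq_abs,
      Complex.norm_ofNat]
  rw [key]
  refine (norm_sub_le _ _).trans ?_
  refine (add_le_add_left ((norm_sub_le _ _).trans
    (add_le_add_left (norm_add_le _ _) _)) _).trans ?_
  rw [d4]
  have : 0 ≤ ‖z‖ ^ 2 * m ^ 2 := by positivity
  nlinarith

/-- Jensen's inequality for a centred law, by tangent lines; it makes the exponentials of the sums a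
submartingale. -/
theorem one_le_twoPointMGFReal (θ : ℝ) {m : ℝ} (hm : |m| ≤ 1) : 1 ≤ twoPointMGFReal θ m := by
  obtain ⟨hm1, hm2⟩ := abs_le.1 hm
  rw [twoPointMGFReal_eq]
  nlinarith [Real.add_one_le_exp (θ * (1 - m)), Real.add_one_le_exp (-(θ * (1 + m)))]

theorem twoPointMGFReal_nonneg (θ : ℝ) {m : ℝ} (hm : |m| ≤ 1) : 0 ≤ twoPointMGFReal θ m :=
  zero_le_one.trans (one_le_twoPointMGFReal θ hm)

/-- Hoeffding's lemma: whatever `m` is, the centred sign lives in an interval of length `2`. The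
bound is free of `m`, so the upper estimates need no decay of the predictions. -/
theorem twoPointMGFReal_le (θ : ℝ) {m : ℝ} (hm : |m| ≤ 1) :
    twoPointMGFReal θ m ≤ Real.exp (θ ^ 2 / 2) := by
  obtain ⟨hm1, hm2⟩ := abs_le.1 hm
  set P : Measure ℝ := ENNReal.ofReal ((1 + m) / 2) • Measure.dirac (1 - m) +
    ENNReal.ofReal ((1 - m) / 2) • Measure.dirac (-(1 + m)) with hP
  have hint (f : ℝ → ℝ) (hf : Measurable f) : ∫ y, f y ∂P =
      (1 + m) / 2 * f (1 - m) + (1 - m) / 2 * f (-(1 + m)) := by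
    have hI (c : ℝ) (a : ℝ) : Integrable f (ENNReal.ofReal a • Measure.dirac c) :=
      (integrable_dirac (by simp)).smul_measure (by simp)
    rw [hP, integral_add_measure (hI _ _) (hI _ _), integral_smul_measure, integral_smul_measure,
      integral_dirac, integral_dirac, ENNReal.toReal_ofReal (by linarith),
      ENNReal.toReal_ofReal (by linarith)]
    simp
  have : IsProbabilityMeasure P := ⟨by
    simp only [hP, Measure.coe_add, Measure.coe_smul, Pi.add_apply, Pi.smul_apply,
      measure_univ, smul_eq_mul, mul_one]
    rw [← ENNReal.ofReal_add (by linarith) (by linarith)]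
    ring_nf; simp⟩
  have hb : ∀ᵐ y ∂P, (id y : ℝ) ∈ Set.Icc (-(1 + m)) (1 - m) := by
    have hs : MeasurableSet {y : ℝ | id y ∈ Set.Icc (-(1 + m)) (1 - m)} := measurableSet_Icc
    rw [hP, ae_add_measure_iff]
    constructor <;> refine Measure.ae_smul_measure ?_ _ <;> rw [ae_dirac_iff hs] <;>
      constructor <;> simp <;> linarith
  have h0 : P[id] = 0 := by
    rw [hint id measurable_id]; simp; ring
  have := (hasSubgaussianMGF_of_mem_Icc_of_integral_eq_zero aemeasurable_id hb h0).mgf_le θ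
  rw [mgf, hint _ (by fun_prop), show (1 - m - -(1 + m)) = 2 by ring] at this
  simp only [id] at this
  rw [twoPointMGFReal_eq]
  convert this using 3
  · ring_nf
  · simp

theorem exp_sub_twoPointMGFReal_le {θ m : ℝ} (hθ : |θ| ≤ 1) (hm : |m| ≤ 1) :
    Real.exp (θ ^ 2 / 2) - 65 * (|θ| ^ 3 + θ ^ 2 * m ^ 2) ≤ twoPointMGFReal θ m := by
  have h := norm_twoPointMGF_sub_le (z := (θ : ℂ)) (m := m) (by simpa using hθ) hm
  rw [← ofReal_twoPointMGFReal] at h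
  rw [show Complex.exp ((θ : ℂ) ^ 2 / 2) = ((Real.exp (θ ^ 2 / 2) : ℝ) : ℂ) by push_cast; rfl,
    ← Complex.ofReal_sub, Complex.norm_real, Complex.norm_real, Real.norm_eq_abs,
    Real.norm_eq_abs, sq_abs] at h
  linarith [(abs_le.1 h).1]

/-! ### Predicted signs -/

/-- `x 0, x 1, …` are random signs such that `x k` is known at time `k + 1` and has conditional
expectation `m k` given the past up to time `k`. -/
structure IsPredictedSigns {Ω : Type*} [mΩ : MeasurableSpace Ω] (μ : Measure Ω)
    (ℱ : Filtration ℕ mΩ) (x m : ℕ → Ω → ℝ) : Prop where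
  adapted : ∀ k, Measurable[ℱ (k + 1)] (x k)
  sign : ∀ k ω, x k ω = 1 ∨ x k ω = -1
  predictable : ∀ k, Measurable[ℱ k] (m k)
  abs_le : ∀ k ω, |m k ω| ≤ 1
  condExp_eq : ∀ k, μ[x k | ℱ k] =ᵐ[μ] m k

/-- Weighted sums of the centred signs `x k - m k`, `N ≤ k < n`. -/
noncomputable def centredSum {Ω : Type*} (x m : ℕ → Ω → ℝ) (b : ℕ → ℝ) (N n : ℕ) (ω : Ω) : ℝ :=
  ∑ k ∈ Finset.Ico N n, b k * (x k ω - m k ω)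

theorem centredSum_succ {Ω : Type*} (x m : ℕ → Ω → ℝ) (b : ℕ → ℝ) {N n : ℕ} (h : N ≤ n) (ω : Ω) :
    centredSum x m b N (n + 1) ω = centredSum x m b N n ω + b n * (x n ω - m n ω) :=
  Finset.sum_Ico_succ_top h _

@[simp] theorem centredSum_self {Ω : Type*} (x m : ℕ → Ω → ℝ) (b : ℕ → ℝ) (N : ℕ) (ω : Ω) :
    centredSum x m b N N ω = 0 := by simp [centredSum]

theorem centredSum_mul {Ω : Type*} (x m : ℕ → Ω → ℝ) (b : ℕ → ℝ) (c : ℝ) (N n : ℕ) (ω : Ω) :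
    centredSum x m (fun k => c * b k) N n ω = c * centredSum x m b N n ω := by
  simp [centredSum, Finset.mul_sum, mul_assoc]

theorem centredSum_add {Ω : Type*} (x m : ℕ → Ω → ℝ) (b : ℕ → ℝ) {N n l : ℕ} (h : N ≤ n)
    (h' : n ≤ l) (ω : Ω) :
    centredSum x m b N n ω + centredSum x m b n l ω = centredSum x m b N l ω :=
  Finset.sum_Ico_consecutive _ h h'

namespace IsPredictedSigns

variable {Ω : Type*} [mΩ : MeasurableSpace Ω] {μ : Measure Ω} [IsProbabilityMeasure μ]
  {ℱ : Filtration ℕ mΩ} {x m : ℕ → Ω → ℝ}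

theorem abs_sign (h : IsPredictedSigns μ ℱ x m) (k : ℕ) (ω : Ω) : |x k ω| = 1 := by
  rcases h.sign k ω with e | e <;> simp [e]

theorem abs_sub_le (h : IsPredictedSigns μ ℱ x m) (k : ℕ) (ω : Ω) : |x k ω - m k ω| ≤ 2 := by
  have := abs_sub (x k ω) (m k ω)
  linarith [h.abs_sign k ω, h.abs_le k ω]

theorem measurable_sign (h : IsPredictedSigns μ ℱ x m) (k : ℕ) : Measurable (x k) :=
  (h.adapted k).mono (ℱ.le _) le_rfl

theorem measurable_pred (h : IsPredictedSigns μ ℱ x m) (k : ℕ) : Measurable (m k) :=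
  (h.predictable k).mono (ℱ.le _) le_rfl

theorem neg (h : IsPredictedSigns μ ℱ x m) : IsPredictedSigns μ ℱ (-x) (-m) where
  adapted k := (h.adapted k).neg
  sign k ω := by rcases h.sign k ω with e | e <;> simp [e]
  predictable k := (h.predictable k).neg
  abs_le k ω := by simpa using h.abs_le k ω
  condExp_eq k := (condExp_neg (x k) _).trans (h.condExp_eq k).neg

theorem integral_mul_sign (h : IsPredictedSigns μ ℱ x m) (k : ℕ) {H : Ω → ℝ}
    (hH : Measurable[ℱ k] H) {C : ℝ} (hC : ∀ ω, |H ω| ≤ C) :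
    ∫ ω, H ω * x k ω ∂μ = ∫ ω, H ω * m k ω ∂μ := by
  have hH' : Measurable H := hH.mono (ℱ.le _) le_rfl
  have ix : Integrable (x k) μ :=
    .of_bound (h.measurable_sign k).aestronglyMeasurable 1 (ae_of_all _ fun ω => (h.abs_sign k ω).le)
  have iHx : Integrable (H * x k) μ := ix.bdd_mul (c := C) hH'.aestronglyMeasurable
    (ae_of_all _ hC)
  have e := condExp_mul_of_stronglyMeasurable_left (m := ℱ k) (μ := μ) hH.stronglyMeasurable iHx ix
  calc ∫ ω, H ω * x k ω ∂μ = ∫ ω, (μ[H * x k | ℱ k]) ω ∂μ := (integral_condExp (ℱ.le k)).symm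
    _ = ∫ ω, H ω * m k ω ∂μ := by
      refine integral_congr_ae ?_
      filter_upwards [e, h.condExp_eq k] with ω e1 e2
      rw [e1, Pi.mul_apply, e2]

theorem integral_mul_sign_complex (h : IsPredictedSigns μ ℱ x m) (k : ℕ) {H : Ω → ℂ}
    (hH : Measurable[ℱ k] H) {C : ℝ} (hC : ∀ ω, ‖H ω‖ ≤ C) :
    ∫ ω, H ω * x k ω ∂μ = ∫ ω, H ω * m k ω ∂μ := by
  have hH' : Measurable H := hH.mono (ℱ.le _) le_rfl
  have hi : ∀ y : Ω → ℝ, Measurable y → (∀ ω, |y ω| ≤ 1) →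
      Integrable (fun ω => H ω * y ω) μ := fun y hy hb =>
    .of_bound (by fun_prop) C (ae_of_all _ fun ω => by
      rw [norm_mul, Complex.norm_real, Real.norm_eq_abs]
      have := norm_nonneg (H ω)
      nlinarith [hC ω, hb ω, abs_nonneg (y ω)])
  have hre : ∀ y : Ω → ℝ, Measurable y → (∀ ω, |y ω| ≤ 1) →
      (∫ ω, H ω * y ω ∂μ) = ((∫ ω, (H ω).re * y ω ∂μ : ℝ) : ℂ) +
        ((∫ ω, (H ω).im * y ω ∂μ : ℝ) : ℂ) * Complex.I := by
    intro y hy hb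
    have := integral_re_add_im (hi y hy hb)
    simpa using this.symm
  rw [hre _ (h.measurable_sign k) (fun ω => (h.abs_sign k ω).le),
    hre _ (h.measurable_pred k) (h.abs_le k),
    h.integral_mul_sign k (H := fun ω => (H ω).re) (Complex.measurable_re.comp hH)
      (fun ω => (Complex.abs_re_le_norm _).trans (hC ω)),
    h.integral_mul_sign k (H := fun ω => (H ω).im) (Complex.measurable_im.comp hH)
      (fun ω => (Complex.abs_im_le_norm _).trans (hC ω))]

/-- For a sign, `exp (z * x) = cosh z + x * sinh z` is affine in `x`, so its conditional expectation
depends on the conditional mean alone and `integral_mul_sign_complex` suffices. -/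
theorem integral_mul_cexp (h : IsPredictedSigns μ ℱ x m) (k : ℕ) {H : Ω → ℂ}
    (hH : Measurable[ℱ k] H) {C : ℝ} (hC : ∀ ω, ‖H ω‖ ≤ C) (z : ℂ) :
    ∫ ω, H ω * Complex.exp (z * (x k ω - m k ω)) ∂μ = ∫ ω, H ω * twoPointMGF z (m k ω) ∂μ := by
  have hH' : Measurable H := hH.mono (ℱ.le _) le_rfl
  have hm := h.measurable_pred k
  have hx := h.measurable_sign k
  have e1 : ∀ ω, H ω * Complex.exp (z * (x k ω - m k ω)) =
      H ω * Complex.exp (-(z * m k ω)) * Complex.cosh z +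
        H ω * Complex.exp (-(z * m k ω)) * Complex.sinh z * x k ω := by
    intro ω
    have : Complex.exp (z * (x k ω - m k ω)) = Complex.exp (-(z * m k ω)) *
        (Complex.cosh z + Complex.sinh z * x k ω) := by
      rw [show z * (x k ω - m k ω) = -(z * m k ω) + z * x k ω by ring, Complex.exp_add]
      congr 1
      rcases h.sign k ω with e | e <;> simp [e, Complex.cosh, Complex.sinh] <;> ring
    rw [this]; ring
  have hb : ∀ ω, ‖Complex.exp (-(z * m k ω))‖ ≤ Real.exp ‖z‖ := by
    intro ω
    refine (Complex.norm_exp_le_exp_norm _).trans (Real.exp_le_exp.2 ?_)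
    rw [norm_neg, norm_mul, Complex.norm_real, Real.norm_eq_abs]
    nlinarith [norm_nonneg z, h.abs_le k ω]
  have hb2 : ∀ ω, ‖H ω * Complex.exp (-(z * m k ω)) * Complex.cosh z‖ ≤
      C * Real.exp ‖z‖ * ‖Complex.cosh z‖ := fun ω => by
    rw [norm_mul, norm_mul]
    have := (norm_nonneg _).trans (hC ω)
    gcongr
    exacts [hC ω, hb ω]
  have hb3 : ∀ ω, ‖H ω * Complex.exp (-(z * m k ω)) * Complex.sinh z‖ ≤
      C * Real.exp ‖z‖ * ‖Complex.sinh z‖ := fun ω => by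
    rw [norm_mul, norm_mul]
    have := (norm_nonneg _).trans (hC ω)
    gcongr
    exacts [hC ω, hb ω]
  have i1 : Integrable (fun ω => H ω * Complex.exp (-(z * m k ω)) * Complex.cosh z) μ :=
    .of_bound (by fun_prop) _ (ae_of_all _ hb2)
  have i2 : ∀ y : Ω → ℝ, Measurable y → (∀ ω, |y ω| ≤ 1) →
      Integrable (fun ω => H ω * Complex.exp (-(z * m k ω)) * Complex.sinh z * y ω) μ :=
    fun y hy hb => .of_bound (by fun_prop) (C * Real.exp ‖z‖ * ‖Complex.sinh z‖)
      (ae_of_all _ fun ω => by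
        rw [norm_mul, Complex.norm_real, Real.norm_eq_abs]
        have := norm_nonneg (H ω * Complex.exp (-(z * m k ω)) * Complex.sinh z)
        nlinarith [hb3 ω, hb ω, abs_nonneg (y ω)])
  have hmeas : Measurable[ℱ k] fun ω => H ω * Complex.exp (-(z * m k ω)) * Complex.sinh z := by
    have := h.predictable k
    exact (hH.mul (Complex.measurable_exp.comp
      ((Complex.measurable_ofReal.comp this).const_mul z).neg)).mul_const _
  simp_rw [e1]
  rw [integral_add i1 (i2 _ hx fun ω => (h.abs_sign k ω).le),
    h.integral_mul_sign_complex k hmeas hb3, ← integral_add i1 (i2 _ hm (h.abs_le k))]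
  refine integral_congr_ae (ae_of_all _ fun ω => ?_)
  simp only [twoPointMGF]
  ring

theorem integral_mul_exp (h : IsPredictedSigns μ ℱ x m) (k : ℕ) {H : Ω → ℝ}
    (hH : Measurable[ℱ k] H) {C : ℝ} (hC : ∀ ω, |H ω| ≤ C) (θ : ℝ) :
    ∫ ω, H ω * Real.exp (θ * (x k ω - m k ω)) ∂μ = ∫ ω, H ω * twoPointMGFReal θ (m k ω) ∂μ := by
  have := h.integral_mul_cexp k (H := fun ω => (H ω : ℂ)) (Complex.measurable_ofReal.comp hH)
    (C := C) (fun ω => by simpa using hC ω) θ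
  simp_rw [← ofReal_twoPointMGFReal] at this
  apply Complex.ofReal_injective
  rw [← integral_complex_ofReal, ← integral_complex_ofReal]
  simpa using this

theorem measurable_centredSum_adapted (h : IsPredictedSigns μ ℱ x m) (b : ℕ → ℝ) (N n : ℕ) :
    Measurable[ℱ n] (centredSum x m b N n) := by
  refine Finset.measurable_fun_sum _ fun k hk => ?_
  have hk := (Finset.mem_Ico.1 hk).2
  exact (((h.adapted k).mono (ℱ.mono hk) le_rfl).sub
    ((h.predictable k).mono (ℱ.mono hk.le) le_rfl)).const_mul _

theorem measurable_centredSum (h : IsPredictedSigns μ ℱ x m) (b : ℕ → ℝ) (N n : ℕ) :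
    Measurable (centredSum x m b N n) :=
  (h.measurable_centredSum_adapted b N n).mono (ℱ.le _) le_rfl

theorem abs_centredSum_le (h : IsPredictedSigns μ ℱ x m) (b : ℕ → ℝ) (N n : ℕ) (ω : Ω) :
    |centredSum x m b N n ω| ≤ ∑ k ∈ Finset.Ico N n, |b k| * 2 := by
  refine (Finset.abs_sum_le_sum_abs _ _).trans (Finset.sum_le_sum fun k _ => ?_)
  rw [abs_mul]
  gcongr
  exact h.abs_sub_le k ω

end IsPredictedSigns

end

section

namespace IsPredictedSigns

variable {Ω : Type*} [mΩ : MeasurableSpace Ω] {μ : Measure Ω} [IsProbabilityMeasure μ]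
  {ℱ : Filtration ℕ mΩ} {x m : ℕ → Ω → ℝ}

/-! ### Exponential moments -/

theorem integrable_mul_exp_centredSum (h : IsPredictedSigns μ ℱ x m) (b : ℕ → ℝ) (N n : ℕ)
    {H : Ω → ℝ} (hH : Measurable H) {C : ℝ} (hC : ∀ ω, |H ω| ≤ C) :
    Integrable (fun ω => H ω * Real.exp (centredSum x m b N n ω)) μ := by
  have := h.measurable_centredSum b N n
  refine .of_bound (by fun_prop) (C * Real.exp (∑ k ∈ Finset.Ico N n, |b k| * 2))
    (ae_of_all _ fun ω => ?_)
  rw [norm_mul, Real.norm_eq_abs, Real.norm_eq_abs, Real.abs_exp]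
  have := (abs_nonneg _).trans (hC ω)
  gcongr
  exacts [hC ω, (le_abs_self _).trans (h.abs_centredSum_le b N n ω)]

theorem integrable_exp_centredSum (h : IsPredictedSigns μ ℱ x m) (b : ℕ → ℝ) (N n : ℕ) :
    Integrable (fun ω => Real.exp (centredSum x m b N n ω)) μ := by
  simpa using h.integrable_mul_exp_centredSum b N n (H := fun _ => 1) measurable_const (C := 1)
    (by simp)

theorem integral_mul_exp_centredSum_succ (h : IsPredictedSigns μ ℱ x m) (b : ℕ → ℝ) {N n : ℕ}
    (hNn : N ≤ n) {H : Ω → ℝ} (hH : Measurable[ℱ n] H) {C : ℝ} (hC : ∀ ω, |H ω| ≤ C) :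
    ∫ ω, H ω * Real.exp (centredSum x m b N (n + 1) ω) ∂μ =
      ∫ ω, H ω * Real.exp (centredSum x m b N n ω) * twoPointMGFReal (b n) (m n ω) ∂μ := by
  rw [← h.integral_mul_exp n (C := C * Real.exp (∑ k ∈ Finset.Ico N n, |b k| * 2))]
  · simp_rw [centredSum_succ x m b hNn, Real.exp_add, mul_assoc]
  · exact hH.mul (Real.measurable_exp.comp (h.measurable_centredSum_adapted b N n))
  · intro ω
    rw [abs_mul, Real.abs_exp]
    have := (abs_nonneg _).trans (hC ω)
    gcongr
    exacts [hC ω, (le_abs_self _).trans (h.abs_centredSum_le b N n ω)]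

theorem measurable_twoPointMGFReal (θ : ℝ) : Measurable (twoPointMGFReal θ) := by
  unfold twoPointMGFReal; fun_prop

theorem integrable_mul_twoPointMGFReal (h : IsPredictedSigns μ ℱ x m) (θ : ℝ) (n : ℕ)
    {G : Ω → ℝ} (hG : Integrable G μ) :
    Integrable (fun ω => G ω * twoPointMGFReal θ (m n ω)) μ := by
  refine hG.mul_bdd (c := Real.exp (θ ^ 2 / 2))
    ((measurable_twoPointMGFReal θ).comp (h.measurable_pred n)).aestronglyMeasurable
    (ae_of_all _ fun ω => ?_)
  rw [Real.norm_eq_abs, abs_of_nonneg (twoPointMGFReal_nonneg _ (h.abs_le n ω))]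
  exact twoPointMGFReal_le _ (h.abs_le n ω)

/-- The last sign is integrated out repeatedly with Hoeffding's bound. The weight `H` carries an
event of the past, as the large deviation estimate requires. -/
theorem integral_mul_exp_centredSum_le (h : IsPredictedSigns μ ℱ x m) (b : ℕ → ℝ) {N n : ℕ}
    (hNn : N ≤ n) {H : Ω → ℝ} (hH : Measurable[ℱ N] H) {C : ℝ} (hC : ∀ ω, |H ω| ≤ C)
    (h0 : ∀ ω, 0 ≤ H ω) :
    ∫ ω, H ω * Real.exp (centredSum x m b N n ω) ∂μ ≤
      (∫ ω, H ω ∂μ) * Real.exp ((∑ k ∈ Finset.Ico N n, b k ^ 2) / 2) := by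
  induction n, hNn using Nat.le_induction with
  | base => simp
  | succ n hNn ih =>
    have hHm : Measurable H := hH.mono (ℱ.le _) le_rfl
    have hi := h.integrable_mul_exp_centredSum b N n hHm hC
    rw [h.integral_mul_exp_centredSum_succ b hNn (hH.mono (ℱ.mono hNn) le_rfl) hC,
      Finset.sum_Ico_succ_top hNn, add_div, Real.exp_add, ← mul_assoc]
    calc _ ≤ ∫ ω, H ω * Real.exp (centredSum x m b N n ω) * Real.exp (b n ^ 2 / 2) ∂μ := by
          refine integral_mono (h.integrable_mul_twoPointMGFReal _ _ hi) (hi.mul_const _)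
            fun ω => ?_
          have := h0 ω
          dsimp only
          gcongr
          exact twoPointMGFReal_le _ (h.abs_le n ω)
      _ ≤ _ := by
        rw [integral_mul_const]
        gcongr

theorem integral_exp_centredSum_le (h : IsPredictedSigns μ ℱ x m) (b : ℕ → ℝ) {N n : ℕ}
    (hNn : N ≤ n) :
    ∫ ω, Real.exp (centredSum x m b N n ω) ∂μ ≤
      Real.exp ((∑ k ∈ Finset.Ico N n, b k ^ 2) / 2) := by
  simpa using h.integral_mul_exp_centredSum_le b hNn (H := fun _ => 1) measurable_const (C := 1)
    (by simp) (by simp)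

/-! ### The maximal inequality -/

theorem submartingale_exp_centredSum (h : IsPredictedSigns μ ℱ x m) (b : ℕ → ℝ) (N : ℕ) :
    Submartingale (fun n ω => Real.exp (centredSum x m b N n ω)) ℱ μ := by
  refine submartingale_of_setIntegral_le_succ (fun n => ?_)
    (fun n => h.integrable_exp_centredSum b N n) fun n s hs => ?_
  · exact (Real.measurable_exp.comp (h.measurable_centredSum_adapted b N n)).stronglyMeasurable
  · have hs' := ℱ.le _ _ hs
    -- Up to time `N` the sum is empty and the exponential constant, so only `n ≥ N` needs an
    -- argument.
    rcases lt_or_ge n N with hn | hn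
    · simp [centredSum, Finset.Ico_eq_empty_of_le hn.le,
        Finset.Ico_eq_empty_of_le (Nat.succ_le_of_lt hn)]
    · have hH : Measurable[ℱ n] (s.indicator (1 : Ω → ℝ)) :=
        (@measurable_const _ _ _ (ℱ n) (1 : ℝ)).indicator hs
      have hHm : Measurable (s.indicator (1 : Ω → ℝ)) := hH.mono (ℱ.le _) le_rfl
      have hb : ∀ ω, |s.indicator (1 : Ω → ℝ) ω| ≤ 1 := fun ω => by
        by_cases hω : ω ∈ s <;> simp [hω]
      have e : ∀ l, ∫ ω in s, Real.exp (centredSum x m b N l ω) ∂μ =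
          ∫ ω, s.indicator (1 : Ω → ℝ) ω * Real.exp (centredSum x m b N l ω) ∂μ := fun l => by
        rw [← integral_indicator hs']
        congr 1 with ω
        by_cases hω : ω ∈ s <;> simp [hω]
      rw [e, e, h.integral_mul_exp_centredSum_succ b hn hH hb]
      have hi := h.integrable_mul_exp_centredSum b N n hHm hb
      refine integral_mono hi (h.integrable_mul_twoPointMGFReal _ _ hi) fun ω => ?_
      have h0 : 0 ≤ s.indicator (1 : Ω → ℝ) ω * Real.exp (centredSum x m b N n ω) :=
        mul_nonneg (Set.indicator_nonneg (by simp) _) (Real.exp_pos _).le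
      exact le_mul_of_one_le_right h0 (one_le_twoPointMGFReal _ (h.abs_le n ω))

/-- Doob's maximal inequality for the exponential submartingale at level `exp y`. -/
theorem measure_exists_le_centredSum_le (h : IsPredictedSigns μ ℱ x m) (b : ℕ → ℝ) {N n : ℕ}
    (hNn : N ≤ n) (y : ℝ) :
    μ.real {ω | ∃ l ≤ n, y ≤ centredSum x m b N l ω} ≤
      Real.exp (-y + (∑ k ∈ Finset.Ico N n, b k ^ 2) / 2) := by
  have hmax := maximal_ineq (h.submartingale_exp_centredSum b N) (fun _ _ => (Real.exp_pos _).le)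
    (ε := (Real.exp y).toNNReal) n
  simp only [Finset.le_sup'_iff, Finset.mem_range, Real.coe_toNNReal _ (Real.exp_pos y).le,
    Real.exp_le_exp, Nat.lt_succ_iff] at hmax
  set s := {ω | ∃ l ≤ n, y ≤ centredSum x m b N l ω}
  have hint : ∫ ω in s, Real.exp (centredSum x m b N n ω) ∂μ ≤
      Real.exp ((∑ k ∈ Finset.Ico N n, b k ^ 2) / 2) :=
    (setIntegral_le_integral (h.integrable_exp_centredSum b N n)
      (ae_of_all _ fun _ => (Real.exp_pos _).le)).trans (h.integral_exp_centredSum_le b hNn)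
  have h2 := ENNReal.toReal_mono ENNReal.ofReal_ne_top
    (hmax.trans (ENNReal.ofReal_le_ofReal hint))
  rw [ENNReal.toReal_mul, ENNReal.toReal_ofReal (Real.exp_pos _).le, ENNReal.coe_toReal,
    Real.coe_toNNReal _ (Real.exp_pos y).le] at h2
  change Real.exp y * μ.real s ≤ _ at h2
  rw [Real.exp_add, Real.exp_neg, inv_mul_eq_div, le_div_iff₀ (Real.exp_pos _)]
  linarith

theorem measure_exists_le_centredSum_le_exp (h : IsPredictedSigns μ ℱ x m) (a : ℕ → ℝ) {N n : ℕ}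
    (hNn : N ≤ n) {y v : ℝ} (hy : 0 ≤ y) (hv : 0 < v) (hV : ∑ k ∈ Finset.Ico N n, a k ^ 2 ≤ v) :
    μ.real {ω | ∃ l ≤ n, y ≤ centredSum x m a N l ω} ≤ Real.exp (-(y ^ 2 / (2 * v))) := by
  -- The scaling `θ = y / v` minimises `-θ * y + θ ^ 2 * v / 2`.
  have h1 := h.measure_exists_le_centredSum_le (fun k => y / v * a k) hNn (y / v * y)
  simp_rw [centredSum_mul, mul_pow, ← Finset.mul_sum] at h1
  refine (measureReal_mono ?_).trans (h1.trans (Real.exp_le_exp.2 ?_))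
  · rintro ω ⟨l, hl, hyl⟩
    exact ⟨l, hl, by gcongr⟩
  · calc _ ≤ -(y / v * y) + (y / v) ^ 2 * v / 2 := by gcongr
      _ = _ := by field_simp; ring

/-! ### Characteristic functions -/

/-- The conditional characteristic functions are replaced by Gaussian ones, one factor at a time.
All other factors have modulus at most `1`, so the one-step errors simply add up, and the prediction
enters only through its mean square. -/
theorem norm_charFun_centredSum_sub_le (h : IsPredictedSigns μ ℱ x m) (b : ℕ → ℝ) {N n : ℕ}
    (hNn : N ≤ n) (hb : ∀ k ∈ Finset.Ico N n, |b k| ≤ 1) :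
    ‖∫ ω, Complex.exp (Complex.I * centredSum x m b N n ω) ∂μ -
        Complex.exp (-(∑ k ∈ Finset.Ico N n, b k ^ 2 : ℝ) / 2)‖ ≤
      65 * ∑ k ∈ Finset.Ico N n, (|b k| ^ 3 + b k ^ 2 * ∫ ω, m k ω ^ 2 ∂μ) := by
  induction n, hNn using Nat.le_induction with
  | base => simp
  | succ n hNn ih =>
    have ih := ih fun k hk => hb k (Finset.Ico_subset_Ico_right (Nat.le_succ n) hk)
    have hbn := hb n (by simp [hNn])
    set V : ℝ := ∑ k ∈ Finset.Ico N n, b k ^ 2 with hV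
    have hm := h.measurable_pred n
    have hS := h.measurable_centredSum b N n
    set E : Ω → ℂ := fun ω => Complex.exp (Complex.I * centredSum x m b N n ω) with hE
    have hEm : Measurable E := by fun_prop
    have hE1 : ∀ ω, ‖E ω‖ = 1 := fun ω => by
      rw [hE]; simp only; rw [mul_comm]; exact Complex.norm_exp_ofReal_mul_I _
    have hz : ‖(Complex.I * b n : ℂ)‖ = |b n| := by simp
    have e1 : ∫ ω, Complex.exp (Complex.I * centredSum x m b N (n + 1) ω) ∂μ =
        ∫ ω, E ω * twoPointMGF (Complex.I * b n) (m n ω) ∂μ := by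
      rw [← h.integral_mul_cexp n (C := 1) _ (fun ω => (hE1 ω).le)]
      · refine integral_congr_ae (ae_of_all _ fun ω => ?_)
        simp only [centredSum_succ x m b hNn, hE, ← Complex.exp_add]
        push_cast
        ring_nf
      · exact Complex.measurable_exp.comp ((Complex.measurable_ofReal.comp
          (h.measurable_centredSum_adapted b N n)).const_mul _)
    have hg : Measurable fun ω => twoPointMGF (Complex.I * b n) (m n ω) := by
      unfold twoPointMGF; fun_prop
    have hsq : (Complex.I * b n : ℂ) ^ 2 / 2 = ((-(b n ^ 2 / 2) : ℝ) : ℂ) := by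
      rw [mul_pow, Complex.I_sq]; push_cast; ring
    have hgb : ∀ ω, ‖twoPointMGF (Complex.I * b n) (m n ω) -
        Complex.exp ((Complex.I * b n) ^ 2 / 2)‖ ≤ 65 * (|b n| ^ 3 + b n ^ 2 * m n ω ^ 2) := by
      intro ω
      have := norm_twoPointMGF_sub_le (z := Complex.I * b n) (m := m n ω) (by rwa [hz])
        (h.abs_le n ω)
      rwa [hz, sq_abs] at this
    have hm2 : Integrable (fun ω => m n ω ^ 2) μ :=
      .of_bound (by fun_prop) 1 (ae_of_all _ fun ω => by
        rw [Real.norm_eq_abs, abs_pow]; exact pow_le_one₀ (abs_nonneg _) (h.abs_le n ω))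
    have hdi : Integrable (fun ω => 65 * (|b n| ^ 3 + b n ^ 2 * m n ω ^ 2)) μ :=
      ((integrable_const _).add (hm2.const_mul _)).const_mul _
    have iE : Integrable E μ := .of_bound (by fun_prop) 1 (ae_of_all _ fun ω => (hE1 ω).le)
    have hD : Integrable (fun ω => E ω * (twoPointMGF (Complex.I * b n) (m n ω) -
        Complex.exp ((Complex.I * b n) ^ 2 / 2))) μ :=
      hdi.mono' (by fun_prop) (ae_of_all _ fun ω => by rw [norm_mul, hE1, one_mul]; exact hgb ω)
    have e2 : ∫ ω, E ω * twoPointMGF (Complex.I * b n) (m n ω) ∂μ =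
        (∫ ω, E ω * (twoPointMGF (Complex.I * b n) (m n ω) -
          Complex.exp ((Complex.I * b n) ^ 2 / 2)) ∂μ) +
        (∫ ω, E ω ∂μ) * Complex.exp ((Complex.I * b n) ^ 2 / 2) := by
      rw [← integral_mul_const, ← integral_add hD (iE.mul_const _)]
      congr 1 with ω
      ring
    have e3 : Complex.exp (-((V + b n ^ 2 : ℝ) : ℂ) / 2) =
        Complex.exp (-(V : ℂ) / 2) * Complex.exp ((Complex.I * b n) ^ 2 / 2) := by
      rw [hsq, ← Complex.exp_add]; push_cast; ring_nf
    rw [Finset.sum_Ico_succ_top hNn, Finset.sum_Ico_succ_top hNn, ← hV, e1, e2, e3,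
      add_sub_assoc, ← sub_mul]
    have n1 : ‖Complex.exp ((Complex.I * b n) ^ 2 / 2)‖ ≤ 1 := by
      rw [hsq, Complex.norm_exp_ofReal]
      exact Real.exp_le_one_iff.2 (by have := sq_nonneg (b n); linarith)
    have n2 : ‖∫ ω, E ω * (twoPointMGF (Complex.I * b n) (m n ω) -
          Complex.exp ((Complex.I * b n) ^ 2 / 2)) ∂μ‖ ≤
        65 * (|b n| ^ 3 + b n ^ 2 * ∫ ω, m n ω ^ 2 ∂μ) := by
      calc _ ≤ ∫ ω, 65 * (|b n| ^ 3 + b n ^ 2 * m n ω ^ 2) ∂μ :=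
            norm_integral_le_of_norm_le hdi (ae_of_all _ fun ω => by
              rw [norm_mul, hE1, one_mul]; exact hgb ω)
        _ = _ := by
          rw [integral_const_mul, integral_add (integrable_const _) (hm2.const_mul _),
            integral_const_mul]
          simp
    have n3 := mul_le_of_le_one_right (norm_nonneg (∫ ω, E ω ∂μ - Complex.exp (-(V : ℂ) / 2))) n1
    refine (norm_add_le _ _).trans ?_
    rw [norm_mul]
    linarith

/-! ### A lower bound for exponential moments and large deviations -/

/-- The converse of Hoeffding's bound, by the same replacement of factors. The exponential is now
unbounded and correlated with `m`, which costs a factor `exp (2 * T)` in the error; `T` is fixed in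
advance so that this factor does not grow along the induction. The error does not scale with `μ.real
A` and has to be summable over the blocks later on. -/
theorem le_integral_indicator_mul_exp_centredSum (h : IsPredictedSigns μ ℱ x m) (b : ℕ → ℝ)
    {N n : ℕ} (hNn : N ≤ n) (hb : ∀ k ∈ Finset.Ico N n, |b k| ≤ 1) {κ : ℝ} (hκ : 0 < κ)
    (hmκ : ∀ k ∈ Finset.Ico N n, ∫ ω, m k ω ^ 2 ∂μ ≤ κ ^ 2) {T : ℝ}
    (hT : ∑ k ∈ Finset.Ico N n, b k ^ 2 ≤ T) {A : Set Ω} (hA : MeasurableSet[ℱ N] A) :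
    Real.exp ((∑ k ∈ Finset.Ico N n, b k ^ 2) / 2) *
        (μ.real A * (1 - 65 * ∑ k ∈ Finset.Ico N n, |b k| ^ 3) -
          65 * (Real.exp (2 * T) * κ * ∑ k ∈ Finset.Ico N n, b k ^ 2)) ≤
      ∫ ω, A.indicator 1 ω * Real.exp (centredSum x m b N n ω) ∂μ := by
  have hH : Measurable[ℱ N] (A.indicator (1 : Ω → ℝ)) :=
    (@measurable_const _ _ _ (ℱ N) (1 : ℝ)).indicator hA
  have hHm : Measurable (A.indicator (1 : Ω → ℝ)) := hH.mono (ℱ.le _) le_rfl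
  have hA' := ℱ.le _ _ hA
  have hH0 : ∀ ω, 0 ≤ A.indicator (1 : Ω → ℝ) ω := fun ω => Set.indicator_nonneg (by simp) _
  have hH1 : ∀ ω, A.indicator (1 : Ω → ℝ) ω ≤ 1 := fun ω => by
    by_cases hω : ω ∈ A <;> simp [hω]
  have hHb : ∀ ω, |A.indicator (1 : Ω → ℝ) ω| ≤ 1 := fun ω => by
    rw [abs_of_nonneg (hH0 ω)]; exact hH1 ω
  have hHA : ∫ ω, A.indicator (1 : Ω → ℝ) ω ∂μ = μ.real A := integral_indicator_one hA'
  induction n, hNn using Nat.le_induction with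
  | base => simp [hHA]
  | succ n hNn ih =>
    have hsub : Finset.Ico N n ⊆ Finset.Ico N (n + 1) := Finset.Ico_subset_Ico_right (Nat.le_succ n)
    rw [Finset.sum_Ico_succ_top hNn] at hT
    have ih := ih (fun k hk => hb k (hsub hk)) (fun k hk => hmκ k (hsub hk))
      (by linarith [sq_nonneg (b n)])
    have hbn := hb n (by simp [hNn])
    have hmn := hmκ n (by simp [hNn])
    rw [h.integral_mul_exp_centredSum_succ b hNn (hH.mono (ℱ.mono hNn) le_rfl) hHb,
      Finset.sum_Ico_succ_top hNn, Finset.sum_Ico_succ_top hNn]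
    set V := ∑ k ∈ Finset.Ico N n, b k ^ 2 with hV
    set W := ∑ k ∈ Finset.Ico N n, |b k| ^ 3
    have hV0 : 0 ≤ V := Finset.sum_nonneg fun k _ => sq_nonneg _
    set G : Ω → ℝ := fun ω => A.indicator 1 ω * Real.exp (centredSum x m b N n ω) with hG
    have iG : Integrable G μ := h.integrable_mul_exp_centredSum b N n hHm hHb
    have hG0 : ∀ ω, 0 ≤ G ω := fun ω => mul_nonneg (hH0 ω) (Real.exp_pos _).le
    have hGle : ∫ ω, G ω ∂μ ≤ μ.real A * Real.exp (V / 2) := by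
      have := h.integral_mul_exp_centredSum_le b hNn hH hHb hH0
      rwa [hHA] at this
    have hm := h.measurable_pred n
    have hm1 : ∀ ω, m n ω ^ 2 ≤ 1 := fun ω => by
      rw [← sq_abs]; exact pow_le_one₀ (abs_nonneg _) (h.abs_le n ω)
    have hm2 : Integrable (fun ω => m n ω ^ 2) μ :=
      .of_bound (by fun_prop) 1 (ae_of_all _ fun ω => by
        rw [Real.norm_eq_abs, abs_of_nonneg (sq_nonneg _)]; exact hm1 ω)
    have iGm : Integrable (fun ω => G ω * m n ω ^ 2) μ :=
      iG.mul_bdd (c := 1) (by fun_prop) (ae_of_all _ fun ω => by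
        rw [Real.norm_eq_abs, abs_of_nonneg (sq_nonneg _)]; exact hm1 ω)
    have i2 : Integrable (fun ω => Real.exp (2 * centredSum x m b N n ω)) μ := by
      simp_rw [← centredSum_mul]
      exact h.integrable_exp_centredSum _ N n
    have hE2 : ∫ ω, Real.exp (2 * centredSum x m b N n ω) ∂μ ≤ Real.exp (2 * V) := by
      simp_rw [← centredSum_mul]
      refine (h.integral_exp_centredSum_le _ hNn).trans_eq ?_
      simp_rw [mul_pow, ← Finset.mul_sum]
      rw [← hV]; ring_nf
    -- Decoupling by `E * m ^ 2 ≤ κ / 2 * E ^ 2 + m ^ 4 / (2 * κ)` and `m ^ 4 ≤ m ^ 2`; the weight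
    -- `κ` balances the two terms because `E[m ^ 2] ≤ κ ^ 2`.
    have hGm : ∫ ω, G ω * m n ω ^ 2 ∂μ ≤ κ * Real.exp (2 * T) := by
      calc ∫ ω, G ω * m n ω ^ 2 ∂μ
          ≤ ∫ ω, (κ / 2 * Real.exp (2 * centredSum x m b N n ω) + 1 / (2 * κ) * m n ω ^ 2) ∂μ := by
            refine integral_mono iGm ((i2.const_mul _).add (hm2.const_mul _)) fun ω => ?_
            have e2 : Real.exp (2 * centredSum x m b N n ω) =
                Real.exp (centredSum x m b N n ω) ^ 2 := by
              rw [← Real.exp_nat_mul]; norm_num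
            have hE := Real.exp_pos (centredSum x m b N n ω)
            simp only [e2, hG]
            set E := Real.exp (centredSum x m b N n ω)
            calc _ ≤ 1 * E * m n ω ^ 2 := by gcongr; exact hH1 ω
              _ ≤ κ / 2 * E ^ 2 + 1 / (2 * κ) * (m n ω ^ 2) ^ 2 := by
                have := sq_nonneg (κ * E - m n ω ^ 2)
                rw [← sub_nonneg]
                have e : κ / 2 * E ^ 2 + 1 / (2 * κ) * (m n ω ^ 2) ^ 2 - 1 * E * m n ω ^ 2 =
                  (κ * E - m n ω ^ 2) ^ 2 / (2 * κ) := by field_simp; ring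
                rw [e]; positivity
              _ ≤ _ := by
                refine add_le_add le_rfl (mul_le_mul_of_nonneg_left ?_ (by positivity))
                nlinarith [hm1 ω, sq_nonneg (m n ω)]
        _ = κ / 2 * (∫ ω, Real.exp (2 * centredSum x m b N n ω) ∂μ) +
            1 / (2 * κ) * ∫ ω, m n ω ^ 2 ∂μ := by
            rw [integral_add (i2.const_mul _) (hm2.const_mul _), integral_const_mul,
              integral_const_mul]
        _ ≤ κ / 2 * Real.exp (2 * V) + 1 / (2 * κ) * κ ^ 2 := by gcongr
        _ = κ / 2 * Real.exp (2 * V) + κ / 2 * 1 := by field_simp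
        _ ≤ κ / 2 * Real.exp (2 * T) + κ / 2 * Real.exp (2 * T) := by
            have : V ≤ T := by linarith [sq_nonneg (b n)]
            gcongr
            exact Real.one_le_exp (by linarith)
        _ = _ := by ring
    have iGG : Integrable
        (fun ω => Real.exp (b n ^ 2 / 2) * G ω - 65 * |b n| ^ 3 * G ω) μ :=
      (iG.const_mul _).sub (iG.const_mul _)
    have step : Real.exp (b n ^ 2 / 2) * (∫ ω, G ω ∂μ) - 65 * |b n| ^ 3 * (∫ ω, G ω ∂μ) -
        65 * b n ^ 2 * (∫ ω, G ω * m n ω ^ 2 ∂μ) ≤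
        ∫ ω, G ω * twoPointMGFReal (b n) (m n ω) ∂μ := by
      rw [← integral_const_mul, ← integral_const_mul, ← integral_const_mul,
        ← integral_sub (iG.const_mul _) (iG.const_mul _),
        ← integral_sub iGG (iGm.const_mul _)]
      refine integral_mono (iGG.sub (iGm.const_mul _))
        (h.integrable_mul_twoPointMGFReal _ _ iG) fun ω => ?_
      have := mul_le_mul_of_nonneg_left (exp_sub_twoPointMGFReal_le hbn (h.abs_le n ω)) (hG0 ω)
      simp only
      nlinarith
    refine le_trans ?_ step
    have hP : 0 ≤ μ.real A := measureReal_nonneg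
    have hexp : Real.exp ((V + b n ^ 2) / 2) = Real.exp (b n ^ 2 / 2) * Real.exp (V / 2) := by
      rw [← Real.exp_add]; ring_nf
    have hge1 : 1 ≤ Real.exp (b n ^ 2 / 2) := Real.one_le_exp (by positivity)
    have hge2 : 1 ≤ Real.exp (V / 2) := Real.one_le_exp (by positivity)
    have t1 := mul_le_mul_of_nonneg_left ih (Real.exp_pos (b n ^ 2 / 2)).le
    have hb3 : 0 ≤ |b n| ^ 3 := by positivity
    have t2 : |b n| ^ 3 * (∫ ω, G ω ∂μ) ≤
        |b n| ^ 3 * (μ.real A * (Real.exp (b n ^ 2 / 2) * Real.exp (V / 2))) := by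
      refine mul_le_mul_of_nonneg_left (hGle.trans ?_) hb3
      gcongr
      exact le_mul_of_one_le_left (Real.exp_pos _).le hge1
    have t3 : b n ^ 2 * (∫ ω, G ω * m n ω ^ 2 ∂μ) ≤
        b n ^ 2 * (κ * Real.exp (2 * T) * (Real.exp (b n ^ 2 / 2) * Real.exp (V / 2))) := by
      refine mul_le_mul_of_nonneg_left (hGm.trans ?_) (sq_nonneg _)
      exact le_mul_of_one_le_right (by positivity) (one_le_mul_of_one_le_of_one_le hge1 hge2)
    rw [hexp]
    nlinarith

/-- Under the law tilted by `exp t`, the sum concentrates near its variance `X`. The two tails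
outside the window between `(1 - δ) * X` and `(1 + δ) * X` are bounded by Chernoff's method, with
the exponent lowered to `1 - δ` or raised to `1 + δ`. -/
theorem exp_le_window {t X δ : ℝ} (hδ0 : 0 ≤ δ) :
    Real.exp t ≤ Real.exp ((1 + δ) * X) * (Set.Ici ((1 - δ) * X)).indicator 1 t +
      Real.exp (δ * (1 - δ) * X) * Real.exp ((1 - δ) * t) +
      Real.exp (-(δ * (1 + δ) * X)) * Real.exp ((1 + δ) * t) := by
  have p1 : 0 ≤ Real.exp (δ * (1 - δ) * X) * Real.exp ((1 - δ) * t) := by positivity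
  have p2 : 0 ≤ Real.exp (-(δ * (1 + δ) * X)) * Real.exp ((1 + δ) * t) := by positivity
  rcases lt_or_ge t ((1 - δ) * X) with h1 | h1
  · rw [Set.indicator_of_notMem (by simpa using h1), ← Real.exp_add (δ * (1 - δ) * X)]
    have : Real.exp t ≤ Real.exp (δ * (1 - δ) * X + (1 - δ) * t) :=
      Real.exp_le_exp.2 (by nlinarith)
    linarith
  · rw [Set.indicator_of_mem (by simpa using h1), Pi.one_apply, mul_one]
    rcases le_or_gt t ((1 + δ) * X) with h2 | h2
    · have := Real.exp_le_exp.2 h2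
      linarith
    · rw [← Real.exp_add (-(δ * (1 + δ) * X))]
      have : Real.exp t ≤ Real.exp (-(δ * (1 + δ) * X) + (1 + δ) * t) :=
        Real.exp_le_exp.2 (by nlinarith)
      have := Real.exp_pos ((1 + δ) * X)
      linarith

/-- Large deviations of a block sum, uniformly over the events of the past. -/
theorem le_measure_inter_large_centredSum (h : IsPredictedSigns μ ℱ x m) (b : ℕ → ℝ)
    {N n : ℕ} (hNn : N ≤ n) (hb : ∀ k ∈ Finset.Ico N n, |b k| ≤ 1) {κ : ℝ} (hκ : 0 < κ)
    (hmκ : ∀ k ∈ Finset.Ico N n, ∫ ω, m k ω ^ 2 ∂μ ≤ κ ^ 2) {X δ : ℝ}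
    (hX : ∑ k ∈ Finset.Ico N n, b k ^ 2 = X) (hδ0 : 0 ≤ δ)
    (hb3 : 65 * ∑ k ∈ Finset.Ico N n, |b k| ^ 3 ≤ 1 / 4)
    (hXδ : 2 * Real.exp (-(X * δ ^ 2 / 2)) ≤ 1 / 4)
    {A : Set Ω} (hA : MeasurableSet[ℱ N] A) :
    Real.exp (-((1 / 2 + δ) * X)) / 2 * μ.real A - 65 * (Real.exp (2 * X) * κ * X) ≤
      μ.real (A ∩ {ω | (1 - δ) * X ≤ centredSum x m b N n ω}) := by
  have hX0 : 0 ≤ X := hX ▸ Finset.sum_nonneg fun k _ => sq_nonneg _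
  have hH : Measurable[ℱ N] (A.indicator (1 : Ω → ℝ)) :=
    (@measurable_const _ _ _ (ℱ N) (1 : ℝ)).indicator hA
  have hHm : Measurable (A.indicator (1 : Ω → ℝ)) := hH.mono (ℱ.le _) le_rfl
  have hA' := ℱ.le _ _ hA
  have hS := h.measurable_centredSum b N n
  have hH0 : ∀ ω, 0 ≤ A.indicator (1 : Ω → ℝ) ω := fun ω => Set.indicator_nonneg (by simp) _
  have hHb : ∀ ω, |A.indicator (1 : Ω → ℝ) ω| ≤ 1 := fun ω => by
    by_cases hω : ω ∈ A <;> simp [hω]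
  have hHA : ∫ ω, A.indicator (1 : Ω → ℝ) ω ∂μ = μ.real A := integral_indicator_one hA'
  have lower := h.le_integral_indicator_mul_exp_centredSum b hNn hb hκ hmκ hX.le hA
  rw [hX] at lower
  have hi (c : ℝ) : Integrable
      (fun ω => A.indicator 1 ω * Real.exp (c * centredSum x m b N n ω)) μ := by
    simp_rw [← centredSum_mul]
    exact h.integrable_mul_exp_centredSum _ N n hHm hHb
  have upper (c : ℝ) : ∫ ω, A.indicator 1 ω * Real.exp (c * centredSum x m b N n ω) ∂μ ≤
      μ.real A * Real.exp (c ^ 2 * X / 2) := by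
    have := h.integral_mul_exp_centredSum_le (fun k => c * b k) hNn hH hHb hH0
    simp_rw [centredSum_mul, mul_pow, ← Finset.mul_sum] at this
    rwa [hHA, hX] at this
  set B := {ω | (1 - δ) * X ≤ centredSum x m b N n ω} with hB
  have hBm : MeasurableSet B := measurableSet_le measurable_const hS
  have hiB : Integrable ((A ∩ B).indicator (1 : Ω → ℝ)) μ :=
    (integrable_const (1 : ℝ)).indicator (hA'.inter hBm)
  have hiAB : Integrable (fun ω => Real.exp ((1 + δ) * X) * (A ∩ B).indicator 1 ω +
      Real.exp (δ * (1 - δ) * X) *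
        (A.indicator 1 ω * Real.exp ((1 - δ) * centredSum x m b N n ω))) μ :=
    (hiB.const_mul _).add ((hi _).const_mul _)
  have main : ∫ ω, A.indicator 1 ω * Real.exp (centredSum x m b N n ω) ∂μ ≤
      Real.exp ((1 + δ) * X) * μ.real (A ∩ B) +
      Real.exp (δ * (1 - δ) * X) *
        (∫ ω, A.indicator 1 ω * Real.exp ((1 - δ) * centredSum x m b N n ω) ∂μ) +
      Real.exp (-(δ * (1 + δ) * X)) *
        (∫ ω, A.indicator 1 ω * Real.exp ((1 + δ) * centredSum x m b N n ω) ∂μ) := by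
    rw [← integral_indicator_one (hA'.inter hBm), ← integral_const_mul, ← integral_const_mul,
      ← integral_const_mul, ← integral_add (hiB.const_mul _) ((hi _).const_mul _),
      ← integral_add hiAB ((hi _).const_mul _)]
    refine integral_mono (by simpa using hi 1) (hiAB.add ((hi _).const_mul _)) fun ω => ?_
    have := mul_le_mul_of_nonneg_left (exp_le_window (t := centredSum x m b N n ω) (X := X) hδ0)
      (hH0 ω)
    refine this.trans_eq ?_
    have : (A ∩ B).indicator (1 : Ω → ℝ) ω = A.indicator 1 ω *
        (Set.Ici ((1 - δ) * X)).indicator 1 (centredSum x m b N n ω) := by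
      by_cases h1 : ω ∈ A <;> by_cases h2 : (1 - δ) * X ≤ centredSum x m b N n ω <;>
        simp [Set.indicator, h1, h2, hB]
    simp only [this]
    ring
  have hP : 0 ≤ μ.real A := measureReal_nonneg
  have u1 := mul_le_mul_of_nonneg_left (upper (1 - δ)) (Real.exp_pos (δ * (1 - δ) * X)).le
  have u2 := mul_le_mul_of_nonneg_left (upper (1 + δ)) (Real.exp_pos (-(δ * (1 + δ) * X))).le
  -- Each tail contributes `μ.real A * exp ((1 - δ ^ 2) * X / 2)`, smaller than the main term `exp
  -- (X / 2)` by the factor `exp (-(X * δ ^ 2 / 2))`.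
  have f1 : Real.exp (δ * (1 - δ) * X) * (μ.real A * Real.exp ((1 - δ) ^ 2 * X / 2)) =
      μ.real A * (Real.exp (X / 2) * Real.exp (-(X * δ ^ 2 / 2))) := by
    rw [mul_left_comm, ← Real.exp_add, ← Real.exp_add]; ring_nf
  have f2 : Real.exp (-(δ * (1 + δ) * X)) * (μ.real A * Real.exp ((1 + δ) ^ 2 * X / 2)) =
      μ.real A * (Real.exp (X / 2) * Real.exp (-(X * δ ^ 2 / 2))) := by
    rw [mul_left_comm, ← Real.exp_add, ← Real.exp_add]; ring_nf
  have f3 : Real.exp ((1 + δ) * X) * Real.exp (-((1 / 2 + δ) * X)) = Real.exp (X / 2) := by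
    rw [← Real.exp_add]; ring_nf
  set P := μ.real A
  set Q := μ.real (A ∩ B)
  set E := Real.exp (X / 2)
  set F := Real.exp (-(X * δ ^ 2 / 2))
  set R := 65 * (Real.exp (2 * X) * κ * X) with hR
  have hR0 : 0 ≤ R := by positivity
  set L := Real.exp ((1 + δ) * X)
  set D := Real.exp (-((1 / 2 + δ) * X))
  have hE : 0 < E := Real.exp_pos _
  have hL : 0 < L := Real.exp_pos _
  have hD0 : 0 < D := Real.exp_pos _
  have hD1 : D ≤ 1 := Real.exp_le_one_iff.2 (by nlinarith)
  have k1 : P * (3 / 4) ≤ P * (1 - 65 * ∑ k ∈ Finset.Ico N n, |b k| ^ 3) :=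
    mul_le_mul_of_nonneg_left (by linarith) hP
  have k2 : E * (P * (3 / 4) - R) ≤ E * (P * (1 - 65 * ∑ k ∈ Finset.Ico N n, |b k| ^ 3) - R) :=
    mul_le_mul_of_nonneg_left (by linarith) hE.le
  have k3 : P * E * (2 * F) ≤ P * E * (1 / 4) := mul_le_mul_of_nonneg_left hXδ (by positivity)
  -- The lower bound leaves `3 / 4` of `E * P`, and the two tails together take at most `1 / 4`.
  -- Division by `L` gives the rate `1 / 2 + δ`, and `D ≤ 1` keeps the error at most `R`.
  have k4 : E * (P / 2 - R) ≤ L * Q := by nlinarith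
  rw [← f3, mul_assoc] at k4
  have k5 := le_of_mul_le_mul_left k4 hL
  nlinarith

end IsPredictedSigns

/-! ### A Borel-Cantelli lemma -/

/-- A second Borel-Cantelli lemma in which independence is replaced by a lower bound against every
past event, up to a summable error. Avoiding one more event multiplies the avoidance probability by
at most `1 - c j ≤ exp (-c j)` and adds at most `b j`; as `∑ c j` diverges, only a tail of `∑ b j`
survives. -/
theorem ae_frequently_of_le_measure_inter {Ω : Type*} [mΩ : MeasurableSpace Ω] {μ : Measure Ω}
    [IsProbabilityMeasure μ] {𝒢 : ℕ → MeasurableSpace Ω} (hmono : Monotone 𝒢)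
    (hle : ∀ j, 𝒢 j ≤ mΩ) {A : ℕ → Set Ω} (hA : ∀ j, MeasurableSet[𝒢 (j + 1)] (A j))
    {c b : ℕ → ℝ} (hc1 : ∀ᶠ j in atTop, c j ∈ Set.Icc (0 : ℝ) 1)
    (hc : Tendsto (fun n => ∑ j ∈ Finset.range n, c j) atTop atTop) (hb0 : ∀ j, 0 ≤ b j)
    (hb : Summable b)
    (hAc : ∀ᶠ j in atTop, ∀ B, MeasurableSet[𝒢 j] B → c j * μ.real B - b j ≤ μ.real (B ∩ A j)) :
    ∀ᵐ ω ∂μ, ∃ᶠ j in atTop, ω ∈ A j := by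
  obtain ⟨J, hJ⟩ := eventually_atTop.1 (hc1.and hAc)
  have hAm : ∀ j, MeasurableSet (A j) := fun j => hle _ _ (hA j)
  -- probability of avoiding all events from `i` up to `n`
  let E : ℕ → ℕ → Set Ω := fun i n => ⋂ j ∈ Finset.Ico i n, (A j)ᶜ
  have hEm : ∀ i n, MeasurableSet[𝒢 n] (E i n) := fun i n =>
    Finset.measurableSet_biInter _ fun j hj =>
      (hmono (Nat.succ_le_of_lt (Finset.mem_Ico.1 hj).2) _ (hA j)).compl
  have hEb : ∀ i, J ≤ i → ∀ n, i ≤ n → μ.real (E i n) ≤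
      Real.exp (-∑ j ∈ Finset.Ico i n, c j) + ∑ j ∈ Finset.Ico i n, b j := by
    intro i hi n hn
    induction n, hn using Nat.le_induction with
    | base => simp [E]
    | succ n hn ih =>
      obtain ⟨⟨h0, h1⟩, hAn⟩ := hJ n (hi.trans hn)
      have key := hAn _ (hEm i n)
      have hs : E i (n + 1) = E i n \ A n := by
        ext ω
        simp only [E, Set.mem_iInter, Finset.mem_Ico, Set.mem_sdiff, Set.mem_compl_iff]
        constructor
        · exact fun h => ⟨fun j hj => h j ⟨hj.1, by omega⟩, h n ⟨hn, by omega⟩⟩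
        · rintro ⟨h, h'⟩ j ⟨hj1, hj2⟩
          rcases Nat.lt_succ_iff_lt_or_eq.1 hj2 with h3 | rfl
          exacts [h j ⟨hj1, h3⟩, h']
      have hd : μ.real (E i (n + 1)) = μ.real (E i n) - μ.real (E i n ∩ A n) := by
        rw [hs, ← measureReal_sdiff_add_inter (s := E i n) (hAm n)]; ring
      rw [Finset.sum_Ico_succ_top hn, Finset.sum_Ico_succ_top hn, neg_add, Real.exp_add, hd]
      have hB : 0 ≤ ∑ j ∈ Finset.Ico i n, b j := Finset.sum_nonneg fun j _ => hb0 j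
      have hexp : 1 - c n ≤ Real.exp (-c n) := by linarith [Real.add_one_le_exp (-c n)]
      have hE0 := Real.exp_pos (-∑ j ∈ Finset.Ico i n, c j)
      have k1 := mul_le_mul_of_nonneg_left hexp hE0.le
      have k2 := mul_le_mul_of_nonneg_left ih (sub_nonneg.2 h1)
      nlinarith
  -- avoiding all events from `i` on
  have hF : ∀ i, J ≤ i → μ.real {ω | ∀ j, i ≤ j → ω ∉ A j} ≤ ∑' j, b (j + i) := by
    intro i hi
    have hlim : Tendsto (fun n => Real.exp (-∑ j ∈ Finset.Ico i n, c j) + ∑' j, b (j + i))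
        atTop (𝓝 (0 + ∑' j, b (j + i))) := by
      refine Tendsto.add_const _ (Real.tendsto_exp_neg_atTop_nhds_zero.comp ?_)
      have h3 : Tendsto (fun n => -(∑ j ∈ Finset.range i, c j) + ∑ j ∈ Finset.range n, c j)
          atTop atTop := tendsto_atTop_add_const_left _ _ hc
      refine h3.congr' ?_
      filter_upwards [eventually_ge_atTop i] with n hn
      rw [Finset.sum_Ico_eq_sub _ hn]; ring
    rw [zero_add] at hlim
    refine ge_of_tendsto hlim ?_
    filter_upwards [eventually_ge_atTop i] with n hn
    refine (measureReal_mono ?_).trans ((hEb i hi n hn).trans ?_)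
    · intro ω hω
      simp only [E, Set.mem_iInter]
      exact fun j hj => hω j (Finset.mem_Ico.1 hj).1
    · gcongr
      rw [Finset.sum_Ico_eq_sum_range]
      have := ((summable_nat_add_iff i).2 hb).sum_le_tsum (Finset.range (n - i))
        (fun j _ => hb0 _)
      simpa [add_comm] using this
  have htail : Tendsto (fun i => ∑' j, b (j + i)) atTop (𝓝 0) := tendsto_sum_nat_add b
  -- The avoidance events increase with `i`, so each is bounded by arbitrarily late tails of `∑ b
  -- j`.
  have hzero : ∀ i, μ {ω | ∀ j, i ≤ j → ω ∉ A j} = 0 := by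
    intro i
    rw [← measureReal_eq_zero_iff]
    refine le_antisymm ?_ measureReal_nonneg
    refine ge_of_tendsto htail ?_
    filter_upwards [eventually_ge_atTop i, eventually_ge_atTop J] with l hl hlJ
    refine (measureReal_mono ?_).trans (hF l hlJ)
    intro ω hω j hj
    exact hω j (hl.trans hj)
  have := ae_all_iff.2 fun i => measure_eq_zero_iff_ae_notMem.1 (hzero i)
  filter_upwards [this] with ω hω
  rw [frequently_atTop]
  intro i
  have := hω i
  push Not at this
  obtain ⟨j, hj, hj'⟩ := this
  exact ⟨j, hj, hj'⟩

end

section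

/-! ### Time scales and geometric blocks -/

/-- A clock `φ` running to infinity at most at unit speed and without macroscopic jumps. -/
structure IsClock (φ : ℕ → ℝ) : Prop where
  mono : Monotone φ
  tendsto : Tendsto φ atTop atTop
  le_self : ∀ n, φ n ≤ n
  ratio : Tendsto (fun n => φ (n + 1) / φ n) atTop (𝓝 1)

/-- The first time at which the clock `φ` reaches `ρ ^ j`. -/
noncomputable def hitTime (φ : ℕ → ℝ) (ρ : ℝ) (j : ℕ) : ℕ := sInf {n | ρ ^ j ≤ φ n}

/-- The normalisation `√(2 φ^β log log φ)` of the law of the iterated logarithm. -/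
noncomputable def lilNorm (φ : ℕ → ℝ) (β : ℝ) (n : ℕ) : ℝ :=
  √(2 * φ n ^ β * Real.log (Real.log (φ n)))

/-- The approximate value of `lilNorm` at the first time the clock reaches `ρ ^ j`. -/
noncomputable def blockNorm (ρ β : ℝ) (j : ℕ) : ℝ := √(2 * (ρ ^ j) ^ β * Real.log j)

theorem tendsto_log_natCast_atTop : Tendsto (fun j : ℕ => Real.log j) atTop atTop :=
  Real.tendsto_log_atTop.comp tendsto_natCast_atTop_atTop

theorem blockNorm_sq {ρ β : ℝ} (hρ : 0 < ρ) (j : ℕ) :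
    blockNorm ρ β j ^ 2 = 2 * (ρ ^ j) ^ β * Real.log j := by
  rw [blockNorm, Real.sq_sqrt]
  have := Real.log_natCast_nonneg j
  positivity

theorem blockNorm_nonneg (ρ β : ℝ) (j : ℕ) : 0 ≤ blockNorm ρ β j := Real.sqrt_nonneg _

theorem eventually_blockNorm_pos {ρ : ℝ} (hρ : 0 < ρ) (β : ℝ) :
    ∀ᶠ j in atTop, 0 < blockNorm ρ β j := by
  filter_upwards [tendsto_log_natCast_atTop.eventually_gt_atTop 0] with j hj
  exact Real.sqrt_pos.2 (by positivity)

theorem tendsto_blockNorm_succ_div {ρ : ℝ} (hρ : 0 < ρ) (β : ℝ) :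
    Tendsto (fun j => blockNorm ρ β (j + 1) / blockNorm ρ β j) atTop (𝓝 √(ρ ^ β)) := by
  have hlog : Tendsto (fun j : ℕ => Real.log (j + 1 : ℕ) / Real.log j) atTop (𝓝 1) := by
    have h1 : Tendsto (fun j : ℕ => Real.log (1 + 1 / (j : ℝ))) atTop (𝓝 0) := by
      have : Tendsto (fun j : ℕ => 1 + 1 / (j : ℝ)) atTop (𝓝 (1 + 0)) :=
        tendsto_const_nhds.add tendsto_one_div_atTop_nhds_zero_nat
      rw [add_zero] at this
      simpa using this.log one_ne_zero
    have h2 : Tendsto (fun j : ℕ => 1 + Real.log (1 + 1 / (j : ℝ)) / Real.log j) atTop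
        (𝓝 (1 + 0)) := tendsto_const_nhds.add (h1.div_atTop tendsto_log_natCast_atTop)
    rw [add_zero] at h2
    refine h2.congr' ?_
    filter_upwards [tendsto_log_natCast_atTop.eventually_gt_atTop 0,
      eventually_gt_atTop 0] with j hj hj0
    have hj0' : (0 : ℝ) < j := by exact_mod_cast hj0
    have : ((j + 1 : ℕ) : ℝ) = j * (1 + 1 / (j : ℝ)) := by push_cast; field_simp
    rw [this, Real.log_mul hj0'.ne' (by positivity)]
    field_simp
  have h3 := (hlog.const_mul (ρ ^ β)).sqrt
  rw [mul_one] at h3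
  refine h3.congr' ?_
  filter_upwards [tendsto_log_natCast_atTop.eventually_gt_atTop 0] with j hj
  rw [blockNorm, blockNorm, ← Real.sqrt_div (by
    have := Real.log_natCast_nonneg (j + 1)
    positivity)]
  congr 1
  rw [pow_succ, Real.mul_rpow (by positivity) hρ.le]
  have : 0 < (ρ ^ j) ^ β := by positivity
  field_simp

theorem tendsto_pow_div_pow_atTop_zero (k : ℕ) {ρ : ℝ} (hρ : 1 < ρ) :
    Tendsto (fun j : ℕ => (j : ℝ) ^ k / ρ ^ j) atTop (𝓝 0) := by
  have h := tendsto_pow_const_mul_const_pow_of_abs_lt_one k (r := ρ⁻¹)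
    (by rw [abs_of_pos (by positivity)]; exact inv_lt_one_of_one_lt₀ hρ)
  simpa [div_eq_mul_inv] using h

/-- The powers of `ρ` cancel and the terms are `j ^ (-(A ^ 2 / D))` for `j ≥ 1`. The index `0` is
shifted away since that identity fails there. -/
theorem summable_exp_neg_blockNorm {ρ : ℝ} (hρ : 0 < ρ) (β : ℝ) {A D : ℝ} (hD : 0 < D)
    (hA : D < A ^ 2) :
    Summable fun j : ℕ =>
      Real.exp (-((A * blockNorm ρ β j) ^ 2 / (2 * (D * (ρ ^ j) ^ β)))) := by
  have hs : Summable fun j : ℕ => (j : ℝ) ^ (-(A ^ 2 / D)) :=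
    Real.summable_nat_rpow.2 (neg_lt_neg ((one_lt_div hD).2 hA))
  refine (summable_nat_add_iff 1).1 (((summable_nat_add_iff 1).2 hs).congr fun j => ?_)
  have hj : (0 : ℝ) < (j + 1 : ℕ) := by positivity
  rw [mul_pow, blockNorm_sq hρ, Real.rpow_def_of_pos hj]
  have : 0 < (ρ ^ (j + 1)) ^ β := by positivity
  congr 1
  field_simp

namespace IsClock

variable {φ : ℕ → ℝ} {ρ : ℝ}

theorem le_hitTime (hφ : IsClock φ) (ρ : ℝ) (j : ℕ) : ρ ^ j ≤ φ (hitTime φ ρ j) :=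
  Nat.sInf_mem (s := {n | ρ ^ j ≤ φ n}) (hφ.tendsto.eventually_ge_atTop _).exists

theorem lt_of_lt_hitTime {j n : ℕ} (hn : n < hitTime φ ρ j) : φ n < ρ ^ j := by
  have := Nat.notMem_of_lt_sInf hn
  simpa using this

theorem hitTime_le {j n : ℕ} (hn : ρ ^ j ≤ φ n) : hitTime φ ρ j ≤ n := Nat.sInf_le hn

theorem lt_hitTime (hφ : IsClock φ) {j n : ℕ} (hn : φ n < ρ ^ j) : n < hitTime φ ρ j := by
  by_contra h
  exact absurd (hφ.le_hitTime ρ j) (not_le.2 ((hφ.mono (not_lt.1 h)).trans_lt hn))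

theorem monotone_hitTime (hφ : IsClock φ) (hρ : 1 ≤ ρ) : Monotone (hitTime φ ρ) :=
  fun _ _ hij => hitTime_le ((pow_le_pow_right₀ hρ hij).trans (hφ.le_hitTime ρ _))

/-- This is the use of the unit speed bound: block `j` starts at a time of size at least `ρ ^ j`, so
that the mean squares of the predictions in it are geometrically small in `j`. -/
theorem pow_le_natCast_hitTime (hφ : IsClock φ) (ρ : ℝ) (j : ℕ) : ρ ^ j ≤ hitTime φ ρ j :=
  (hφ.le_hitTime ρ j).trans (hφ.le_self _)

theorem tendsto_hitTime (hφ : IsClock φ) (hρ : 1 < ρ) : Tendsto (hitTime φ ρ) atTop atTop :=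
  (tendsto_natCast_atTop_iff (R := ℝ)).1
    (tendsto_atTop_mono (hφ.pow_le_natCast_hitTime ρ) (tendsto_pow_atTop_atTop_of_one_lt hρ))

/-- The overshoot is at most one tick: just before the hitting time the clock was below `ρ ^ j`, and
consecutive clock values have ratio tending to `1`. -/
theorem tendsto_hitTime_div (hφ : IsClock φ) (hρ : 1 < ρ) :
    Tendsto (fun j => φ (hitTime φ ρ j) / ρ ^ j) atTop (𝓝 1) := by
  have hN := hφ.tendsto_hitTime hρ
  have hN1 : Tendsto (fun j => hitTime φ ρ j - 1) atTop atTop :=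
    (tendsto_sub_atTop_nat 1).comp hN
  refine tendsto_of_tendsto_of_tendsto_of_le_of_le' tendsto_const_nhds (hφ.ratio.comp hN1)
    (Eventually.of_forall fun j => ?_) ?_
  · have : 0 < ρ ^ j := by positivity
    rw [le_div_iff₀ this, one_mul]
    exact hφ.le_hitTime ρ j
  · filter_upwards [hN.eventually_gt_atTop 0,
      (hφ.tendsto.comp hN1).eventually_gt_atTop 0] with j hj hj2
    have e : hitTime φ ρ j - 1 + 1 = hitTime φ ρ j := Nat.sub_add_cancel hj
    simp only [Function.comp, e] at hj2 ⊢
    have h3 : 0 ≤ φ (hitTime φ ρ j) := hj2.le.trans (hφ.mono (Nat.sub_le _ _))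
    exact div_le_div_of_nonneg_left h3 hj2 (lt_of_lt_hitTime (by omega)).le

theorem tendsto_log_log_hitTime_div (hφ : IsClock φ) (hρ : 1 < ρ) :
    Tendsto (fun j => Real.log (Real.log (φ (hitTime φ ρ j))) / Real.log j) atTop (𝓝 1) := by
  have hl := Real.log_pos hρ
  have h1 : Tendsto (fun j : ℕ => Real.log ρ + Real.log (φ (hitTime φ ρ j) / ρ ^ j) / j) atTop
      (𝓝 (Real.log ρ + 0)) := by
    refine tendsto_const_nhds.add (Tendsto.div_atTop (a := 0) ?_ tendsto_natCast_atTop_atTop)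
    simpa using (hφ.tendsto_hitTime_div hρ).log one_ne_zero
  rw [add_zero] at h1
  have h2 := (h1.log hl.ne').div_atTop tendsto_log_natCast_atTop
  have h3 := h2.const_add 1
  rw [add_zero] at h3
  refine h3.congr' ?_
  filter_upwards [tendsto_log_natCast_atTop.eventually_gt_atTop 0, eventually_gt_atTop 0,
    h1.eventually_const_lt hl] with j hj hj0 hj1
  have hj0' : (0 : ℝ) < j := by exact_mod_cast hj0
  have hp : 0 < ρ ^ j := by positivity
  have hφ0 : 0 < φ (hitTime φ ρ j) := hp.trans_le (hφ.le_hitTime ρ j)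
  have e : Real.log (φ (hitTime φ ρ j)) =
      j * (Real.log ρ + Real.log (φ (hitTime φ ρ j) / ρ ^ j) / j) := by
    rw [Real.log_div hφ0.ne' hp.ne', Real.log_pow]; field_simp; ring
  rw [e, Real.log_mul hj0'.ne' hj1.ne']
  field_simp

theorem tendsto_lilNorm_hitTime_div (hφ : IsClock φ) (hρ : 1 < ρ) (β : ℝ) :
    Tendsto (fun j => lilNorm φ β (hitTime φ ρ j) / blockNorm ρ β j) atTop (𝓝 1) := by
  have h1 := ((hφ.tendsto_hitTime_div hρ).rpow_const (p := β) (Or.inl one_ne_zero)).mul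
    (hφ.tendsto_log_log_hitTime_div hρ)
  rw [Real.one_rpow, mul_one] at h1
  have h2 := h1.sqrt
  rw [Real.sqrt_one] at h2
  refine h2.congr' ?_
  filter_upwards [tendsto_log_natCast_atTop.eventually_gt_atTop 0] with j hj
  have hp : 0 < ρ ^ j := by positivity
  have hφ0 : 0 < φ (hitTime φ ρ j) := hp.trans_le (hφ.le_hitTime ρ j)
  rw [lilNorm, blockNorm, ← Real.sqrt_div' _ (by positivity), Real.div_rpow hφ0.le hp.le]
  congr 1
  have : 0 < (ρ ^ j) ^ β := by positivity
  field_simp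

/-- Inside a block `φ ^ β` is smallest at the left end if `β ≥ 0` and at the right end if `β ≤ 0`;
`min 1 (ρ ^ β)` covers both. The factor `η` absorbs the constant `log (log ρ)`. -/
theorem eventually_blockNorm_le_lilNorm (hρ : 1 < ρ) (β : ℝ) {η : ℝ} (hη0 : 0 ≤ η)
    (hη : η < 1) :
    ∀ᶠ j in atTop, ∀ n, ρ ^ j ≤ φ n → φ n < ρ ^ (j + 1) →
      √(min 1 (ρ ^ β) * η) * blockNorm ρ β j ≤ lilNorm φ β n := by
  have hl := Real.log_pos hρ
  have h1 : Tendsto (fun j : ℕ => 1 + Real.log (Real.log ρ) / Real.log j) atTop (𝓝 (1 + 0)) :=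
    tendsto_const_nhds.add (tendsto_const_nhds.div_atTop tendsto_log_natCast_atTop)
  rw [add_zero] at h1
  filter_upwards [tendsto_log_natCast_atTop.eventually_gt_atTop 0, eventually_gt_atTop 0,
    h1.eventually_const_lt hη] with j hj hj0 hj1 n hn1 hn2
  have hj0' : (0 : ℝ) < j := by exact_mod_cast hj0
  have hp : 0 < ρ ^ j := by positivity
  have hφ0 : 0 < φ n := hp.trans_le hn1
  have hpow : min 1 (ρ ^ β) * (ρ ^ j) ^ β ≤ φ n ^ β := by
    have hb : 0 < (ρ ^ j) ^ β := by positivity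
    rcases le_total 0 β with hβ | hβ
    · calc min 1 (ρ ^ β) * (ρ ^ j) ^ β ≤ 1 * (ρ ^ j) ^ β := by gcongr; exact min_le_left _ _
        _ ≤ φ n ^ β := by rw [one_mul]; exact Real.rpow_le_rpow hp.le hn1 hβ
    · calc min 1 (ρ ^ β) * (ρ ^ j) ^ β ≤ ρ ^ β * (ρ ^ j) ^ β := by gcongr; exact min_le_right _ _
        _ = (ρ ^ (j + 1)) ^ β := by
          rw [pow_succ, Real.mul_rpow (by positivity) (by positivity)]; ring
        _ ≤ φ n ^ β := Real.rpow_le_rpow_of_nonpos hφ0 hn2.le hβ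
  have hlog : η * Real.log j ≤ Real.log (Real.log (φ n)) := by
    have a1 : j * Real.log ρ ≤ Real.log (φ n) := by
      rw [← Real.log_pow]; exact Real.log_le_log hp hn1
    have a2 : Real.log (j * Real.log ρ) ≤ Real.log (Real.log (φ n)) :=
      Real.log_le_log (by positivity) a1
    rw [Real.log_mul hj0'.ne' hl.ne'] at a2
    have a3 : η * Real.log j < (1 + Real.log (Real.log ρ) / Real.log j) * Real.log j := by
      gcongr
    have a4 : (1 + Real.log (Real.log ρ) / Real.log j) * Real.log j =
      Real.log j + Real.log (Real.log ρ) := by field_simp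
    linarith
  rw [blockNorm, lilNorm, ← Real.sqrt_mul (by positivity)]
  apply Real.sqrt_le_sqrt
  calc min 1 (ρ ^ β) * η * (2 * (ρ ^ j) ^ β * Real.log j) =
      2 * (min 1 (ρ ^ β) * (ρ ^ j) ^ β) * (η * Real.log j) := by ring
    _ ≤ 2 * φ n ^ β * Real.log (Real.log (φ n)) := by gcongr

theorem tendsto_scale_hitTime (hφ : IsClock φ) (hρ : 1 < ρ) {β c : ℝ} {w : ℕ → ℝ}
    (hw : Tendsto (fun n => w n / φ n ^ β) atTop (𝓝 c)) :
    Tendsto (fun j => w (hitTime φ ρ j) / (ρ ^ j) ^ β) atTop (𝓝 c) := by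
  have h := (hw.comp (hφ.tendsto_hitTime hρ)).mul
    ((hφ.tendsto_hitTime_div hρ).rpow_const (p := β) (Or.inl one_ne_zero))
  rw [Real.one_rpow, mul_one] at h
  refine h.congr fun j => ?_
  have hp : 0 < ρ ^ j := by positivity
  have hφ0 : 0 < φ (hitTime φ ρ j) := hp.trans_le (hφ.le_hitTime ρ j)
  rw [Function.comp, Real.div_rpow hφ0.le hp.le]
  have : 0 < (ρ ^ j) ^ β := by positivity
  have : 0 < φ (hitTime φ ρ j) ^ β := by positivity
  field_simp

theorem tendsto_scale_hitTime_succ (hφ : IsClock φ) (hρ : 1 < ρ) {β c : ℝ} {w : ℕ → ℝ}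
    (hw : Tendsto (fun n => w n / φ n ^ β) atTop (𝓝 c)) :
    Tendsto (fun j => w (hitTime φ ρ (j + 1)) / (ρ ^ j) ^ β) atTop (𝓝 (c * ρ ^ β)) := by
  have h := ((hφ.tendsto_scale_hitTime hρ hw).comp (tendsto_add_atTop_nat 1)).mul_const (ρ ^ β)
  refine h.congr fun j => ?_
  have : 0 < (ρ ^ j) ^ β := by positivity
  have : 0 < ρ ^ β := by positivity
  rw [Function.comp, pow_succ, Real.mul_rpow (by positivity) (by positivity)]
  field_simp

end IsClock

theorem ae_eventually_notMem_of_summable {Ω : Type*} [MeasurableSpace Ω] {μ : Measure Ω}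
    [IsProbabilityMeasure μ] {s : ℕ → Set Ω} {f : ℕ → ℝ} (hf : Summable f)
    (hs : ∀ᶠ j in atTop, μ.real (s j) ≤ f j) : ∀ᵐ ω ∂μ, ∀ᶠ j in atTop, ω ∉ s j := by
  have hsum : Summable fun j => μ.real (s j) :=
    summable_of_isBigO_nat hf (Asymptotics.IsBigO.of_bound 1 (by
      filter_upwards [hs] with j hj
      rw [one_mul, Real.norm_of_nonneg measureReal_nonneg]
      exact hj.trans (le_abs_self _)))
  refine ae_eventually_notMem ?_
  have e : ∀ j, μ (s j) = ENNReal.ofReal (μ.real (s j)) := fun j =>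
    (ofReal_measureReal (measure_ne_top _ _)).symm
  simp_rw [e]
  rw [← ENNReal.ofReal_tsum_of_nonneg (fun _ => measureReal_nonneg) hsum]
  exact ENNReal.ofReal_ne_top

end

section

/-! ### The law of the iterated logarithm -/

/-- A process `Y` whose increments are, up to the sign `σ`, those of the weighted sums of centred
predicted signs, with variance proxy `w n ∼ c φ(n)^β`.  It is either a weighted sum itself
(`β > 0`, `σ = 1`) or the remainder of a convergent one (`β < 0`, `σ = -1`). -/
structure IsScaledProcess {Ω : Type*} [mΩ : MeasurableSpace Ω] (μ : Measure Ω)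
    (ℱ : Filtration ℕ mΩ) (x m : ℕ → Ω → ℝ) (a : ℕ → ℝ) (Y : ℕ → Ω → ℝ) (w φ : ℕ → ℝ)
    (β c σ : ℝ) : Prop where
  signs : IsPredictedSigns μ ℱ x m
  meanSq : ∃ K s : ℝ, 0 < K ∧ 0 < s ∧ ∀ k : ℕ, ∫ ω, m k ω ^ 2 ∂μ ≤ K * ((k : ℝ) + 1) ^ (-s)
  clock : IsClock φ
  sub_eq : ∀ N n, N ≤ n → ∀ ω, Y n ω - Y N ω = σ * centredSum x m a N n ω
  sign_eq : (0 < β ∧ σ = 1) ∨ (β < 0 ∧ σ = -1)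
  subgaussian : ∀ n, HasSubgaussianMGF (Y n) (w n).toNNReal μ
  variance_eq : ∀ N n, N ≤ n → ∑ k ∈ Finset.Ico N n, a k ^ 2 = σ * (w n - w N)
  weight_le : ∃ C : ℝ, 0 < C ∧ ∀ᶠ n in atTop, ∀ k, n ≤ k → a k ^ 2 ≤ C * φ n ^ (β - 1)
  scale_pos : 0 < c
  scale : Tendsto (fun n => w n / φ n ^ β) atTop (𝓝 c)

theorem centredSum_neg {Ω : Type*} (x m : ℕ → Ω → ℝ) (b : ℕ → ℝ) (N n : ℕ) (ω : Ω) :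
    centredSum (-x) (-m) b N n ω = -centredSum x m b N n ω := by
  simp only [centredSum, Pi.neg_apply, ← Finset.sum_neg_distrib]
  exact Finset.sum_congr rfl fun k _ => by ring

namespace IsScaledProcess

variable {Ω : Type*} [mΩ : MeasurableSpace Ω] {μ : Measure Ω} [IsProbabilityMeasure μ]
  {ℱ : Filtration ℕ mΩ} {x m : ℕ → Ω → ℝ} {a : ℕ → ℝ} {Y : ℕ → Ω → ℝ} {w φ : ℕ → ℝ} {β c σ : ℝ}

theorem neg (h : IsScaledProcess μ ℱ x m a Y w φ β c σ) :
    IsScaledProcess μ ℱ (-x) (-m) a (-Y) w φ β c σ where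
  signs := h.signs.neg
  meanSq := by simpa using h.meanSq
  clock := h.clock
  sub_eq N n hn ω := by
    rw [centredSum_neg, mul_neg, ← h.sub_eq N n hn ω]; simp; ring
  sign_eq := h.sign_eq
  subgaussian n := (h.subgaussian n).neg
  variance_eq := h.variance_eq
  weight_le := h.weight_le
  scale_pos := h.scale_pos
  scale := h.scale

theorem sign_sq (h : IsScaledProcess μ ℱ x m a Y w φ β c σ) : σ = 1 ∨ σ = -1 := by
  rcases h.sign_eq with e | e
  exacts [Or.inl e.2, Or.inr e.2]

theorem sign_mul_pos (h : IsScaledProcess μ ℱ x m a Y w φ β c σ) {ρ : ℝ} (hρ : 1 < ρ) :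
    0 < σ * (ρ ^ β - 1) := by
  rcases h.sign_eq with ⟨hβ, rfl⟩ | ⟨hβ, rfl⟩
  · linarith [Real.one_lt_rpow hρ hβ]
  · linarith [Real.rpow_lt_one_of_one_lt_of_neg hρ hβ]

/-- The variance of a geometric block. -/
theorem tendsto_block_variance (h : IsScaledProcess μ ℱ x m a Y w φ β c σ) {ρ : ℝ}
    (hρ : 1 < ρ) :
    Tendsto (fun j => (∑ k ∈ Finset.Ico (hitTime φ ρ j) (hitTime φ ρ (j + 1)), a k ^ 2) /
      (ρ ^ j) ^ β) atTop (𝓝 (c * (σ * (ρ ^ β - 1)))) := by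
  have h1 := ((h.clock.tendsto_scale_hitTime_succ hρ h.scale).sub
    (h.clock.tendsto_scale_hitTime hρ h.scale)).const_mul σ
  rw [show c * (σ * (ρ ^ β - 1)) = σ * (c * ρ ^ β - c) by ring]
  refine h1.congr fun j => ?_
  rw [h.variance_eq _ _ (h.clock.monotone_hitTime hρ.le (Nat.le_succ j))]
  ring

/-- Sub-Gaussian tails along the hitting times and the first Borel-Cantelli lemma; `D` between `c`
and `A ^ 2` absorbs the convergence of the variance proxies. -/
theorem ae_eventually_lt_blockNorm (h : IsScaledProcess μ ℱ x m a Y w φ β c σ) {ρ : ℝ}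
    (hρ : 1 < ρ) {A : ℝ} (hA : 0 ≤ A) (hAc : c < A ^ 2) :
    ∀ᵐ ω ∂μ, ∀ᶠ j in atTop, Y (hitTime φ ρ j) ω < A * blockNorm ρ β j := by
  obtain ⟨D, hD1, hD2⟩ := exists_between hAc
  have hw := h.clock.tendsto_scale_hitTime hρ h.scale
  have hev : ∀ᶠ j in atTop, μ.real {ω | A * blockNorm ρ β j ≤ Y (hitTime φ ρ j) ω} ≤
      Real.exp (-((A * blockNorm ρ β j) ^ 2 / (2 * (D * (ρ ^ j) ^ β)))) := by
    filter_upwards [hw.eventually_lt_const hD1, hw.eventually_const_lt h.scale_pos] with j h1 h2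
    have hp : 0 < (ρ ^ j) ^ β := by positivity
    have h3 : 0 < w (hitTime φ ρ j) := by
      by_contra h4
      exact absurd h2 (not_lt.2 (div_nonpos_of_nonpos_of_nonneg (not_lt.1 h4) hp.le))
    refine ((h.subgaussian _).measure_ge_le (by have := blockNorm_nonneg ρ β j; positivity)).trans
      (Real.exp_le_exp.2 ?_)
    rw [Real.coe_toNNReal _ h3.le, neg_div]
    have h5 : w (hitTime φ ρ j) ≤ D * (ρ ^ j) ^ β := ((div_lt_iff₀ hp).1 h1).le
    gcongr
  filter_upwards [ae_eventually_notMem_of_summable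
    (summable_exp_neg_blockNorm (by positivity) β (h.scale_pos.trans hD1) hD2) hev] with ω hω
  filter_upwards [hω] with j hj
  simpa using hj

/-- Controls the fluctuation between two hitting times by the maximal inequality. The admissible `A`
become arbitrarily small as `ρ` decreases to `1`. -/
theorem ae_eventually_sum_lt_blockNorm (h : IsScaledProcess μ ℱ x m a Y w φ β c σ) {ρ : ℝ}
    (hρ : 1 < ρ) {A : ℝ} (hA : 0 ≤ A) (hAc : c * (σ * (ρ ^ β - 1)) < A ^ 2) :
    ∀ᵐ ω ∂μ, ∀ᶠ j in atTop, ∀ l ≤ hitTime φ ρ (j + 1),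
      centredSum x m a (hitTime φ ρ j) l ω < A * blockNorm ρ β j := by
  obtain ⟨D, hD1, hD2⟩ := exists_between hAc
  have hD0 : 0 < D := (mul_pos h.scale_pos (h.sign_mul_pos hρ)).trans hD1
  have hev : ∀ᶠ j in atTop, μ.real {ω | ∃ l ≤ hitTime φ ρ (j + 1),
      A * blockNorm ρ β j ≤ centredSum x m a (hitTime φ ρ j) l ω} ≤
      Real.exp (-((A * blockNorm ρ β j) ^ 2 / (2 * (D * (ρ ^ j) ^ β)))) := by
    filter_upwards [(h.tendsto_block_variance hρ).eventually_lt_const hD1] with j h1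
    have hp : 0 < (ρ ^ j) ^ β := by positivity
    exact h.signs.measure_exists_le_centredSum_le_exp a
      (h.clock.monotone_hitTime hρ.le (Nat.le_succ j))
      (by have := blockNorm_nonneg ρ β j; positivity) (by positivity) ((div_lt_iff₀ hp).1 h1).le
  filter_upwards [ae_eventually_notMem_of_summable
    (summable_exp_neg_blockNorm (by positivity) β hD0 hD2) hev] with ω hω
  filter_upwards [hω] with j hj
  simpa using hj

/-- The upper half of the law: the value at the last hitting time plus the fluctuation since then,
each within `ε / 4` of its target. -/
theorem ae_eventually_le_lilNorm (h : IsScaledProcess μ ℱ x m a Y w φ β c σ) {ε : ℝ}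
    (hε : 0 < ε) :
    ∀ᵐ ω ∂μ, ∀ᶠ n in atTop, Y n ω ≤ (√c + ε) * lilNorm φ β n := by
  have hc := h.scale_pos
  have hsc : 0 < √c := Real.sqrt_pos.2 hc
  -- The gap between `√c + ε / 2` and `√c + ε` pays for the variation of the normalisation within a
  -- block.
  set r := (√c + ε / 2) / (√c + ε) with hr
  have hr0 : 0 < r := by positivity
  have hr1 : r < 1 := (div_lt_one (by positivity)).2 (by linarith)
  obtain ⟨η, hη1, hη2⟩ := exists_between (show r ^ 2 < 1 by nlinarith)
  have hη0 : 0 < η := (by positivity : 0 < r ^ 2).trans hη1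
  -- a ratio close to one
  obtain ⟨ρ, ⟨hρ1, hρ2⟩, hρ⟩ : ∃ ρ : ℝ, (c * (σ * (ρ ^ β - 1)) < (ε / 4) ^ 2 ∧
      r ^ 2 < min 1 (ρ ^ β) * η) ∧ 1 < ρ := by
    have hcont : Tendsto (fun ρ : ℝ => ρ ^ β) (𝓝[>] 1) (𝓝 1) := by
      have : ContinuousAt (fun ρ : ℝ => ρ ^ β) 1 :=
        Real.continuousAt_rpow_const _ _ (Or.inl one_ne_zero)
      simpa [ContinuousAt] using this.tendsto.mono_left (nhdsWithin_le_nhds (s := Set.Ioi 1))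
    have e1 : Tendsto (fun ρ : ℝ => c * (σ * (ρ ^ β - 1))) (𝓝[>] 1) (𝓝 (c * (σ * (1 - 1)))) :=
      ((hcont.sub_const 1).const_mul σ).const_mul c
    have e2 : Tendsto (fun ρ : ℝ => min 1 (ρ ^ β) * η) (𝓝[>] 1) (𝓝 (min 1 1 * η)) :=
      (tendsto_const_nhds.min hcont).mul_const η
    rw [sub_self, mul_zero, mul_zero] at e1
    rw [min_self, one_mul] at e2
    exact (((e1.eventually_lt_const (by positivity : 0 < (ε / 4) ^ 2)).and
      (e2.eventually_const_lt hη1)).and self_mem_nhdsWithin).exists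
  have hA : c < (√c + ε / 4) ^ 2 := by nlinarith [Real.sq_sqrt hc.le]
  -- For `σ = -1` the block estimate is applied to the negated signs.
  have hB : ∀ᵐ ω ∂μ, ∀ᶠ j in atTop, ∀ l ≤ hitTime φ ρ (j + 1),
      σ * centredSum x m a (hitTime φ ρ j) l ω < ε / 4 * blockNorm ρ β j := by
    rcases h.sign_sq with e | e
    · filter_upwards [h.ae_eventually_sum_lt_blockNorm hρ (by positivity) hρ1] with ω hω
      simpa [e] using hω
    · filter_upwards [h.neg.ae_eventually_sum_lt_blockNorm hρ (by positivity) hρ1] with ω hω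
      simpa [e, centredSum_neg] using hω
  filter_upwards [h.ae_eventually_lt_blockNorm hρ (by positivity) hA, hB] with ω h1 h2
  have h3 := IsClock.eventually_blockNorm_le_lilNorm (φ := φ) hρ β hη0.le hη2
  obtain ⟨J, hJ⟩ := eventually_atTop.1 (h1.and (h2.and h3))
  filter_upwards [h.clock.tendsto.eventually_ge_atTop (ρ ^ J)] with n hn
  obtain ⟨j, hj1, hj2⟩ := exists_nat_pow_near ((one_le_pow₀ hρ.le).trans hn) hρ
  have hJj : J ≤ j := by
    by_contra hlt
    have : ρ ^ (j + 1) ≤ ρ ^ J := pow_le_pow_right₀ hρ.le (by omega)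
    linarith
  obtain ⟨g1, g2, g3⟩ := hJ j hJj
  have g2' := g2 n (h.clock.lt_hitTime hj2).le
  rw [← h.sub_eq _ _ (IsClock.hitTime_le hj1)] at g2'
  have g3' := g3 n hj1 hj2
  have hg := blockNorm_nonneg ρ β j
  have hr2 : r ≤ √(min 1 (ρ ^ β) * η) := Real.le_sqrt_of_sq_le hρ2.le
  calc Y n ω ≤ (√c + ε / 2) * blockNorm ρ β j := by linarith
    _ = (√c + ε) * (r * blockNorm ρ β j) := by rw [hr]; field_simp
    _ ≤ (√c + ε) * (√(min 1 (ρ ^ β) * η) * blockNorm ρ β j) := by gcongr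
    _ ≤ _ := by gcongr

/-- Each block is rescaled so that its normalised variance is a multiple of `log j`, chosen to make
the large deviation probability of order `1 / j`, which is not summable. The error terms carry
geometrically small mean squares against powers of `j`, so they are summable. -/
theorem ae_frequently_blockNorm_le_sum (h : IsScaledProcess μ ℱ x m a Y w φ β c σ) {ρ : ℝ}
    (hρ : 1 < ρ) {D : ℝ} (hDc : D ^ 2 < c * (σ * (ρ ^ β - 1))) :
    ∀ᵐ ω ∂μ, ∃ᶠ j in atTop, D * blockNorm ρ β j ≤
      centredSum x m a (hitTime φ ρ j) (hitTime φ ρ (j + 1)) ω := by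
  obtain ⟨K, s, hK, hs, hm⟩ := h.meanSq
  obtain ⟨C, hC, hCa⟩ := h.weight_le
  set d := c * (σ * (ρ ^ β - 1)) with hd
  have hd0 : 0 < d := mul_pos h.scale_pos (h.sign_mul_pos hρ)
  have hρ0 : 0 < ρ := by positivity
  have hmono := h.clock.monotone_hitTime (ρ := ρ) hρ.le
  -- The factor `(1 - δ) ^ 2 / (1 + 2 * δ)` is the total loss in the square of the constant, and it
  -- tends to `1` with `δ → 0`.
  obtain ⟨δ, ⟨hδD, hδ1⟩, hδ0⟩ : ∃ δ : ℝ, (D ^ 2 < (1 - δ) ^ 2 / (1 + 2 * δ) * d ∧ δ < 1) ∧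
      0 < δ := by
    have : ContinuousAt (fun δ : ℝ => (1 - δ) ^ 2 / (1 + 2 * δ) * d) 0 := by
      refine ContinuousAt.mul (ContinuousAt.div₀ (by fun_prop) (by fun_prop) (by norm_num))
        continuousAt_const
    have e1 := (this.tendsto.mono_left (nhdsWithin_le_nhds (s := Set.Ioi 0)))
    have e2 : Tendsto (fun δ : ℝ => δ) (𝓝[>] 0) (𝓝 0) := tendsto_id.mono_left nhdsWithin_le_nhds
    norm_num at e1
    exact (((e1.eventually_const_lt hDc).and (e2.eventually_lt_const one_pos)).and
      self_mem_nhdsWithin).exists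
  set V : ℕ → ℝ := fun j => ∑ k ∈ Finset.Ico (hitTime φ ρ j) (hitTime φ ρ (j + 1)), a k ^ 2 with hV
  have hVlim : Tendsto (fun j => V j / (ρ ^ j) ^ β) atTop (𝓝 d) := h.tendsto_block_variance hρ
  -- Solves `(1 / 2 + δ) * X j = log j`, so that `exp (-((1 / 2 + δ) * X j)) = 1 / j` for `j ≥ 1`.
  set X : ℕ → ℝ := fun j => 2 / (1 + 2 * δ) * Real.log j with hX
  have hXlim : Tendsto X atTop atTop :=
    tendsto_log_natCast_atTop.const_mul_atTop (by positivity)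
  have hX0 : ∀ j, 0 ≤ X j := fun j => by
    have := Real.log_natCast_nonneg j
    positivity
  have hXj : ∀ j, X j ≤ 2 * j := fun j => by
    have h1 : X j ≤ 2 * Real.log j := by
      have := Real.log_natCast_nonneg j
      have h2 : 2 / (1 + 2 * δ) ≤ 2 := div_le_self (by norm_num) (by linarith)
      simp only [hX]
      gcongr
    exact h1.trans (by gcongr; exact Real.log_le_self (Nat.cast_nonneg j))
  set lam : ℕ → ℝ := fun j => √(X j / V j) with hlam
  have hVpos : ∀ᶠ j in atTop, d / 2 * (ρ ^ j) ^ β < V j := by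
    filter_upwards [hVlim.eventually_const_lt (half_lt_self hd0)] with j hj
    exact (lt_div_iff₀ (by positivity)).1 hj
  have hlamV : ∀ᶠ j in atTop, lam j ^ 2 * V j = X j := by
    filter_upwards [hVpos] with j hj
    have : 0 < V j := lt_trans (by positivity) hj
    rw [hlam]; simp only
    rw [Real.sq_sqrt (div_nonneg (hX0 j) this.le)]
    field_simp
  -- the normalised weights are uniformly small
  have hsmall : ∀ᶠ j in atTop, ∀ k, hitTime φ ρ j ≤ k →
      (lam j * a k) ^ 2 ≤ 4 * C / d * j / ρ ^ j := by
    have hratio : ∀ᶠ j in atTop, φ (hitTime φ ρ j) ^ β < 2 * (ρ ^ j) ^ β := by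
      have := (h.clock.tendsto_hitTime_div hρ).rpow_const (p := β) (Or.inl one_ne_zero)
      rw [Real.one_rpow] at this
      filter_upwards [this.eventually_lt_const one_lt_two] with j hj
      have hp : 0 < ρ ^ j := by positivity
      rw [Real.div_rpow (hp.le.trans (h.clock.le_hitTime ρ j)) hp.le] at hj
      exact (div_lt_iff₀ (by positivity)).1 hj
    have hX2 : ∀ᶠ j : ℕ in atTop, X j ≤ j := by
      have h1 := Real.isLittleO_log_id_atTop.comp_tendsto
        (tendsto_natCast_atTop_atTop (R := ℝ))
      filter_upwards [h1.bound (show (0 : ℝ) < 1 / 2 by norm_num)] with j hj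
      have h0 := Real.log_natCast_nonneg j
      simp only [Function.comp, id, Real.norm_eq_abs, abs_of_nonneg h0, Nat.abs_cast] at hj
      have h2 : 2 / (1 + 2 * δ) ≤ 2 := div_le_self (by norm_num) (by linarith)
      have : X j ≤ 2 * Real.log j := by simp only [hX]; gcongr
      linarith
    filter_upwards [hVpos, (h.clock.tendsto_hitTime hρ).eventually hCa, hratio, hX2]
      with j h1 h2 h3 h4 k hk
    have hp : 0 < ρ ^ j := by positivity
    have hpβ : 0 < (ρ ^ j) ^ β := by positivity
    have hV0 : 0 < V j := lt_trans (by positivity) h1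
    have hφ := h.clock.le_hitTime ρ j
    have hφ0 := hp.trans_le hφ
    have h5 : a k ^ 2 ≤ C * (2 * (ρ ^ j) ^ β / ρ ^ j) := by
      refine (h2 k hk).trans ?_
      rw [Real.rpow_sub_one hφ0.ne']
      gcongr
    calc (lam j * a k) ^ 2 = X j / V j * a k ^ 2 := by
          rw [mul_pow, hlam]; simp only
          rw [Real.sq_sqrt (div_nonneg (hX0 j) hV0.le)]
      _ ≤ j / (d / 2 * (ρ ^ j) ^ β) * (C * (2 * (ρ ^ j) ^ β / ρ ^ j)) := by gcongr
      _ = _ := by field_simp; ring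
  have hlim1 : Tendsto (fun j : ℕ => 4 * C / d * j / ρ ^ j) atTop (𝓝 0) := by
    have := (tendsto_pow_div_pow_atTop_zero 1 hρ).const_mul (4 * C / d)
    rw [mul_zero] at this
    refine this.congr fun j => by rw [pow_one]; ring
  have hlim3 : Tendsto (fun j : ℕ => (4 * C / d * j / ρ ^ j) * (2 * j) ^ 2) atTop (𝓝 0) := by
    have := (tendsto_pow_div_pow_atTop_zero 3 hρ).const_mul (16 * C / d)
    rw [mul_zero] at this
    refine this.congr fun j => by ring
  -- Bounds the error `65 * (exp (2 * X) * κ * X)` using `exp (2 * X) ≤ j ^ 4`, `X ≤ 2 * j` and `κ =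
  -- √K * ρ ^ (-(s / 2) * j)`.
  set b : ℕ → ℝ := fun j => 130 * √K * (j ^ 5 * ((ρ ^ (-(s / 2))) ^ j)) with hb
  refine (ae_frequently_of_le_measure_inter (𝒢 := fun j => ℱ (hitTime φ ρ j))
    (fun i j hij => ℱ.mono (hmono hij)) (fun j => ℱ.le _)
    (A := fun j => {ω | (1 - δ) * X j ≤ lam j *
      centredSum x m a (hitTime φ ρ j) (hitTime φ ρ (j + 1)) ω})
    (c := fun j => 1 / (2 * (j : ℝ))) (b := b) ?_ ?_ ?_ ?_ ?_ ?_).mono ?_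
  · intro j
    exact ((h.signs.measurable_centredSum_adapted a (hitTime φ ρ j)
      (hitTime φ ρ (j + 1))).const_mul (lam j)) measurableSet_Ici
  · filter_upwards [eventually_ge_atTop 1] with j hj
    have : (1 : ℝ) ≤ j := by exact_mod_cast hj
    exact ⟨by positivity, (div_le_one (by positivity)).2 (by linarith)⟩
  · have h1 := Real.tendsto_sum_range_one_div_nat_succ_atTop.const_mul_atTop
      (show (0 : ℝ) < 1 / 2 by norm_num)
    refine (tendsto_add_atTop_iff_nat 1).1 (h1.congr fun n => ?_)
    rw [Finset.sum_range_succ', Finset.mul_sum]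
    simp only [CharP.cast_eq_zero, mul_zero, div_zero, add_zero]
    refine Finset.sum_congr rfl fun i _ => ?_
    push_cast
    field_simp
  · intro j; positivity
  · refine Summable.mul_left _ (summable_pow_mul_geometric_of_norm_lt_one 5 ?_)
    rw [Real.norm_of_nonneg (by positivity)]
    exact Real.rpow_lt_one_of_one_lt_of_neg hρ (by linarith)
  · have hexp : ∀ᶠ j in atTop, 2 * Real.exp (-(X j * δ ^ 2 / 2)) ≤ 1 / 4 := by
      have h1 : Tendsto (fun j => X j * δ ^ 2 / 2) atTop atTop :=
        (hXlim.atTop_mul_const (by positivity)).atTop_div_const two_pos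
      have h2 := (Real.tendsto_exp_neg_atTop_nhds_zero.comp h1).const_mul 2
      rw [mul_zero] at h2
      exact (h2.eventually_lt_const (by norm_num)).mono fun j hj => hj.le
    filter_upwards [hlamV, hsmall, hexp, eventually_ge_atTop 1,
      hlim1.eventually_lt_const one_pos,
      hlim3.eventually_lt_const (show (0 : ℝ) < (1 / 260) ^ 2 by norm_num)]
      with j h1 h2 h3 h4 h5 h6 B hB
    have hj1 : (1 : ℝ) ≤ j := by exact_mod_cast h4
    have hp : 0 < ρ ^ j := by positivity
    have hN := h.clock.pow_le_natCast_hitTime ρ j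
    set κ := √K * (ρ ^ (-(s / 2))) ^ j with hκ
    have hκ0 : 0 < κ := by positivity
    set t := √(4 * C / d * j / ρ ^ j) with ht
    have ht0 : 0 ≤ t := Real.sqrt_nonneg _
    have hbt : ∀ k ∈ Finset.Ico (hitTime φ ρ j) (hitTime φ ρ (j + 1)), |lam j * a k| ≤ t :=
      fun k hk => Real.abs_le_sqrt (h2 k (Finset.mem_Ico.1 hk).1)
    have ht1 : t ≤ 1 := Real.sqrt_le_one.2 h5.le
    have hsum : ∑ k ∈ Finset.Ico (hitTime φ ρ j) (hitTime φ ρ (j + 1)), (lam j * a k) ^ 2 =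
        X j := by
      simp_rw [mul_pow, ← Finset.mul_sum]; exact h1
    -- The sum of cubes is at most `t * X j`, and `65 / 260 = 1 / 4` is what the large deviation
    -- bound allows.
    have htX : t * X j ≤ 1 / 260 := by
      refine (mul_le_mul_of_nonneg_left (hXj j) ht0).trans ?_
      refine le_of_sq_le_sq ?_ (by norm_num)
      rw [mul_pow, ht, Real.sq_sqrt (by positivity)]
      exact h6.le
    have h3b : 65 * ∑ k ∈ Finset.Ico (hitTime φ ρ j) (hitTime φ ρ (j + 1)), |lam j * a k| ^ 3 ≤
        1 / 4 := by
      have : ∑ k ∈ Finset.Ico (hitTime φ ρ j) (hitTime φ ρ (j + 1)), |lam j * a k| ^ 3 ≤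
          t * X j := by
        rw [← hsum, Finset.mul_sum]
        refine Finset.sum_le_sum fun k hk => ?_
        rw [pow_succ', sq_abs]
        exact mul_le_mul_of_nonneg_right (hbt k hk) (sq_nonneg _)
      linarith
    have hmκ : ∀ k ∈ Finset.Ico (hitTime φ ρ j) (hitTime φ ρ (j + 1)),
        ∫ ω, m k ω ^ 2 ∂μ ≤ κ ^ 2 := by
      intro k hk
      refine (hm k).trans ?_
      have e : κ ^ 2 = K * (ρ ^ j) ^ (-s) := by
        rw [hκ, mul_pow, Real.sq_sqrt hK.le, ← pow_mul, mul_comm j 2, pow_mul,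
          ← Real.rpow_natCast (ρ ^ (-(s / 2))) 2, ← Real.rpow_mul hρ0.le,
          ← Real.rpow_natCast _ j, ← Real.rpow_natCast ρ j, ← Real.rpow_mul hρ0.le,
          ← Real.rpow_mul hρ0.le]
        push_cast
        ring_nf
      rw [e]
      refine mul_le_mul_of_nonneg_left (Real.rpow_le_rpow_of_nonpos hp ?_ (by linarith)) hK.le
      have : (hitTime φ ρ j : ℝ) ≤ k := by exact_mod_cast (Finset.mem_Ico.1 hk).1
      linarith
    have main := h.signs.le_measure_inter_large_centredSum (fun k => lam j * a k)
      (hmono (Nat.le_succ j)) (fun k hk => (hbt k hk).trans ht1) hκ0 hmκ hsum hδ0.le h3b h3 hB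
    simp_rw [centredSum_mul] at main
    refine le_trans ?_ main
    have e1 : Real.exp (-((1 / 2 + δ) * X j)) / 2 = 1 / (2 * (j : ℝ)) := by
      have : (1 / 2 + δ) * X j = Real.log j := by simp only [hX]; field_simp
      rw [this, Real.exp_neg, Real.exp_log (by positivity)]
      field_simp
    have e2 : Real.exp (2 * X j) ≤ (j : ℝ) ^ 4 := by
      rw [← Real.exp_log (show (0 : ℝ) < j by positivity), ← Real.exp_nat_mul]
      refine Real.exp_le_exp.2 ?_
      have h2 : 2 / (1 + 2 * δ) ≤ 2 := div_le_self (by norm_num) (by linarith)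
      have := Real.log_natCast_nonneg j
      simp only [hX]
      push_cast
      nlinarith
    have e3 : 65 * (Real.exp (2 * X j) * κ * X j) ≤ b j := by
      calc 65 * (Real.exp (2 * X j) * κ * X j) ≤ 65 * ((j : ℝ) ^ 4 * κ * (2 * j)) := by
            have := hX0 j
            gcongr
            exact hXj j
        _ = b j := by simp only [hb, hκ]; ring
    rw [e1]
    linarith
  · intro ω hω
    have hev : ∀ᶠ j in atTop, (1 - δ) * X j ≤ lam j *
        centredSum x m a (hitTime φ ρ j) (hitTime φ ρ (j + 1)) ω →
        D * blockNorm ρ β j ≤ centredSum x m a (hitTime φ ρ j) (hitTime φ ρ (j + 1)) ω := by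
      have h7 := hVlim.const_mul ((1 - δ) ^ 2 / (1 + 2 * δ))
      filter_upwards [hlamV, hVpos, hXlim.eventually_gt_atTop 0, h7.eventually_const_lt hδD]
        with j h1 h2 h3 h4 h5
      have hp : 0 < (ρ ^ j) ^ β := by positivity
      have hV0 : 0 < V j := lt_trans (by positivity) h2
      have hl0 : 0 < lam j := Real.sqrt_pos.2 (by positivity)
      -- Undoing the scaling: `X j = lam j ^ 2 * V j`, so the event says that the block sum is at
      -- least `(1 - δ) * lam j * V j`, whose square is `(1 - δ) ^ 2 * X j * V j`.
      have h6 : D * blockNorm ρ β j ≤ (1 - δ) * (lam j * V j) := by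
        have hn : 0 ≤ (1 - δ) * (lam j * V j) :=
          mul_nonneg (by linarith) (by positivity)
        refine le_of_sq_le_sq ?_ hn
        have : ((1 - δ) * (lam j * V j)) ^ 2 = (1 - δ) ^ 2 * (X j * V j) := by rw [← h1]; ring
        rw [this, mul_pow, blockNorm_sq hρ0]
        have hlog : 0 ≤ Real.log j := Real.log_natCast_nonneg j
        have h8 : D ^ 2 * (ρ ^ j) ^ β ≤ (1 - δ) ^ 2 / (1 + 2 * δ) * V j := by
          rw [← mul_div_assoc, lt_div_iff₀ hp] at h4
          exact h4.le
        calc D ^ 2 * (2 * (ρ ^ j) ^ β * Real.log j) =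
            2 * Real.log j * (D ^ 2 * (ρ ^ j) ^ β) := by ring
          _ ≤ 2 * Real.log j * ((1 - δ) ^ 2 / (1 + 2 * δ) * V j) := by gcongr
          _ = (1 - δ) ^ 2 * (X j * V j) := by simp only [hX]; ring
      refine h6.trans (le_of_mul_le_mul_left ?_ hl0)
      calc lam j * ((1 - δ) * (lam j * V j)) = (1 - δ) * X j := by rw [← h1]; ring
        _ ≤ _ := h5
    exact (hω.and_eventually hev).mono fun j hj => hj.2 hj.1

end IsScaledProcess

end

/-! ### Lower half of the law of the iterated logarithm -/

section

theorem IsClock.eventually_lilNorm_pos {φ : ℕ → ℝ} (hφ : IsClock φ) (β : ℝ) :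
    ∀ᶠ n in atTop, 0 < lilNorm φ β n := by
  have h1 := (Real.tendsto_log_atTop.comp (Real.tendsto_log_atTop.comp
    hφ.tendsto)).eventually_gt_atTop 0
  filter_upwards [h1, hφ.tendsto.eventually_gt_atTop 0] with n hn hn2
  simp only [Function.comp] at hn
  exact Real.sqrt_pos.2 (by positivity)

/-- Here `e j` indexes the end of the block where `y` is to be large and `o j` the opposite end. A
large increment from `o` to `e` forces a large value at `e`, since `y` cannot be very negative at
`o`; the cost is `B` times the limiting ratio `r` of the norms. -/
theorem IsClock.frequently_lilNorm_le_of_blocks {φ : ℕ → ℝ} (hφ : IsClock φ) {ρ : ℝ}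
    (hρ : 1 < ρ) {β : ℝ} {y : ℕ → ℝ} {e o : ℕ → ℕ} (he : Tendsto e atTop atTop)
    (ho : Tendsto o atTop atTop) {B D r l : ℝ}
    (hy : ∀ᶠ n in atTop, -y n ≤ B * lilNorm φ β n)
    (hr : Tendsto (fun j => blockNorm ρ β (o j) / blockNorm ρ β (e j)) atTop (𝓝 r))
    (hD : ∃ᶠ j in atTop, D * blockNorm ρ β (e j) ≤
      y (hitTime φ ρ (e j)) - y (hitTime φ ρ (o j))) (hl : l < D - B * r) :
    ∃ᶠ n in atTop, l * lilNorm φ β n ≤ y n := by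
  have hρ0 : 0 < ρ := by positivity
  have hgo := ho.eventually (eventually_blockNorm_pos hρ0 β)
  have hge := he.eventually (eventually_blockNorm_pos hρ0 β)
  have h1 : Tendsto (fun j => lilNorm φ β (hitTime φ ρ (e j)) / blockNorm ρ β (e j)) atTop
      (𝓝 1) := (hφ.tendsto_lilNorm_hitTime_div hρ β).comp he
  have h2 : Tendsto (fun j => lilNorm φ β (hitTime φ ρ (o j)) / blockNorm ρ β (e j)) atTop
      (𝓝 r) := by
    have := ((hφ.tendsto_lilNorm_hitTime_div hρ β).comp ho).mul hr
    rw [one_mul] at this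
    refine this.congr' ?_
    filter_upwards [hgo] with j hj
    simp only [Function.comp]
    field_simp
  have h3 := ((h2.const_mul B).const_sub D).sub (h1.const_mul l)
  have h4 : 0 < D - B * r - l * 1 := by linarith
  have h5 : ∀ᶠ j in atTop, D * blockNorm ρ β (e j) ≤
      y (hitTime φ ρ (e j)) - y (hitTime φ ρ (o j)) →
      l * lilNorm φ β (hitTime φ ρ (e j)) ≤ y (hitTime φ ρ (e j)) := by
    filter_upwards [h3.eventually_const_lt h4, hge,
      ((hφ.tendsto_hitTime hρ).comp ho).eventually hy] with j g1 g2 g3 g4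
    have g5 := mul_pos g1 g2
    have g6 : (D - B * (lilNorm φ β (hitTime φ ρ (o j)) / blockNorm ρ β (e j)) -
        l * (lilNorm φ β (hitTime φ ρ (e j)) / blockNorm ρ β (e j))) * blockNorm ρ β (e j) =
        D * blockNorm ρ β (e j) - B * lilNorm φ β (hitTime φ ρ (o j)) -
        l * lilNorm φ β (hitTime φ ρ (e j)) := by field_simp
    simp only [Function.comp] at g3
    linarith
  exact ((hφ.tendsto_hitTime hρ).comp he).frequently
    ((hD.and_eventually h5).mono fun j hj => hj.2 hj.1)

theorem limsup_div_eq {y ψ : ℕ → ℝ} {c : ℝ} (hψ : ∀ᶠ n in atTop, 0 < ψ n)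
    (hle : ∀ k : ℕ, ∀ᶠ n in atTop, y n ≤ (c + 1 / ((k : ℝ) + 1)) * ψ n)
    (hge : ∀ k : ℕ, ∃ᶠ n in atTop, (c - 1 / ((k : ℝ) + 1)) * ψ n ≤ y n) :
    limsup (fun n => ((y n / ψ n : ℝ) : EReal)) atTop = c := by
  apply le_antisymm
  · rw [← EReal.le_of_forall_lt_iff_le]
    intro z hz
    obtain ⟨k, hk⟩ := exists_nat_one_div_lt (sub_pos.2 (EReal.coe_lt_coe_iff.1 hz))
    refine limsup_le_of_le (by isBoundedDefault) ?_
    filter_upwards [hψ, hle k] with n h1 h2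
    rw [EReal.coe_le_coe_iff, div_le_iff₀ h1]
    nlinarith
  · rw [← EReal.ge_of_forall_gt_iff_ge]
    intro z hz
    obtain ⟨k, hk⟩ := exists_nat_one_div_lt (sub_pos.2 (EReal.coe_lt_coe_iff.1 hz))
    refine le_limsup_of_frequently_le ?_ (by isBoundedDefault)
    refine ((hge k).and_eventually hψ).mono fun n ⟨h1, h2⟩ => ?_
    rw [EReal.coe_le_coe_iff, le_div_iff₀ h2]
    nlinarith

namespace IsScaledProcess

variable {Ω : Type*} [mΩ : MeasurableSpace Ω] {μ : Measure Ω} [IsProbabilityMeasure μ]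
  {ℱ : Filtration ℕ mΩ} {x m : ℕ → Ω → ℝ} {a : ℕ → ℝ} {Y : ℕ → Ω → ℝ} {w φ : ℕ → ℝ} {β c σ : ℝ}

/-- For large `ρ` the block variance is the proportion `1 - ρ ^ (-|β|)` of the variance at its
dominant end, and the norm at the other end is smaller by the factor `√(ρ ^ (-|β|))`. A crude upper
bound for `-Y` at the other end is then enough. -/
theorem ae_frequently_lilNorm_le (h : IsScaledProcess μ ℱ x m a Y w φ β c σ) {ε : ℝ}
    (hε : 0 < ε) :
    ∀ᵐ ω ∂μ, ∃ᶠ n in atTop, (√c - ε) * lilNorm φ β n ≤ Y n ω := by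
  have hc := h.scale_pos
  have hsc : 0 < √c := Real.sqrt_pos.2 hc
  wlog hεc : ε < √c generalizing ε
  · filter_upwards [this (half_pos hsc) (half_lt_self hsc)] with ω hω
    refine hω.mono fun n hn => hn.trans' ?_
    exact mul_le_mul_of_nonneg_right (by linarith) (Real.sqrt_nonneg _)
  set D := √c - ε / 2 with hD
  have hD0 : 0 < D := by linarith
  have hDc : D ^ 2 < c := by nlinarith [Real.sq_sqrt hc.le]
  have hβ : 0 < |β| := abs_pos.2 (by rcases h.sign_eq with e | e; exacts [e.1.ne', e.1.ne])
  -- a large ratio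
  obtain ⟨ρ, ⟨hρ1, hρ2⟩, hρ⟩ : ∃ ρ : ℝ, (D ^ 2 < c * (1 - ρ ^ (-|β|)) ∧
      √c - ε < D - 2 * √c * √(ρ ^ (-|β|))) ∧ 1 < ρ := by
    have t := tendsto_rpow_neg_atTop hβ
    have e1 := (t.const_sub 1).const_mul c
    have e2 := (t.sqrt.const_mul (2 * √c)).const_sub D
    rw [sub_zero, mul_one] at e1
    rw [Real.sqrt_zero, mul_zero, sub_zero] at e2
    exact (((e1.eventually_const_lt hDc).and (e2.eventually_const_lt (by linarith))).and
      (eventually_gt_atTop 1)).exists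
  have hρ0 : 0 < ρ := by positivity
  -- The upper half with `ε = √c`, which gives the constant `2 * √c`.
  have hneg := h.neg.ae_eventually_le_lilNorm hsc
  have hneg' : ∀ᵐ ω ∂μ, ∀ᶠ n in atTop, -Y n ω ≤ 2 * √c * lilNorm φ β n := by
    filter_upwards [hneg] with ω hω
    filter_upwards [hω] with n hn
    simp only [Pi.neg_apply] at hn
    linarith
  have hmono := h.clock.monotone_hitTime (ρ := ρ) hρ.le
  have hlim := tendsto_blockNorm_succ_div hρ0 β
  have hpβ : 0 < ρ ^ β := by positivity
  -- For `β > 0` the dominant end is the right one, `j + 1`, and the block bound, stated with the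
  -- norm at `j`, has to be converted. For `β < 0` it is the left one, `j`.
  rcases h.sign_eq with ⟨hβ0, rfl⟩ | ⟨hβ0, rfl⟩
  · rw [abs_of_pos hβ0, Real.rpow_neg hρ0.le] at hρ1 hρ2
    have hD2 : D * √(ρ ^ β) < √(c * (1 * (ρ ^ β - 1))) := by
      apply Real.lt_sqrt_of_sq_lt
      rw [mul_pow, Real.sq_sqrt hpβ.le]
      calc D ^ 2 * ρ ^ β < c * (1 - (ρ ^ β)⁻¹) * ρ ^ β := by gcongr
        _ = _ := by field_simp
    obtain ⟨D', hD'1, hD'2⟩ := exists_between hD2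
    have hD'0 : 0 < D' := lt_trans (by positivity) hD'1
    have hb := h.ae_frequently_blockNorm_le_sum hρ (D := D') ((Real.lt_sqrt hD'0.le).1 hD'2)
    filter_upwards [hneg', hb] with ω h1 h2
    refine h.clock.frequently_lilNorm_le_of_blocks hρ (e := fun j => j + 1) (o := fun j => j)
      (tendsto_add_atTop_nat 1) tendsto_id h1
      (r := √(ρ ^ β)⁻¹) (D := D) ?_ ?_ hρ2
    · rw [Real.sqrt_inv]
      refine (hlim.inv₀ (Real.sqrt_pos.2 hpβ).ne').congr fun j => by rw [inv_div]
    · have h3 := (hlim.const_mul D).eventually_lt_const hD'1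
      refine (h2.and_eventually (h3.and (eventually_blockNorm_pos hρ0 β))).mono ?_
      rintro j ⟨g1, g2, g3⟩
      rw [h.sub_eq _ _ (hmono (Nat.le_succ j)), one_mul]
      refine le_trans ?_ g1
      rw [← mul_div_assoc, div_lt_iff₀ g3] at g2
      exact g2.le
  · rw [abs_of_neg hβ0, neg_neg] at hρ1 hρ2
    have hb := h.ae_frequently_blockNorm_le_sum hρ (D := D) (by linarith)
    filter_upwards [hneg', hb] with ω h1 h2
    refine h.clock.frequently_lilNorm_le_of_blocks hρ (e := fun j => j) (o := fun j => j + 1)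
      tendsto_id (tendsto_add_atTop_nat 1) h1 hlim (D := D) ?_ hρ2
    refine h2.mono fun j hj => ?_
    have := h.sub_eq _ _ (hmono (Nat.le_succ j)) ω
    linarith

/-- The law of the iterated logarithm. -/
theorem ae_limsupPM (h : IsScaledProcess μ ℱ x m a Y w φ β c σ) :
    ∀ᵐ ω ∂μ, LimsupPM (fun n => Y n ω / lilNorm φ β n) √c := by
  have hpos : ∀ k : ℕ, (0 : ℝ) < 1 / ((k : ℝ) + 1) := fun k => by positivity
  filter_upwards [ae_all_iff.2 fun k => h.ae_eventually_le_lilNorm (hpos k),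
    ae_all_iff.2 fun k => h.ae_frequently_lilNorm_le (hpos k),
    ae_all_iff.2 fun k => h.neg.ae_eventually_le_lilNorm (hpos k),
    ae_all_iff.2 fun k => h.neg.ae_frequently_lilNorm_le (hpos k)] with ω h1 h2 h3 h4
  have hψ := h.clock.eventually_lilNorm_pos β
  refine ⟨limsup_div_eq hψ h1 h2, ?_⟩
  simpa [neg_div] using limsup_div_eq hψ h3 h4

end IsScaledProcess

end

/-! ### Convergent sums, remainders and the central limit theorem -/

section

/-- Fatou's lemma, in the form that carries exponential moment bounds over to remainders. -/
theorem lintegral_le_of_ae_tendsto {Ω : Type*} [MeasurableSpace Ω] {μ : Measure Ω}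
    {f : ℕ → Ω → ENNReal} (hf : ∀ n, Measurable (f n)) {g : Ω → ENNReal}
    (hlim : ∀ᵐ ω ∂μ, Tendsto (fun n => f n ω) atTop (𝓝 (g ω))) {C : ENNReal}
    (hC : ∀ n, ∫⁻ ω, f n ω ∂μ ≤ C) : ∫⁻ ω, g ω ∂μ ≤ C := by
  calc ∫⁻ ω, g ω ∂μ = ∫⁻ ω, liminf (fun n => f n ω) atTop ∂μ := by
        refine lintegral_congr_ae ?_
        filter_upwards [hlim] with ω hω using hω.liminf_eq.symm
    _ ≤ liminf (fun n => ∫⁻ ω, f n ω ∂μ) atTop := lintegral_liminf_le hf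
    _ ≤ C := liminf_le_of_le (by isBoundedDefault) fun b hb => by
        obtain ⟨n, hn⟩ := hb.exists
        exact hn.trans (hC n)

/-- Convergence to a centred normal law from convergence of characteristic functions. -/
theorem CLT.of_tendsto_charFun {Ω : Type*} [MeasurableSpace Ω] {μ : Measure Ω}
    [IsProbabilityMeasure μ] {Y : ℕ → Ω → ℝ} {v : ℝ} (hv : 0 ≤ v) (hY : ∀ n, AEMeasurable (Y n) μ)
    (h : ∀ t : ℝ, Tendsto (fun n => ∫ ω, Complex.exp (Complex.I * (t * Y n ω : ℝ)) ∂μ) atTop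
      (𝓝 (Complex.exp (-(v * t ^ 2 : ℝ) / 2)))) : CLT μ Y v := by
  refine ⟨hY, aemeasurable_id, ProbabilityMeasure.tendsto_iff_tendsto_charFun.2 fun t => ?_⟩
  simp only [ProbabilityMeasure.coe_mk, Measure.map_id, charFun_gaussianReal]
  simp only [charFun_apply_real]
  convert h t using 1
  · ext n
    rw [integral_map (hY n) (by fun_prop)]
    congr 1 with ω
    push_cast
    ring_nf
  · rw [Real.coe_toNNReal _ hv]
    push_cast
    ring_nf

namespace IsPredictedSigns

variable {Ω : Type*} [mΩ : MeasurableSpace Ω] {μ : Measure Ω} [IsProbabilityMeasure μ]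
  {ℱ : Filtration ℕ mΩ} {x m : ℕ → Ω → ℝ}

/-! ### Second moments -/

theorem memLp_centredSum (h : IsPredictedSigns μ ℱ x m) (b : ℕ → ℝ) (N n : ℕ) (p : ENNReal) :
    MemLp (centredSum x m b N n) p μ :=
  .of_bound (h.measurable_centredSum b N n).aestronglyMeasurable _
    (ae_of_all _ (h.abs_centredSum_le b N n))

theorem memLp_pred (h : IsPredictedSigns μ ℱ x m) (k : ℕ) (p : ENNReal) : MemLp (m k) p μ :=
  .of_bound (h.measurable_pred k).aestronglyMeasurable 1 (ae_of_all _ (h.abs_le k))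

theorem memLp_sign (h : IsPredictedSigns μ ℱ x m) (k : ℕ) (p : ENNReal) : MemLp (x k) p μ :=
  .of_bound (h.measurable_sign k).aestronglyMeasurable 1
    (ae_of_all _ fun ω => (h.abs_sign k ω).le)

theorem integral_sub_sq (h : IsPredictedSigns μ ℱ x m) (k : ℕ) :
    ∫ ω, (x k ω - m k ω) ^ 2 ∂μ = 1 - ∫ ω, m k ω ^ 2 ∂μ := by
  have e : ∀ ω, (x k ω - m k ω) ^ 2 = 1 - 2 * (m k ω * x k ω) + m k ω ^ 2 := fun ω => by
    have : x k ω ^ 2 = 1 := by rcases h.sign k ω with e | e <;> simp [e]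
    linear_combination this
  have i1 : Integrable (fun ω => m k ω * x k ω) μ :=
    (h.memLp_pred k 2).integrable_mul (h.memLp_sign k 2)
  have i2 : Integrable (fun ω => m k ω ^ 2) μ := (h.memLp_pred k 2).integrable_sq
  have i3 : Integrable (fun ω => 1 - 2 * (m k ω * x k ω)) μ :=
    (integrable_const 1).sub (i1.const_mul 2)
  simp_rw [e]
  rw [integral_add i3 i2, integral_sub (integrable_const 1) (i1.const_mul 2), integral_const_mul,
    h.integral_mul_sign k (h.predictable k) (h.abs_le k)]
  simp_rw [← sq]
  simp
  ring

theorem integral_centredSum_mul (h : IsPredictedSigns μ ℱ x m) (b : ℕ → ℝ) (N n : ℕ) :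
    ∫ ω, centredSum x m b N n ω * (x n ω - m n ω) ∂μ = 0 := by
  have e := h.integral_mul_sign n (h.measurable_centredSum_adapted b N n)
    (h.abs_centredSum_le b N n)
  have i1 : Integrable (fun ω => centredSum x m b N n ω * x n ω) μ :=
    (h.memLp_centredSum b N n 2).integrable_mul (h.memLp_sign n 2)
  have i2 : Integrable (fun ω => centredSum x m b N n ω * m n ω) μ :=
    (h.memLp_centredSum b N n 2).integrable_mul (h.memLp_pred n 2)
  simp_rw [mul_sub]
  rw [integral_sub i1 i2, e, sub_self]

/-- Martingale increments are orthogonal, and a centred sign has variance `1 - E[m ^ 2]`. -/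
theorem integral_centredSum_sq (h : IsPredictedSigns μ ℱ x m) (b : ℕ → ℝ) {N n : ℕ}
    (hn : N ≤ n) :
    ∫ ω, centredSum x m b N n ω ^ 2 ∂μ =
      ∑ k ∈ Finset.Ico N n, b k ^ 2 * (1 - ∫ ω, m k ω ^ 2 ∂μ) := by
  induction n, hn using Nat.le_induction with
  | base => simp
  | succ n hn ih =>
    have e : ∀ ω, centredSum x m b N (n + 1) ω ^ 2 = centredSum x m b N n ω ^ 2 +
        2 * b n * (centredSum x m b N n ω * (x n ω - m n ω)) +
        b n ^ 2 * (x n ω - m n ω) ^ 2 := fun ω => by rw [centredSum_succ x m b hn]; ring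
    have hd : MemLp (fun ω => x n ω - m n ω) 2 μ := (h.memLp_sign n 2).sub (h.memLp_pred n 2)
    have i1 : Integrable (fun ω => centredSum x m b N n ω ^ 2) μ :=
      (h.memLp_centredSum b N n 2).integrable_sq
    have i2 : Integrable (fun ω => centredSum x m b N n ω * (x n ω - m n ω)) μ :=
      (h.memLp_centredSum b N n 2).integrable_mul hd
    have i3 : Integrable (fun ω => (x n ω - m n ω) ^ 2) μ := hd.integrable_sq
    have i4 : Integrable (fun ω => centredSum x m b N n ω ^ 2 +
        2 * b n * (centredSum x m b N n ω * (x n ω - m n ω))) μ := i1.add (i2.const_mul _)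
    simp_rw [e]
    rw [integral_add i4 (i3.const_mul _), integral_add i1 (i2.const_mul _), integral_const_mul,
      integral_const_mul, h.integral_centredSum_mul, h.integral_sub_sq, ih,
      Finset.sum_Ico_succ_top hn]
    ring

theorem integral_centredSum (h : IsPredictedSigns μ ℱ x m) (b : ℕ → ℝ) (N n : ℕ) :
    ∫ ω, centredSum x m b N n ω ∂μ = 0 := by
  have hi (y : ℕ → Ω → ℝ) (hy : ∀ k, MemLp (y k) 1 μ) (k : ℕ) : Integrable (y k) μ :=
    memLp_one_iff_integrable.1 (hy k)
  have ix := hi x fun k => h.memLp_sign k 1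
  have im := hi m fun k => h.memLp_pred k 1
  simp only [centredSum]
  refine (integral_finsetSum (f := fun k ω => b k * (x k ω - m k ω)) _
    fun k _ => ((ix k).sub (im k)).const_mul (b k)).trans ?_
  refine Finset.sum_eq_zero fun k _ => ?_
  have := h.integral_mul_sign k (H := fun _ => 1) measurable_const (C := 1) (by simp)
  simp only [one_mul] at this
  rw [integral_const_mul, integral_sub (ix k) (im k), this, sub_self, mul_zero]

theorem integral_pred_sq_nonneg (k : ℕ) : 0 ≤ ∫ ω, m k ω ^ 2 ∂μ :=
  integral_nonneg fun _ => sq_nonneg _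

theorem eLpNorm_centredSum_le (h : IsPredictedSigns μ ℱ x m) (b : ℕ → ℝ) {N n : ℕ}
    (hn : N ≤ n) {v : ℝ} (hv : ∑ k ∈ Finset.Ico N n, b k ^ 2 ≤ v) :
    eLpNorm (centredSum x m b N n) 2 μ ≤ ENNReal.ofReal √v := by
  rw [(h.memLp_centredSum b N n 2).eLpNorm_eq_integral_rpow_norm two_ne_zero ENNReal.ofNat_ne_top]
  refine ENNReal.ofReal_le_ofReal ?_
  simp only [ENNReal.toReal_ofNat, Real.rpow_ofNat, Real.norm_eq_abs, sq_abs]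
  rw [Real.sqrt_eq_rpow, one_div, h.integral_centredSum_sq b hn]
  refine Real.rpow_le_rpow (Finset.sum_nonneg fun k _ => ?_) (le_trans ?_ hv) (by norm_num)
  · have h1 : ∫ ω, m k ω ^ 2 ∂μ ≤ 1 := by
      have := h.integral_sub_sq k ▸ integral_nonneg (μ := μ) fun ω => sq_nonneg (x k ω - m k ω)
      linarith
    exact mul_nonneg (sq_nonneg _) (by linarith)
  · refine Finset.sum_le_sum fun k _ => ?_
    have := integral_pred_sq_nonneg (μ := μ) (m := m) k
    nlinarith [sq_nonneg (b k)]

theorem martingale_centredSum (h : IsPredictedSigns μ ℱ x m) (b : ℕ → ℝ) :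
    Martingale (centredSum x m b 0) ℱ μ := by
  refine martingale_of_condExp_sub_eq_zero_nat
    (fun n => (h.measurable_centredSum_adapted b 0 n).stronglyMeasurable)
    (fun n => memLp_one_iff_integrable.1 (h.memLp_centredSum b 0 n 1)) fun n => ?_
  have e : centredSum x m b 0 (n + 1) - centredSum x m b 0 n = b n • (x n - m n) := by
    ext ω
    simp [centredSum_succ x m b (Nat.zero_le n)]
  rw [e]
  have ix := memLp_one_iff_integrable.1 (h.memLp_sign n 1)
  have im := memLp_one_iff_integrable.1 (h.memLp_pred n 1)
  have h1 := condExp_smul (μ := μ) (b n) (x n - m n) (ℱ n)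
  have h2 := condExp_sub ix im (ℱ n)
  have h3 := condExp_of_stronglyMeasurable (ℱ.le n) (h.predictable n).stronglyMeasurable im
  filter_upwards [h1, h2, h.condExp_eq n] with ω g1 g2 g3
  rw [g1, Pi.smul_apply, g2, Pi.sub_apply, g3, h3]
  simp

/-! ### Convergent weighted sums and their remainders -/

theorem sum_Ico_sq_eq {a : ℕ → ℝ} (ha : Summable fun k => a k ^ 2) {N n : ℕ} (hn : N ≤ n) :
    ∑ k ∈ Finset.Ico N n, a k ^ 2 = (∑' k, a (k + N) ^ 2) - ∑' k, a (k + n) ^ 2 := by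
  have h1 := ha.sum_add_tsum_nat_add N
  have h2 := ha.sum_add_tsum_nat_add n
  rw [Finset.sum_Ico_eq_sub _ hn]
  linarith

theorem sum_Ico_sq_le {a : ℕ → ℝ} (ha : Summable fun k => a k ^ 2) {N n : ℕ} (hn : N ≤ n) :
    ∑ k ∈ Finset.Ico N n, a k ^ 2 ≤ ∑' k, a (k + N) ^ 2 := by
  rw [sum_Ico_sq_eq ha hn]
  have : 0 ≤ ∑' k, a (k + n) ^ 2 := tsum_nonneg fun k => sq_nonneg _
  linarith

/-- Square summable weights bound the martingale in `L²`, hence in `L¹`, and the martingale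
convergence theorem applies. -/
theorem exists_tendsto_centredSum (h : IsPredictedSigns μ ℱ x m) {a : ℕ → ℝ}
    (ha : Summable fun k => a k ^ 2) :
    ∃ L : Ω → ℝ, Measurable L ∧
      ∀ᵐ ω ∂μ, Tendsto (fun n => centredSum x m a 0 n ω) atTop (𝓝 (L ω)) := by
  refine measurable_limit_of_tendsto_metrizable_ae
    (fun n => (h.measurable_centredSum a 0 n).aemeasurable)
    ((h.martingale_centredSum a).submartingale.exists_ae_tendsto_of_bdd
      (R := (√(∑' k, a (k + 0) ^ 2)).toNNReal) fun n => ?_)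
  exact (eLpNorm_le_eLpNorm_of_exponent_le (by norm_num)
    (h.measurable_centredSum a 0 n).aestronglyMeasurable).trans
    (h.eLpNorm_centredSum_le a (Nat.zero_le n) (sum_Ico_sq_le ha (Nat.zero_le n)))

theorem tendsto_remainder {a : ℕ → ℝ} {L : Ω → ℝ} {ω : Ω}
    (hL : Tendsto (fun n => centredSum x m a 0 n ω) atTop (𝓝 (L ω))) (n : ℕ) :
    Tendsto (fun l => centredSum x m a n (n + l) ω) atTop (𝓝 (L ω - centredSum x m a 0 n ω)) := by
  have h1 := (hL.comp (tendsto_add_atTop_nat n)).sub_const (centredSum x m a 0 n ω)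
  refine h1.congr fun l => ?_
  rw [Function.comp, add_comm l n, ← centredSum_add x m a (Nat.zero_le n) (Nat.le_add_right n l)]
  ring

theorem eLpNorm_remainder_le (h : IsPredictedSigns μ ℱ x m) {a : ℕ → ℝ}
    (ha : Summable fun k => a k ^ 2) {L : Ω → ℝ}
    (hL : ∀ᵐ ω ∂μ, Tendsto (fun n => centredSum x m a 0 n ω) atTop (𝓝 (L ω))) (n : ℕ) :
    eLpNorm (fun ω => L ω - centredSum x m a 0 n ω) 2 μ ≤
      ENNReal.ofReal √(∑' k, a (k + n) ^ 2) := by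
  refine (Lp.eLpNorm_lim_le_liminf_eLpNorm
    (fun l => (h.measurable_centredSum a n (n + l)).aestronglyMeasurable) _
    (hL.mono fun ω hω => tendsto_remainder hω n)).trans ?_
  refine liminf_le_of_le (by isBoundedDefault) fun b hb => ?_
  obtain ⟨l, hl⟩ := hb.exists
  exact hl.trans (h.eLpNorm_centredSum_le a (Nat.le_add_right n l)
    (sum_Ico_sq_le ha (Nat.le_add_right n l)))

theorem hasSubgaussianMGF_centredSum (h : IsPredictedSigns μ ℱ x m) (a : ℕ → ℝ) {N n : ℕ}
    (hn : N ≤ n) :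
    HasSubgaussianMGF (centredSum x m a N n) (∑ k ∈ Finset.Ico N n, a k ^ 2).toNNReal μ where
  integrable_exp_mul t := by
    simp_rw [← centredSum_mul]
    exact h.integrable_exp_centredSum _ N n
  mgf_le t := by
    have := h.integral_exp_centredSum_le (fun k => t * a k) hn
    simp_rw [centredSum_mul, mul_pow, ← Finset.mul_sum] at this
    rw [Real.coe_toNNReal _ (Finset.sum_nonneg fun k _ => sq_nonneg _), mul_comm _ (t ^ 2)]
    exact this

/-- The finite blocks starting at `n` have exponential moments bounded by the full tail of the
variances. Fatou's lemma passes this to the limit, which gives integrability and the bound together.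
-/
theorem hasSubgaussianMGF_remainder (h : IsPredictedSigns μ ℱ x m) {a : ℕ → ℝ}
    (ha : Summable fun k => a k ^ 2) {L : Ω → ℝ} (hLm : Measurable L)
    (hL : ∀ᵐ ω ∂μ, Tendsto (fun n => centredSum x m a 0 n ω) atTop (𝓝 (L ω))) (n : ℕ) :
    HasSubgaussianMGF (fun ω => L ω - centredSum x m a 0 n ω) (∑' k, a (k + n) ^ 2).toNNReal μ := by
  have hw : 0 ≤ ∑' k, a (k + n) ^ 2 := tsum_nonneg fun k => sq_nonneg _
  have hSm := h.measurable_centredSum a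
  have key (t : ℝ) : ∫⁻ ω, ENNReal.ofReal (Real.exp (t * (L ω - centredSum x m a 0 n ω))) ∂μ ≤
      ENNReal.ofReal (Real.exp ((∑' k, a (k + n) ^ 2) * t ^ 2 / 2)) := by
    refine lintegral_le_of_ae_tendsto
      (f := fun l ω => ENNReal.ofReal (Real.exp (t * centredSum x m a n (n + l) ω)))
      (fun l => by have := hSm n (n + l); fun_prop) ?_ fun l => ?_
    · filter_upwards [hL] with ω hω
      exact (ENNReal.continuous_ofReal.tendsto _).comp
        ((Real.continuous_exp.tendsto _).comp ((tendsto_remainder hω n).const_mul t))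
    · have hs := h.hasSubgaussianMGF_centredSum a (Nat.le_add_right n l)
      rw [← ofReal_integral_eq_lintegral_ofReal (hs.integrable_exp_mul t)
        (ae_of_all _ fun _ => (Real.exp_pos _).le)]
      refine ENNReal.ofReal_le_ofReal ((hs.mgf_le t).trans (Real.exp_le_exp.2 ?_))
      rw [Real.coe_toNNReal _ (Finset.sum_nonneg fun k _ => sq_nonneg _)]
      gcongr
      exact sum_Ico_sq_le ha (Nat.le_add_right n l)
  have hint (t : ℝ) : Integrable (fun ω => Real.exp (t * (L ω - centredSum x m a 0 n ω))) μ := by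
    have := hSm 0 n
    refine ⟨by fun_prop, ?_⟩
    rw [hasFiniteIntegral_iff_ofReal (ae_of_all _ fun _ => (Real.exp_pos _).le)]
    exact (key t).trans_lt ENNReal.ofReal_lt_top
  refine ⟨hint, fun t => ?_⟩
  have k := key t
  rw [← ofReal_integral_eq_lintegral_ofReal (hint t) (ae_of_all _ fun _ => (Real.exp_pos _).le),
    ENNReal.ofReal_le_ofReal_iff (Real.exp_pos _).le] at k
  rwa [Real.coe_toNNReal _ hw]

/-- If the limit were a constant `c`, then `E[(S n - c) ^ 2] = E[S n ^ 2] + c ^ 2` would stay above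
the contribution of the single index `k₀`, contradicting convergence in `L²`. -/
theorem variance_limit_pos (h : IsPredictedSigns μ ℱ x m) {a : ℕ → ℝ} {L : Ω → ℝ}
    (hLp : MemLp L 2 μ)
    (hL : Tendsto (fun n => eLpNorm (fun ω => centredSum x m a 0 n ω - L ω) 2 μ) atTop (𝓝 0))
    {k₀ : ℕ} (hk₀ : a k₀ ≠ 0) (hm₀ : ∫ ω, m k₀ ω ^ 2 ∂μ < 1) : 0 < variance L μ := by
  refine lt_of_le_of_ne (variance_nonneg _ _) fun h0 => ?_
  have hconst : L =ᵐ[μ] fun _ => ∫ ω, L ω ∂μ := by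
    rw [← evariance_eq_zero_iff hLp.1.aemeasurable, ← hLp.ofReal_variance_eq, ← h0,
      ENNReal.ofReal_zero]
  set c := ∫ ω, L ω ∂μ
  have hle (n : ℕ) (hn : k₀ < n) : ENNReal.ofReal (√(a k₀ ^ 2 * (1 - ∫ ω, m k₀ ω ^ 2 ∂μ))) ≤
      eLpNorm (fun ω => centredSum x m a 0 n ω - L ω) 2 μ := by
    have e : eLpNorm (fun ω => centredSum x m a 0 n ω - L ω) 2 μ =
        eLpNorm (fun ω => centredSum x m a 0 n ω - c) 2 μ := by
      refine eLpNorm_congr_ae ?_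
      filter_upwards [hconst] with ω hω
      rw [hω]
    have hLp' : MemLp (fun ω => centredSum x m a 0 n ω - c) 2 μ :=
      (h.memLp_centredSum a 0 n 2).sub (memLp_const c)
    rw [e, hLp'.eLpNorm_eq_integral_rpow_norm two_ne_zero ENNReal.ofNat_ne_top]
    refine ENNReal.ofReal_le_ofReal ?_
    simp only [ENNReal.toReal_ofNat, Real.rpow_ofNat, Real.norm_eq_abs, sq_abs]
    rw [Real.sqrt_eq_rpow, one_div]
    have hpos (k : ℕ) : 0 ≤ a k ^ 2 * (1 - ∫ ω, m k ω ^ 2 ∂μ) := by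
      have := h.integral_sub_sq k ▸ integral_nonneg (μ := μ) fun ω => sq_nonneg (x k ω - m k ω)
      exact mul_nonneg (sq_nonneg _) this
    refine Real.rpow_le_rpow (hpos k₀) ?_ (by norm_num)
    have i1 : Integrable (fun ω => centredSum x m a 0 n ω ^ 2) μ :=
      (h.memLp_centredSum a 0 n 2).integrable_sq
    have i2 : Integrable (fun ω => centredSum x m a 0 n ω) μ :=
      memLp_one_iff_integrable.1 (h.memLp_centredSum a 0 n 1)
    have i3 : Integrable (fun ω => centredSum x m a 0 n ω ^ 2 - 2 * c * centredSum x m a 0 n ω) μ :=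
      i1.sub (i2.const_mul _)
    have e2 : ∫ ω, (centredSum x m a 0 n ω - c) ^ 2 ∂μ =
        ∫ ω, centredSum x m a 0 n ω ^ 2 ∂μ + c ^ 2 := by
      have : ∀ ω, (centredSum x m a 0 n ω - c) ^ 2 =
        (centredSum x m a 0 n ω ^ 2 - 2 * c * centredSum x m a 0 n ω) + c ^ 2 := fun ω => by ring
      simp_rw [this]
      rw [integral_add i3 (integrable_const _), integral_sub i1 (i2.const_mul _),
        integral_const_mul, h.integral_centredSum]
      simp
    rw [e2, h.integral_centredSum_sq a (Nat.zero_le n)]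
    have := Finset.single_le_sum (f := fun k => a k ^ 2 * (1 - ∫ ω, m k ω ^ 2 ∂μ))
      (fun k _ => hpos k) (Finset.mem_Ico.2 ⟨Nat.zero_le k₀, hn⟩)
    have := sq_nonneg c
    linarith
  have h1 := ge_of_tendsto hL ((eventually_gt_atTop k₀).mono hle)
  rw [nonpos_iff_eq_zero, ENNReal.ofReal_eq_zero] at h1
  have h2 : 0 < √(a k₀ ^ 2 * (1 - ∫ ω, m k₀ ω ^ 2 ∂μ)) :=
    Real.sqrt_pos.2 (mul_pos (by positivity) (by linarith))
  linarith

/-! ### The central limit theorem -/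

theorem norm_charFun_smul_sub_le (h : IsPredictedSigns μ ℱ x m) (a : ℕ → ℝ) {N n : ℕ}
    (hn : N ≤ n) {A s : ℝ} (hA : ∀ k ∈ Finset.Ico N n, |a k| ≤ A) (hs : |s| * A ≤ 1) :
    ‖∫ ω, Complex.exp (Complex.I * (s * centredSum x m a N n ω : ℝ)) ∂μ -
        Complex.exp (-(s ^ 2 * ∑ k ∈ Finset.Ico N n, a k ^ 2 : ℝ) / 2)‖ ≤
      65 * (|s| * A * (s ^ 2 * ∑ k ∈ Finset.Ico N n, a k ^ 2) +
        s ^ 2 * ∑ k ∈ Finset.Ico N n, a k ^ 2 * ∫ ω, m k ω ^ 2 ∂μ) := by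
  have hb : ∀ k ∈ Finset.Ico N n, |s * a k| ≤ |s| * A := fun k hk => by
    rw [abs_mul]; gcongr; exact hA k hk
  have key := h.norm_charFun_centredSum_sub_le (fun k => s * a k) hn fun k hk => (hb k hk).trans hs
  simp_rw [centredSum_mul] at key
  have e1 : ∑ k ∈ Finset.Ico N n, (s * a k) ^ 2 = s ^ 2 * ∑ k ∈ Finset.Ico N n, a k ^ 2 := by
    simp_rw [mul_pow, ← Finset.mul_sum]
  rw [e1] at key
  refine key.trans ?_
  rw [Finset.sum_add_distrib, ← e1, Finset.mul_sum, Finset.mul_sum (a := s ^ 2)]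
  refine mul_le_mul_of_nonneg_left (add_le_add (Finset.sum_le_sum fun k hk => ?_)
    (Finset.sum_le_sum fun k hk => ?_)) (by norm_num)
  · rw [pow_succ', sq_abs]
    exact mul_le_mul_of_nonneg_right (hb k hk) (sq_nonneg _)
  · rw [mul_pow, mul_assoc]

/-- Bounded weights are negligible against `r n → ∞`, which kills the cubic error. The quadratic
error is an `a k ^ 2`-weighted average of the mean squares, which tends to `0` as they do. -/
theorem clt_centredSum (h : IsPredictedSigns μ ℱ x m) {a : ℕ → ℝ} (ha : ∀ k, |a k| ≤ 1)
    (hm : Tendsto (fun k => ∫ ω, m k ω ^ 2 ∂μ) atTop (𝓝 0)) {r : ℕ → ℝ}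
    (hr : Tendsto r atTop atTop) {v : ℝ} (hv : 0 < v)
    (hrv : Tendsto (fun n => (∑ k ∈ Finset.range n, a k ^ 2) / r n ^ 2) atTop (𝓝 v)) :
    CLT μ (fun n ω => centredSum x m a 0 n ω / r n) v := by
  have hsum : Tendsto (fun n => ∑ k ∈ Finset.range n, a k ^ 2) atTop atTop := by
    have h1 := hrv.pos_mul_atTop hv ((tendsto_pow_atTop two_ne_zero).comp hr)
    refine h1.congr' ?_
    filter_upwards [hr.eventually_gt_atTop 0] with n hn
    simp only [Function.comp]
    field_simp
  have hm' : Tendsto (fun n => (∑ k ∈ Finset.range n, a k ^ 2 * ∫ ω, m k ω ^ 2 ∂μ) / r n ^ 2)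
      atTop (𝓝 0) := by
    have h1 : (fun k => a k ^ 2 * ∫ ω, m k ω ^ 2 ∂μ) =o[atTop] fun k => a k ^ 2 := by
      have := (Asymptotics.isBigO_refl (fun k => a k ^ 2) atTop).mul_isLittleO
        ((Asymptotics.isLittleO_one_iff ℝ).2 hm)
      simpa using this
    have h2 := (h1.sum_range (fun k => sq_nonneg _) hsum).tendsto_div_nhds_zero
    have h3 := h2.mul hrv
    rw [zero_mul] at h3
    refine h3.congr' ?_
    filter_upwards [hsum.eventually_gt_atTop 0] with n hn
    field_simp
  refine CLT.of_tendsto_charFun hv.le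
    (fun n => ((h.measurable_centredSum a 0 n).div_const _).aemeasurable) fun t => ?_
  have hs : Tendsto (fun n => t / r n) atTop (𝓝 0) := tendsto_const_nhds.div_atTop hr
  have hsq : Tendsto (fun n => (t / r n) ^ 2 * ∑ k ∈ Finset.range n, a k ^ 2) atTop
      (𝓝 (v * t ^ 2)) :=
    (hrv.mul_const (t ^ 2)).congr fun n => by ring
  have hexp : Tendsto (fun n => Complex.exp
      (-((t / r n) ^ 2 * ∑ k ∈ Finset.range n, a k ^ 2 : ℝ) / 2)) atTop
      (𝓝 (Complex.exp (-(v * t ^ 2 : ℝ) / 2))) :=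
    (Complex.continuous_exp.tendsto _).comp
      ((((Complex.continuous_ofReal.tendsto _).comp hsq).neg).div_const 2)
  refine tendsto_of_tendsto_of_dist hexp ?_
  have hbound : Tendsto (fun n => 65 * (|t / r n| * 1 *
      ((t / r n) ^ 2 * ∑ k ∈ Finset.range n, a k ^ 2) +
      (t / r n) ^ 2 * ∑ k ∈ Finset.range n, a k ^ 2 * ∫ ω, m k ω ^ 2 ∂μ)) atTop (𝓝 0) := by
    have h4 : Tendsto (fun n => (t / r n) ^ 2 *
        ∑ k ∈ Finset.range n, a k ^ 2 * ∫ ω, m k ω ^ 2 ∂μ) atTop (𝓝 0) := by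
      have := hm'.mul_const (t ^ 2)
      rw [zero_mul] at this
      exact this.congr fun n => by ring
    have h5 := ((((hs.abs.mul_const 1).mul hsq).add h4).const_mul 65)
    simpa using h5
  refine squeeze_zero' (Eventually.of_forall fun _ => dist_nonneg) ?_ hbound
  filter_upwards [hs.abs.eventually_lt_const (by simp : |(0 : ℝ)| < 1)] with n hn
  have := h.norm_charFun_smul_sub_le a (Nat.zero_le n) (A := 1) (s := t / r n)
    (fun k _ => ha k) (by linarith)
  rw [dist_comm, dist_eq_norm]
  rw [← Finset.range_eq_Ico] at this
  have e : ∀ ω, t * (centredSum x m a 0 n ω / r n) = t / r n * centredSum x m a 0 n ω :=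
    fun ω => by ring
  simp_rw [e]
  exact this

theorem clt_remainder (h : IsPredictedSigns μ ℱ x m) {a : ℕ → ℝ}
    (ha : Summable fun k => a k ^ 2) {L : Ω → ℝ} (hLm : Measurable L)
    (hL : ∀ᵐ ω ∂μ, Tendsto (fun n => centredSum x m a 0 n ω) atTop (𝓝 (L ω)))
    {A E r : ℕ → ℝ} (hA : ∀ n k, n ≤ k → |a k| ≤ A n)
    (hE : ∀ n k, n ≤ k → ∫ ω, m k ω ^ 2 ∂μ ≤ E n) (hE0 : Tendsto E atTop (𝓝 0))
    (hr : ∀ᶠ n in atTop, 0 < r n) (hAr : Tendsto (fun n => A n / r n) atTop (𝓝 0)) {v : ℝ}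
    (hv : 0 ≤ v)
    (hrv : Tendsto (fun n => (∑' k, a (k + n) ^ 2) / r n ^ 2) atTop (𝓝 v)) :
    CLT μ (fun n ω => (L ω - centredSum x m a 0 n ω) / r n) v := by
  refine CLT.of_tendsto_charFun hv
    (fun n => ((hLm.sub (h.measurable_centredSum a 0 n)).div_const _).aemeasurable) fun t => ?_
  have hsq : Tendsto (fun n => (t / r n) ^ 2 * ∑' k, a (k + n) ^ 2) atTop (𝓝 (v * t ^ 2)) :=
    (hrv.mul_const (t ^ 2)).congr fun n => by ring
  have hexp : Tendsto (fun n => Complex.exp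
      (-((t / r n) ^ 2 * ∑' k, a (k + n) ^ 2 : ℝ) / 2)) atTop
      (𝓝 (Complex.exp (-(v * t ^ 2 : ℝ) / 2))) :=
    (Complex.continuous_exp.tendsto _).comp
      ((((Complex.continuous_ofReal.tendsto _).comp hsq).neg).div_const 2)
  have hA0 (n : ℕ) : 0 ≤ A n := (abs_nonneg _).trans (hA n n le_rfl)
  have hE0' (n : ℕ) : 0 ≤ E n := (integral_pred_sq_nonneg n).trans (hE n n le_rfl)
  have hsA : Tendsto (fun n => |t / r n| * A n) atTop (𝓝 0) := by
    have := hAr.const_mul |t|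
    rw [mul_zero] at this
    refine this.congr' ?_
    filter_upwards [hr] with n hn
    rw [abs_div, abs_of_pos hn]
    ring
  refine tendsto_of_tendsto_of_dist hexp ?_
  have hbound : Tendsto (fun n => 65 * (|t / r n| * A n *
      ((t / r n) ^ 2 * ∑' k, a (k + n) ^ 2) +
      E n * ((t / r n) ^ 2 * ∑' k, a (k + n) ^ 2))) atTop (𝓝 0) := by
    simpa using ((hsA.mul hsq).add (hE0.mul hsq)).const_mul 65
  refine squeeze_zero' (Eventually.of_forall fun _ => dist_nonneg) ?_ hbound
  filter_upwards [hsA.eventually_lt_const one_pos] with n hn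
  set s := t / r n
  have hlim1 : Tendsto (fun l => ∫ ω, Complex.exp (Complex.I *
      (s * centredSum x m a n (n + l) ω : ℝ)) ∂μ) atTop
      (𝓝 (∫ ω, Complex.exp (Complex.I * (s * (L ω - centredSum x m a 0 n ω) : ℝ)) ∂μ)) := by
    refine tendsto_integral_of_dominated_convergence (fun _ => 1) (fun l => ?_)
      (integrable_const _) (fun l => ae_of_all _ fun ω => ?_) ?_
    · have := h.measurable_centredSum a n (n + l)
      fun_prop
    · rw [mul_comm, Complex.norm_exp_ofReal_mul_I]
    · filter_upwards [hL] with ω hω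
      exact (Complex.continuous_exp.tendsto _).comp (((Complex.continuous_ofReal.tendsto _).comp
        ((tendsto_remainder hω n).const_mul s)).const_mul _)
  have hlim2 : Tendsto (fun l => ∑ k ∈ Finset.Ico n (n + l), a k ^ 2) atTop
      (𝓝 (∑' k, a (k + n) ^ 2)) := by
    have := ((summable_nat_add_iff n).2 ha).hasSum.tendsto_sum_nat
    refine this.congr fun l => ?_
    rw [Finset.sum_Ico_eq_sum_range]
    simp [add_comm]
  have hlim3 : Tendsto (fun l => Complex.exp
      (-(s ^ 2 * ∑ k ∈ Finset.Ico n (n + l), a k ^ 2 : ℝ) / 2)) atTop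
      (𝓝 (Complex.exp (-(s ^ 2 * ∑' k, a (k + n) ^ 2 : ℝ) / 2))) :=
    (Complex.continuous_exp.tendsto _).comp ((((Complex.continuous_ofReal.tendsto _).comp
      (hlim2.const_mul (s ^ 2))).neg).div_const 2)
  -- For fixed `n` the block estimate holds for all `l` with a bound free of `l`, so it survives `l
  -- → ∞`; only afterwards does `n` grow.
  have hmain : ‖∫ ω, Complex.exp (Complex.I * (s * (L ω - centredSum x m a 0 n ω) : ℝ)) ∂μ -
      Complex.exp (-(s ^ 2 * ∑' k, a (k + n) ^ 2 : ℝ) / 2)‖ ≤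
      65 * (|s| * A n * (s ^ 2 * ∑' k, a (k + n) ^ 2) +
        E n * (s ^ 2 * ∑' k, a (k + n) ^ 2)) := le_of_tendsto (hlim1.sub hlim3).norm (Eventually.of_forall fun l => by
    refine (h.norm_charFun_smul_sub_le a (Nat.le_add_right n l) (A := A n) (s := s)
      (fun k hk => hA n k (Finset.mem_Ico.1 hk).1) hn.le).trans ?_
    have h1 := sum_Ico_sq_le ha (Nat.le_add_right n l)
    have h2 : ∑ k ∈ Finset.Ico n (n + l), a k ^ 2 * ∫ ω, m k ω ^ 2 ∂μ ≤
        E n * ∑' k, a (k + n) ^ 2 := by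
      calc _ ≤ ∑ k ∈ Finset.Ico n (n + l), a k ^ 2 * E n := by
            gcongr with k hk
            exact hE n k (Finset.mem_Ico.1 hk).1
        _ = E n * ∑ k ∈ Finset.Ico n (n + l), a k ^ 2 := by rw [← Finset.sum_mul]; ring
        _ ≤ _ := mul_le_mul_of_nonneg_left h1 (hE0' n)
    have h3 : s ^ 2 * ∑ k ∈ Finset.Ico n (n + l), a k ^ 2 * ∫ ω, m k ω ^ 2 ∂μ ≤
        E n * (s ^ 2 * ∑' k, a (k + n) ^ 2) := by
      calc _ ≤ s ^ 2 * (E n * ∑' k, a (k + n) ^ 2) :=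
            mul_le_mul_of_nonneg_left h2 (sq_nonneg _)
        _ = _ := by ring
    have h4 : |s| * A n * (s ^ 2 * ∑ k ∈ Finset.Ico n (n + l), a k ^ 2) ≤
        |s| * A n * (s ^ 2 * ∑' k, a (k + n) ^ 2) := by
      have := hA0 n
      gcongr
    linarith)
  rw [dist_comm, dist_eq_norm]
  have e : ∀ ω, t * ((L ω - centredSum x m a 0 n ω) / r n) =
      s * (L ω - centredSum x m a 0 n ω) := fun ω => by simp only [s]; ring
  simp_rw [e]
  exact hmain

end IsPredictedSigns

end

/-! ### Independence and conditional means in the elephant random walk -/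

section

/-- If `f` is independent of `(g, h)` and `g` of `h`, then `h` is independent of `(f, g)`. -/
theorem indepFun_of_indepFun_prodMk {Ω α β δ : Type*} [MeasurableSpace Ω] [MeasurableSpace α]
    [MeasurableSpace β] [MeasurableSpace δ] {μ : Measure Ω} [IsProbabilityMeasure μ]
    {f : Ω → α} {g : Ω → β} {h : Ω → δ} (hf : Measurable f) (hg : Measurable g)
    (hh : Measurable h) (h₁ : IndepFun f (fun ω => (g ω, h ω)) μ) (h₂ : IndepFun g h μ) :
    IndepFun h (fun ω => (f ω, g ω)) μ := by
  refine IndepFun.symm ?_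
  have h₃ : IndepFun f g μ := h₁.comp (φ := id) (ψ := Prod.fst) measurable_id measurable_fst
  have := Measure.isProbabilityMeasure_map (μ := μ) hf.aemeasurable
  have := Measure.isProbabilityMeasure_map (μ := μ) hg.aemeasurable
  have := Measure.isProbabilityMeasure_map (μ := μ) hh.aemeasurable
  rw [indepFun_iff_map_prod_eq_prod_map_map hf.aemeasurable (hg.prodMk hh).aemeasurable,
    (indepFun_iff_map_prod_eq_prod_map_map hg.aemeasurable hh.aemeasurable).1 h₂,
    ← (measurePreserving_prodAssoc _ _ _).map_eq] at h₁
  rw [indepFun_iff_map_prod_eq_prod_map_map (hf.prodMk hg).aemeasurable hh.aemeasurable,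
    (indepFun_iff_map_prod_eq_prod_map_map hf.aemeasurable hg.aemeasurable).1 h₃]
  have h₄ := congrArg (Measure.map MeasurableEquiv.prodAssoc.symm) h₁
  rw [Measure.map_map (MeasurableEquiv.measurable _) (by fun_prop),
    Measure.map_map (MeasurableEquiv.measurable _) (MeasurableEquiv.measurable _)] at h₄
  have h₅ : (MeasurableEquiv.prodAssoc.symm : α × β × δ ≃ᵐ (α × β) × δ) ∘
      (MeasurableEquiv.prodAssoc : (α × β) × δ ≃ᵐ α × β × δ) = id := by ext x <;> rfl
  rw [h₅, Measure.map_id] at h₄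
  exact h₄

theorem ae_or_of_measureReal_add {Ω : Type*} [MeasurableSpace Ω] {μ : Measure Ω}
    [IsProbabilityMeasure μ] {f : Ω → ℝ} (hf : Measurable f) {r : ℝ}
    (h1 : μ.real {ω | f ω = 1} = r) (h2 : μ.real {ω | f ω = -1} = 1 - r) :
    ∀ᵐ ω ∂μ, f ω = 1 ∨ f ω = -1 := by
  have m1 : MeasurableSet {ω | f ω = 1} := hf (measurableSet_singleton 1)
  have m2 : MeasurableSet {ω | f ω = -1} := hf (measurableSet_singleton (-1))
  have hd : Disjoint {ω | f ω = 1} {ω | f ω = -1} := by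
    rw [Set.disjoint_left]
    intro ω h h'
    rw [Set.mem_ofPred_eq] at h h'
    linarith
  have hu : μ.real ({ω | f ω = 1} ∪ {ω | f ω = -1}) = 1 := by
    rw [measureReal_union hd m2, h1, h2]; ring
  have : ∀ᵐ ω ∂μ, ω ∈ {ω | f ω = 1} ∪ {ω | f ω = -1} := by
    refine (mem_ae_iff_prob_eq_one (m1.union m2)).2 ?_
    rw [← ofReal_measureReal, hu, ENNReal.ofReal_one]
  exact this

theorem integral_sign {Ω : Type*} [MeasurableSpace Ω] {μ : Measure Ω}
    [IsProbabilityMeasure μ] {f : Ω → ℝ} (hf : Measurable f) {r : ℝ}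
    (h1 : μ.real {ω | f ω = 1} = r) (h2 : μ.real {ω | f ω = -1} = 1 - r) :
    ∫ ω, f ω ∂μ = 2 * r - 1 := by
  have m1 : MeasurableSet {ω | f ω = 1} := hf (measurableSet_singleton 1)
  have e : f =ᵐ[μ] fun ω => 2 * {ω | f ω = 1}.indicator (fun _ => (1 : ℝ)) ω - 1 := by
    filter_upwards [ae_or_of_measureReal_add hf h1 h2] with ω hω
    rcases hω with h | h
    · rw [Set.indicator_of_mem (by exact h), h]; norm_num
    · rw [Set.indicator_of_notMem (by rw [Set.mem_ofPred_eq, h]; norm_num), h]; norm_num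
  rw [integral_congr_ae e, integral_sub (((integrable_const _).indicator m1).const_mul _)
    (integrable_const _), integral_const_mul, integral_indicator_const _ m1, h1]
  simp

namespace IsElephantRandomWalk

variable {Ω : Type*} [mΩ : MeasurableSpace Ω] {μ : Measure Ω} [IsProbabilityMeasure μ]
  {p q : ℝ} {X : ℕ → Ω → ℝ} {U : ℕ → Ω → ℕ} {ξ : ℕ → Ω → ℝ}

theorem ae_choice_mem (h : IsElephantRandomWalk μ p q X U ξ) {n : ℕ} (hn : 1 ≤ n) :
    ∀ᵐ ω ∂μ, U n ω ∈ Finset.Icc 1 n := by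
  have hU := h.measurable_choice n hn
  have hd : ((Finset.Icc 1 n : Finset ℕ) : Set ℕ).PairwiseDisjoint fun j => {ω | U n ω = j} := by
    intro i _ j _ hij
    simp only [Function.onFun]
    rw [Set.disjoint_left]
    intro ω h h'
    rw [Set.mem_ofPred_eq] at h h'
    exact hij (h.symm.trans h')
  have hu : μ.real (⋃ j ∈ Finset.Icc 1 n, {ω | U n ω = j}) = 1 := by
    rw [measureReal_biUnion_finset hd fun j _ => hU (measurableSet_singleton j),
      Finset.sum_congr rfl fun j hj => h.choice_uniform n hn j (Finset.mem_Icc.1 hj).1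
        (Finset.mem_Icc.1 hj).2]
    have : (n : ℝ) ≠ 0 := by positivity
    simp [this]
  have : ∀ᵐ ω ∂μ, ω ∈ ⋃ j ∈ Finset.Icc 1 n, {ω | U n ω = j} := by
    refine (mem_ae_iff_prob_eq_one (Finset.measurableSet_biUnion _ fun j _ =>
      hU (measurableSet_singleton j))).2 ?_
    rw [← ofReal_measureReal (measure_ne_top _ _)]
    exact (congrArg _ hu).trans ENNReal.ofReal_one
  filter_upwards [this] with ω hω
  simpa using hω

theorem ae_sign (h : IsElephantRandomWalk μ p q X U ξ) :
    ∀ᵐ ω ∂μ, ∀ n, 1 ≤ n → X n ω = 1 ∨ X n ω = -1 := by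
  have h1 := ae_or_of_measureReal_add (h.measurable_step 1 le_rfl) h.first_pos h.first_neg
  have h2 : ∀ᵐ ω ∂μ, ∀ n, 1 ≤ n → U n ω ∈ Finset.Icc 1 n :=
    ae_all_iff.2 fun n => eventually_imp_distrib_left.2 fun hn => h.ae_choice_mem hn
  have h3 : ∀ᵐ ω ∂μ, ∀ n, 1 ≤ n → X (n + 1) ω = ξ n ω * X (U n ω) ω :=
    ae_all_iff.2 fun n => eventually_imp_distrib_left.2 fun hn => h.step n hn
  have h4 : ∀ᵐ ω ∂μ, ∀ n, 1 ≤ n → ξ n ω = 1 ∨ ξ n ω = -1 :=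
    ae_all_iff.2 fun n => eventually_imp_distrib_left.2 fun hn =>
      ae_or_of_measureReal_add (h.measurable_sign n hn) (h.sign_pos n hn) (h.sign_neg n hn)
  filter_upwards [h1, h2, h3, h4] with ω h1 h2 h3 h4 n hn
  induction n using Nat.strong_induction_on with
  | _ n ih =>
    obtain rfl | hn' := hn.eq_or_lt
    · exact h1
    · obtain ⟨k, rfl⟩ : ∃ k, n = k + 1 := ⟨n - 1, by omega⟩
      have hk : 1 ≤ k := by omega
      have hu := Finset.mem_Icc.1 (h2 k hk)
      rw [h3 k hk]
      rcases h4 k hk with e | e <;> rcases ih _ (by omega) hu.1 with e' | e' <;>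
        simp [e, e']

/-- The indicator of the choice `j`, times the sign, at time `n`. -/
noncomputable def copy (U : ℕ → Ω → ℕ) (ξ : ℕ → Ω → ℝ) (n j : ℕ) (ω : Ω) : ℝ :=
  (if U n ω = j then 1 else 0) * ξ n ω

theorem step_eq_sum (h : IsElephantRandomWalk μ p q X U ξ) {n : ℕ} (hn : 1 ≤ n) :
    X (n + 1) =ᵐ[μ] fun ω => ∑ j ∈ Finset.Icc 1 n, copy U ξ n j ω * X j ω := by
  filter_upwards [h.step n hn, h.ae_choice_mem hn] with ω h1 h2
  rw [h1]
  simp only [copy, ite_mul, one_mul, zero_mul]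
  rw [Finset.sum_ite_eq, if_pos h2]

/-- The first step and the randomness `(U 1, ξ 1), …, (U n, ξ n)`. -/
def past (X : ℕ → Ω → ℝ) (U : ℕ → Ω → ℕ) (ξ : ℕ → Ω → ℝ) (n : ℕ) (ω : Ω) :
    ℝ × (Finset.range n → ℕ × ℝ) :=
  (X 1 ω, fun j => (U (j + 1) ω, ξ (j + 1) ω))

theorem measurable_pair (h : IsElephantRandomWalk μ p q X U ξ) (n : ℕ) :
    Measurable fun ω => (U (n + 1) ω, ξ (n + 1) ω) :=
  (h.measurable_choice _ (by omega)).prodMk (h.measurable_sign _ (by omega))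

theorem indepFun_past (h : IsElephantRandomWalk μ p q X U ξ) (n : ℕ) :
    IndepFun (fun ω => (U (n + 1) ω, ξ (n + 1) ω)) (past X U ξ n) μ := by
  have hS := h.indep_times.indepFun_finset (Finset.range n) {n} (by simp)
    fun i => h.measurable_pair i
  refine indepFun_of_indepFun_prodMk (h.measurable_step 1 le_rfl)
    (measurable_pi_lambda _ fun j => h.measurable_pair j) (h.measurable_pair n) ?_ ?_
  · exact h.indep_first.comp (φ := id)
      (ψ := fun s : ℕ → ℕ × ℝ => ((fun j : Finset.range n => s j), s n)) measurable_id
      (by fun_prop)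
  · exact hS.comp (φ := id) (ψ := fun s : ({n} : Finset ℕ) → ℕ × ℝ => s ⟨n, by simp⟩)
      measurable_id (measurable_pi_apply _)

/-- The recursion for the steps holds only almost surely, so they are expressed through the driving
randomness up to null sets. The choices and signs up to time `n` determine the steps up to time `n +
1`. -/
theorem exists_eq_past (h : IsElephantRandomWalk μ p q X U ξ) (n : ℕ) :
    ∀ j, 1 ≤ j → j ≤ n + 1 → ∃ F : ℝ × (Finset.range n → ℕ × ℝ) → ℝ, Measurable F ∧
      X j =ᵐ[μ] F ∘ past X U ξ n := by
  induction n with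
  | zero =>
    intro j h1 h2
    obtain rfl : j = 1 := by omega
    exact ⟨Prod.fst, measurable_fst, Eventually.of_forall fun _ => rfl⟩
  | succ n ih =>
    let T : ℝ × (Finset.range (n + 1) → ℕ × ℝ) → ℝ × (Finset.range n → ℕ × ℝ) := fun s =>
      (s.1, fun j => s.2 ⟨j, Finset.range_mono (Nat.le_succ n) j.2⟩)
    have hT : Measurable T := by fun_prop
    -- Indices out of range get the function `0`, so that `F` can be chosen for all `j` at once.
    have ih' : ∀ j, ∃ F : ℝ × (Finset.range (n + 1) → ℕ × ℝ) → ℝ, Measurable F ∧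
        (1 ≤ j → j ≤ n + 1 → X j =ᵐ[μ] F ∘ past X U ξ (n + 1)) := fun j => by
      by_cases hj : 1 ≤ j ∧ j ≤ n + 1
      · obtain ⟨F, hF, e⟩ := ih j hj.1 hj.2
        exact ⟨F ∘ T, hF.comp hT, fun _ _ => e⟩
      · exact ⟨0, measurable_zero, fun h1 h2 => absurd ⟨h1, h2⟩ hj⟩
    choose F hF e using ih'
    intro j h1 h2
    obtain h2 | rfl : j ≤ n + 1 ∨ j = n + 1 + 1 := by omega
    · exact ⟨F j, hF j, e j h1 h2⟩
    · refine ⟨fun s => ∑ i ∈ Finset.Icc 1 (n + 1),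
        (if (s.2 ⟨n, by simp⟩).1 = i then 1 else 0) * (s.2 ⟨n, by simp⟩).2 * F i s, ?_, ?_⟩
      · refine Finset.measurable_fun_sum _ fun i _ => ?_
        refine Measurable.mul (Measurable.mul (Measurable.ite ?_ measurable_const
          measurable_const) (by fun_prop)) (hF i)
        have : Measurable fun s : ℝ × (Finset.range (n + 1) → ℕ × ℝ) =>
          (s.2 ⟨n, by simp⟩).1 := by fun_prop
        exact this (measurableSet_singleton i)
      · have e' : ∀ᵐ ω ∂μ, ∀ i ∈ Finset.Icc 1 (n + 1), X i ω = F i (past X U ξ (n + 1) ω) :=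
          (Finset.eventually_all _).2 fun i hi =>
            e i (Finset.mem_Icc.1 hi).1 (Finset.mem_Icc.1 hi).2
        filter_upwards [h.step_eq_sum (n := n + 1) (by omega), e'] with ω h1 h2
        rw [h1]
        exact Finset.sum_congr rfl fun i hi => by rw [h2 i hi]; rfl

theorem history_le (h : IsElephantRandomWalk μ p q X U ξ) (n : ℕ) : history X n ≤ mΩ :=
  iSup₂_le fun k hk => (h.measurable_step k (Finset.mem_Icc.1 hk).1).comap_le

theorem measurable_history {n j : ℕ} (h1 : 1 ≤ j) (h2 : j ≤ n) : Measurable[history X n] (X j) :=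
  measurable_iff_comap_le.2 (le_iSup₂_of_le j (Finset.mem_Icc.2 ⟨h1, h2⟩) le_rfl)

/-- Independence from the driving past passes to a measurable function of it, and then to the almost
surely equal vector of steps, which generates the history. -/
theorem indep_history (h : IsElephantRandomWalk μ p q X U ξ) (n : ℕ) :
    Indep (MeasurableSpace.comap (fun ω => (U (n + 1) ω, ξ (n + 1) ω)) inferInstance)
      (history X (n + 1)) μ := by
  have hF := h.exists_eq_past n
  have : ∀ j : Finset.Icc 1 (n + 1), ∃ F : ℝ × (Finset.range n → ℕ × ℝ) → ℝ, Measurable F ∧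
      X j =ᵐ[μ] F ∘ past X U ξ n := fun j =>
    hF j (Finset.mem_Icc.1 j.2).1 (Finset.mem_Icc.1 j.2).2
  choose F hF e using this
  have h1 := (h.indepFun_past n).comp (φ := id) (ψ := fun s j => F j s) measurable_id
    (measurable_pi_lambda _ hF)
  have h2 : IndepFun (fun ω => (U (n + 1) ω, ξ (n + 1) ω))
      (fun ω (j : Finset.Icc 1 (n + 1)) => X j ω) μ := by
    refine h1.congr (ae_eq_refl _) ?_
    filter_upwards [ae_all_iff.2 e] with ω hω
    exact funext fun j => (hω j).symm
  refine indep_of_indep_of_le_right (IndepFun_iff_Indep _ _ _ |>.1 h2) ?_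
  refine iSup₂_le fun k hk => ?_
  have : Measurable[MeasurableSpace.comap (fun ω (j : Finset.Icc 1 (n + 1)) => X j ω) inferInstance]
      (X k) := 
    (measurable_pi_apply (X := fun _ : Finset.Icc 1 (n + 1) => ℝ) ⟨k, hk⟩).comp
      (comap_measurable fun ω (j : Finset.Icc 1 (n + 1)) => X j ω)
  exact this.comap_le

theorem integral_copy (h : IsElephantRandomWalk μ p q X U ξ) {n j : ℕ} (hn : 1 ≤ n) (h1 : 1 ≤ j)
    (h2 : j ≤ n) : ∫ ω, copy U ξ n j ω ∂μ = (2 * p - 1) / n := by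
  have hU := h.measurable_choice n hn
  have hm : MeasurableSet {ω | U n ω = j} := hU (measurableSet_singleton j)
  have hi : IndepFun (fun ω => if U n ω = j then (1 : ℝ) else 0) (ξ n) μ :=
    (h.indep_choice_sign n hn).comp (φ := fun u => if u = j then (1 : ℝ) else 0) (ψ := id)
      (measurable_of_countable _) measurable_id
  simp only [copy]
  rw [hi.integral_fun_mul_eq_mul_integral
    (Measurable.ite hm measurable_const measurable_const).aestronglyMeasurable
    (h.measurable_sign n hn).aestronglyMeasurable,
    integral_sign (h.measurable_sign n hn) (h.sign_pos n hn) (h.sign_neg n hn)]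
  have e : (fun ω => if U n ω = j then (1 : ℝ) else 0) =
      {ω | U n ω = j}.indicator fun _ => (1 : ℝ) := by
    ext ω
    simp [Set.indicator_apply]
  rw [e, integral_indicator_const _ hm, h.choice_uniform n hn j h1 h2]
  simp
  ring

/-- In `X (n + 1) = ∑ copy j * X j` the factor `X j` is known and `copy j` is independent of the
history with mean `(2 * p - 1) / n`. -/
theorem condExp_step (h : IsElephantRandomWalk μ p q X U ξ) {n : ℕ} (hn : 1 ≤ n) :
    μ[X (n + 1) | history X n] =ᵐ[μ]
      fun ω => (2 * p - 1) / n * ∑ j ∈ Finset.Icc 1 n, X j ω := by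
  have hle := h.history_le n
  have hξ : ∀ᵐ ω ∂μ, ξ n ω = 1 ∨ ξ n ω = -1 :=
    ae_or_of_measureReal_add (h.measurable_sign n hn) (h.sign_pos n hn) (h.sign_neg n hn)
  have hcm : ∀ j, Measurable[MeasurableSpace.comap (fun ω => (U n ω, ξ n ω)) inferInstance]
      (copy U ξ n j) := fun j => by
    have : Measurable fun s : ℕ × ℝ => (if s.1 = j then (1 : ℝ) else 0) * s.2 :=
      (Measurable.ite (measurable_fst (measurableSet_singleton j)) measurable_const
        measurable_const).mul measurable_snd
    exact this.comp (comap_measurable _)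
  have hple : MeasurableSpace.comap (fun ω => (U n ω, ξ n ω)) inferInstance ≤ mΩ :=
    ((h.measurable_choice n hn).prodMk (h.measurable_sign n hn)).comap_le
  have hcb : ∀ j, ∀ᵐ ω ∂μ, ‖copy U ξ n j ω‖ ≤ 1 := fun j => by
    filter_upwards [hξ] with ω hω
    simp only [copy]
    rcases hω with e | e <;> rw [e] <;> split_ifs <;> simp
  have hci : ∀ j, Integrable (copy U ξ n j) μ := fun j =>
    .of_bound ((hcm j).mono hple le_rfl).aestronglyMeasurable 1 (hcb j)
  have hXi : ∀ j ∈ Finset.Icc 1 n, Integrable (fun ω => copy U ξ n j ω * X j ω) μ := fun j hj => by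
    have h1 := (Finset.mem_Icc.1 hj).1
    refine .of_bound (((hcm j).mono hple le_rfl).mul (h.measurable_step j h1)).aestronglyMeasurable
      1 ?_
    filter_upwards [hcb j, h.ae_sign] with ω a b
    rw [norm_mul]
    rcases b j h1 with e | e <;> rw [e] <;> simpa using a
  have hind : Indep (MeasurableSpace.comap (fun ω => (U n ω, ξ n ω)) inferInstance)
      (history X n) μ := by
    obtain ⟨k, rfl⟩ : ∃ k, n = k + 1 := ⟨n - 1, by omega⟩
    exact h.indep_history k
  refine (condExp_congr_ae (h.step_eq_sum hn)).trans ?_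
  have e1 := condExp_finsetSum (μ := μ) hXi (history X n)
  have e2 : ∀ᵐ ω ∂μ, ∀ j ∈ Finset.Icc 1 n,
      (μ[fun ω => copy U ξ n j ω * X j ω | history X n]) ω = (2 * p - 1) / n * X j ω := by
    refine (Finset.eventually_all _).2 fun j hj => ?_
    obtain ⟨h1, h2⟩ := Finset.mem_Icc.1 hj
    have a := condExp_mul_of_stronglyMeasurable_right (m := history X n) (μ := μ)
      (measurable_history h1 h2).stronglyMeasurable (hXi j hj) (hci j)
    have b := condExp_indep_eq hple hle (hcm j).stronglyMeasurable hind
    filter_upwards [a, b] with ω a b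
    rw [h.integral_copy hn h1 h2] at b
    refine Eq.trans a ?_
    rw [Pi.mul_apply, b]
  have e3 : (fun ω => ∑ j ∈ Finset.Icc 1 n, copy U ξ n j ω * X j ω) =
      ∑ j ∈ Finset.Icc 1 n, fun ω => copy U ξ n j ω * X j ω := by ext ω; simp
  rw [e3]
  filter_upwards [e1, e2] with ω a b
  rw [a, Finset.sum_apply, Finset.sum_congr rfl b, Finset.mul_sum]

theorem condExp_first (h : IsElephantRandomWalk μ p q X U ξ) :
    μ[X 1 | history X 0] =ᵐ[μ] fun _ => 2 * q - 1 := by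
  have : history X 0 = ⊥ := by simp [history]
  rw [this, condExp_bot, integral_sign (h.measurable_step 1 le_rfl) h.first_pos h.first_neg]

end IsElephantRandomWalk

end

/-! ### The walk as predicted signs, and the decay of the predictions -/

section

/-- A version of the step `X (k + 1)` that takes the values `1` and `-1` only. -/
noncomputable def signStep {Ω : Type*} (X : ℕ → Ω → ℝ) (k : ℕ) (ω : Ω) : ℝ :=
  if X (k + 1) ω = 1 then 1 else -1

/-- The conditional expectation of `signStep X k` given the past, for memory parameter
`(1 + α) / 2` and first-step parameter `q`. -/
noncomputable def signPred {Ω : Type*} (α q : ℝ) (X : ℕ → Ω → ℝ) (k : ℕ) (ω : Ω) : ℝ :=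
  if k = 0 then 2 * q - 1 else α / k * ∑ j ∈ Finset.range k, signStep X j ω

theorem abs_sum_signStep_le {Ω : Type*} (X : ℕ → Ω → ℝ) (k : ℕ) (ω : Ω) :
    |∑ j ∈ Finset.range k, signStep X j ω| ≤ k := by
  refine (Finset.abs_sum_le_sum_abs _ _).trans ?_
  refine (Finset.sum_le_card_nsmul _ _ 1 fun j _ => ?_).trans (by simp)
  simp only [signStep]
  split_ifs <;> simp

theorem sum_Icc_one_eq_sum_range (f : ℕ → ℝ) (n : ℕ) :
    ∑ k ∈ Finset.Icc 1 n, f k = ∑ k ∈ Finset.range n, f (k + 1) := by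
  induction n with
  | zero => simp
  | succ n ih => rw [Finset.sum_Icc_succ_top (by omega), ih, Finset.sum_range_succ]

namespace IsElephantRandomWalk

variable {Ω : Type*} [mΩ : MeasurableSpace Ω] {μ : Measure Ω} [IsProbabilityMeasure μ]
  {p q : ℝ} {X : ℕ → Ω → ℝ} {U : ℕ → Ω → ℕ} {ξ : ℕ → Ω → ℝ}

/-- The filtration generated by the steps. -/
def stepFiltration (h : IsElephantRandomWalk μ p q X U ξ) : Filtration ℕ mΩ where
  seq := history X
  mono' _ _ hij := biSup_mono fun _ hk => Finset.Icc_subset_Icc_right hij hk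
  le' := h.history_le

theorem ae_signStep_eq (h : IsElephantRandomWalk μ p q X U ξ) :
    ∀ᵐ ω ∂μ, ∀ k, signStep X k ω = X (k + 1) ω := by
  filter_upwards [h.ae_sign] with ω hω k
  simp only [signStep]
  rcases hω (k + 1) (by omega) with e | e <;> rw [e] <;> norm_num

theorem measurable_signStep {n k : ℕ} (hk : k + 1 ≤ n) : Measurable[history X n] (signStep X k) :=
  Measurable.ite (measurable_history (by omega) hk (measurableSet_singleton 1)) measurable_const
    measurable_const

theorem isPredictedSigns (h : IsElephantRandomWalk μ p q X U ξ) (hp : |2 * p - 1| ≤ 1)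
    (hq : q ∈ Set.Icc (0 : ℝ) 1) :
    IsPredictedSigns μ h.stepFiltration (signStep X) (signPred (2 * p - 1) q X) where
  adapted k := measurable_signStep le_rfl
  sign k ω := by simp only [signStep]; split_ifs <;> simp
  predictable k := by
    rcases eq_or_ne k 0 with rfl | hk
    · exact measurable_const
    · have : signPred (2 * p - 1) q X k =
          fun ω => (2 * p - 1) / k * ∑ j ∈ Finset.range k, signStep X j ω := by
        ext ω; simp [signPred, hk]
      rw [this]
      exact (Finset.measurable_fun_sum _ fun j hj =>
        measurable_signStep (Finset.mem_range.1 hj)).const_mul _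
  abs_le k ω := by
    simp only [signPred]
    split_ifs with hk
    · rw [abs_le]; constructor <;> linarith [hq.1, hq.2]
    · have hk' : (0 : ℝ) < k := by positivity
      rw [abs_mul, abs_div, Nat.abs_cast, div_mul_eq_mul_div, div_le_one hk']
      nlinarith [abs_sum_signStep_le X k ω, abs_nonneg (∑ j ∈ Finset.range k, signStep X j ω)]
  condExp_eq k := by
    have e1 : signStep X k =ᵐ[μ] X (k + 1) := h.ae_signStep_eq.mono fun ω hω => hω k
    refine (condExp_congr_ae e1).trans ?_
    rcases Nat.eq_zero_or_pos k with rfl | hk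
    · exact h.condExp_first
    · filter_upwards [h.condExp_step hk, h.ae_signStep_eq] with ω h1 h2
      refine h1.trans ?_
      simp only [signPred, hk.ne', if_false]
      rw [Finset.sum_congr rfl fun j _ => h2 j, sum_Icc_one_eq_sum_range fun j => X j ω]

theorem ae_martPart_eq (h : IsElephantRandomWalk μ p q X U ξ) (hp : |2 * p - 1| ≤ 1)
    (hq : q ∈ Set.Icc (0 : ℝ) 1) (γ : ℝ) :
    ∀ᵐ ω ∂μ, ∀ n, martPart μ γ X n ω =
      centredSum (signStep X) (signPred (2 * p - 1) q X) (fun k => ((k : ℝ) + 1) ^ (-γ)) 0 n ω := by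
  have hs := h.isPredictedSigns hp hq
  have e : ∀ k, μ[X (k + 1) | history X k] =ᵐ[μ] signPred (2 * p - 1) q X k := fun k =>
    (condExp_congr_ae (h.ae_signStep_eq.mono fun ω hω => (hω k).symm)).trans (hs.condExp_eq k)
  filter_upwards [h.ae_signStep_eq, ae_all_iff.2 e] with ω h1 h2 n
  rw [martPart, sum_Icc_one_eq_sum_range fun k =>
    (X k ω - (μ[X k | history X (k - 1)]) ω) / (k : ℝ) ^ γ, centredSum, ← Finset.range_eq_Ico]
  refine Finset.sum_congr rfl fun k _ => ?_
  rw [Nat.add_sub_cancel, h2 k, h1 k, Real.rpow_neg (by positivity), Nat.cast_succ]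
  ring

/-- With `T k` the sum of the first `k` signs, `E[T (k + 1) ^ 2] = (1 + 2 * α / k) * E[T k ^ 2] +
1`. The rate `1 + A` is not sharp, but any exponent below `2` makes the mean of `(T k / k) ^ 2`
decay, and it treats all `α < 1` alike. -/
theorem integral_sum_sq_le (h : IsElephantRandomWalk μ p q X U ξ) (hp : |2 * p - 1| ≤ 1)
    (hq : q ∈ Set.Icc (0 : ℝ) 1) {A : ℝ} (hA0 : 0 ≤ A) (hA1 : A < 1) (hA : 2 * p - 1 ≤ A) {k : ℕ}
    (hk : 1 ≤ k) :
    ∫ ω, (∑ j ∈ Finset.range k, signStep X j ω) ^ 2 ∂μ ≤ 1 / (1 - A) * (k : ℝ) ^ (1 + A) := by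
  have hs := h.isPredictedSigns hp hq
  have hA' : 0 < 1 - A := by linarith
  induction k, hk using Nat.le_induction with
  | base =>
    have : ∀ ω, (∑ j ∈ Finset.range 1, signStep X j ω) ^ 2 = 1 := fun ω => by
      rw [Finset.sum_range_one]
      rcases hs.sign 0 ω with e | e <;> rw [e] <;> norm_num
    simp_rw [this]
    simp
    exact (one_le_inv₀ hA').2 (by linarith)
  | succ k hk ih =>
    set T : Ω → ℝ := fun ω => ∑ j ∈ Finset.range k, signStep X j ω with hT
    have hTm : Measurable[history X k] T := Finset.measurable_fun_sum _ fun j hj =>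
        measurable_signStep (Finset.mem_range.1 hj)
    have hTm' : Measurable T := hTm.mono (h.history_le k) le_rfl
    have hTb : ∀ ω, |T ω| ≤ k := abs_sum_signStep_le X k
    have hxm := hs.measurable_sign k
    have e1 : ∀ ω, (∑ j ∈ Finset.range (k + 1), signStep X j ω) ^ 2 =
        T ω ^ 2 + 2 * (T ω * signStep X k ω) + 1 := fun ω => by
      rw [Finset.sum_range_succ]
      have : signStep X k ω ^ 2 = 1 := by rcases hs.sign k ω with e | e <;> rw [e] <;> norm_num
      change (T ω + _) ^ 2 = _
      linear_combination this
    have i1 : Integrable (fun ω => T ω ^ 2) μ :=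
      .of_bound (by fun_prop) ((k : ℝ) ^ 2) (ae_of_all _ fun ω => by
        rw [norm_pow]; exact pow_le_pow_left₀ (norm_nonneg _) (hTb ω) 2)
    have i2 : Integrable (fun ω => 2 * (T ω * signStep X k ω)) μ :=
      (Integrable.of_bound (by fun_prop) (k : ℝ) (ae_of_all _ fun ω => by
        rw [norm_mul, Real.norm_eq_abs, Real.norm_eq_abs, hs.abs_sign, mul_one]
        exact hTb ω)).const_mul 2
    have e2 : ∫ ω, T ω * signStep X k ω ∂μ = (2 * p - 1) / k * ∫ ω, T ω ^ 2 ∂μ := by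
      rw [hs.integral_mul_sign k (H := T) hTm hTb, ← integral_const_mul]
      refine integral_congr_ae (ae_of_all _ fun ω => ?_)
      simp only [signPred, show k ≠ 0 by omega, if_false]
      change T ω * (_ * T ω) = _
      ring
    have hk0 : (0 : ℝ) < k := by positivity
    simp_rw [e1]
    have i12 : Integrable (fun ω => T ω ^ 2 + 2 * (T ω * signStep X k ω)) μ := i1.add i2
    rw [integral_add i12 (integrable_const _), integral_add i1 i2, integral_const_mul, e2]
    simp only [integral_const, probReal_univ, smul_eq_mul, mul_one]
    have hI : 0 ≤ ∫ ω, T ω ^ 2 ∂μ := integral_nonneg fun ω => sq_nonneg _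
    -- Bernoulli's inequality. Its increment `(1 + A) / k` exceeds `2 * A / k` by `(1 - A) / k`;
    -- after multiplication by `k ^ (1 + A) / (1 - A)` the surplus is `k ^ A ≥ 1`, which pays for
    -- the additive `1`.
    have hb : (k : ℝ) ^ (1 + A) * (1 + (1 + A) / k) ≤ ((k + 1 : ℕ) : ℝ) ^ (1 + A) := by
      have := one_add_mul_self_le_rpow_one_add (s := 1 / (k : ℝ))
        (by have : 0 ≤ 1 / (k : ℝ) := by positivity
            linarith) (p := 1 + A) (by linarith)
      calc (k : ℝ) ^ (1 + A) * (1 + (1 + A) / k) ≤ (k : ℝ) ^ (1 + A) * (1 + 1 / k) ^ (1 + A) := by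
            refine mul_le_mul_of_nonneg_left (le_trans (le_of_eq ?_) this) (by positivity)
            ring
        _ = _ := by
            rw [← Real.mul_rpow hk0.le (by positivity)]
            congr 1
            push_cast
            field_simp
    have hk1 : 1 ≤ (k : ℝ) ^ A := Real.one_le_rpow (by exact_mod_cast hk) hA0
    have hkA : (k : ℝ) ^ (1 + A) = k * (k : ℝ) ^ A := by rw [Real.rpow_add hk0, Real.rpow_one]
    have c1 : (2 * p - 1) / k ≤ A / k := by gcongr
    have c2 : 0 ≤ A / k := by positivity
    calc _ ≤ (1 + 2 * (A / k)) * ∫ ω, T ω ^ 2 ∂μ + 1 := by nlinarith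
      _ ≤ (1 + 2 * (A / k)) * (1 / (1 - A) * (k : ℝ) ^ (1 + A)) + 1 := by gcongr
      _ ≤ 1 / (1 - A) * ((k : ℝ) ^ (1 + A) * (1 + (1 + A) / k)) := by
          rw [hkA]
          have : 1 / (1 - A) * (k * (k : ℝ) ^ A * (1 + (1 + A) / k)) -
              (1 + 2 * (A / k)) * (1 / (1 - A) * (k * (k : ℝ) ^ A)) = (k : ℝ) ^ A := by
            field_simp
            ring
          linarith
      _ ≤ _ := by gcongr

theorem integral_signPred_sq_le (h : IsElephantRandomWalk μ p q X U ξ) (hp : |2 * p - 1| ≤ 1)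
    (hp1 : 2 * p - 1 < 1) (hq : q ∈ Set.Icc (0 : ℝ) 1) :
    ∃ K s : ℝ, 0 < K ∧ 0 < s ∧
      ∀ k : ℕ, ∫ ω, signPred (2 * p - 1) q X k ω ^ 2 ∂μ ≤ K * ((k : ℝ) + 1) ^ (-s) := by
  have hs := h.isPredictedSigns hp hq
  set A := max (2 * p - 1) 0
  have hA0 : 0 ≤ A := le_max_right _ _
  have hA1 : A < 1 := max_lt hp1 one_pos
  have hA' : 0 < 1 - A := by linarith
  have hK : 1 ≤ 1 / (1 - A) := by rw [le_div_iff₀ hA']; linarith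
  -- The exponent is `2 - (1 + A)`. The factor `2` pays for the passage from `k` to `k + 1`, and the
  -- constant also covers `k = 0`, where the mean square is `(2 * q - 1) ^ 2 ≤ 1`.
  refine ⟨2 * (1 / (1 - A)), 1 - A, by positivity, hA', fun k => ?_⟩
  rcases Nat.eq_zero_or_pos k with rfl | hk
  · have : ∫ ω, signPred (2 * p - 1) q X 0 ω ^ 2 ∂μ = (2 * q - 1) ^ 2 := by simp [signPred]
    rw [this]
    simp only [Nat.cast_zero, zero_add, Real.one_rpow]
    nlinarith [hq.1, hq.2]
  · have hk0 : (0 : ℝ) < k := by positivity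
    have e : ∀ ω, signPred (2 * p - 1) q X k ω ^ 2 =
        ((2 * p - 1) / k) ^ 2 * (∑ j ∈ Finset.range k, signStep X j ω) ^ 2 := fun ω => by
      simp only [signPred, hk.ne', if_false]; ring
    simp_rw [e]
    rw [integral_const_mul]
    have h1 := h.integral_sum_sq_le hp hq hA0 hA1 (le_max_left _ _) hk
    have h2 : ((2 * p - 1) / k) ^ 2 ≤ ((k : ℝ) ^ 2)⁻¹ := by
      rw [div_pow, div_eq_mul_inv]
      exact mul_le_of_le_one_left (by positivity) ((sq_le_one_iff_abs_le_one _).2 hp)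
    have h3 : ((k : ℝ) ^ 2)⁻¹ * (k : ℝ) ^ (1 + A) = (k : ℝ) ^ (-(1 - A)) := by
      rw [← Real.rpow_natCast, ← Real.rpow_neg hk0.le, ← Real.rpow_add hk0]
      congr 1; push_cast; ring
    have h4 : (k : ℝ) ^ (-(1 - A)) ≤ 2 * ((k : ℝ) + 1) ^ (-(1 - A)) := by
      have h5 : (((k : ℝ) + 1) / 2) ^ (1 - A) ≤ (k : ℝ) ^ (1 - A) :=
        Real.rpow_le_rpow (by positivity)
          (by have : (1 : ℝ) ≤ k := by exact_mod_cast hk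
              linarith) hA'.le
      have h6 : (2 : ℝ) ^ (1 - A) ≤ 2 := by
        conv_rhs => rw [← Real.rpow_one 2]
        exact Real.rpow_le_rpow_of_exponent_le (by norm_num) (by linarith)
      rw [Real.div_rpow (by positivity) (by norm_num), div_le_iff₀ (by positivity)] at h5
      rw [Real.rpow_neg hk0.le, Real.rpow_neg (by positivity), inv_le_iff_one_le_mul₀ (by positivity),
        mul_assoc, mul_comm _ ((k : ℝ) ^ _), ← mul_assoc, ← div_eq_mul_inv,
        one_le_div (by positivity)]
      nlinarith [Real.rpow_pos_of_pos hk0 (1 - A)]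
    calc _ ≤ ((k : ℝ) ^ 2)⁻¹ * (1 / (1 - A) * (k : ℝ) ^ (1 + A)) := by gcongr
      _ = 1 / (1 - A) * (k : ℝ) ^ (-(1 - A)) := by rw [← h3]; ring
      _ ≤ 1 / (1 - A) * (2 * ((k : ℝ) + 1) ^ (-(1 - A))) := by gcongr
      _ = _ := by ring

end IsElephantRandomWalk

end

section

/-! ### Sums of powers -/

/-- Mean value theorem and monotonicity. The antiderivative `g` is left abstract so that `y ^ β / β`
and, for `β = 0`, the logarithm are treated at once. -/
theorem rpow_sub_one_sandwich {g : ℝ → ℝ} {β : ℝ} (hβ : β ≤ 1)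
    (hg : ∀ x, 0 < x → HasDerivAt g (x ^ (β - 1)) x) {x : ℝ} (hx : 0 < x) :
    (x + 1) ^ (β - 1) ≤ g (x + 1) - g x ∧ g (x + 1) - g x ≤ x ^ (β - 1) := by
  obtain ⟨c, hc, e⟩ := exists_hasDerivAt_eq_slope g (fun y => y ^ (β - 1)) (lt_add_one x)
    (fun y hy => (hg y (hx.trans_le hy.1)).continuousAt.continuousWithinAt)
    (fun y hy => hg y (hx.trans hy.1))
  rw [add_sub_cancel_left, div_one] at e
  rw [← e]
  exact ⟨Real.rpow_le_rpow_of_nonpos (hx.trans hc.1) hc.2.le (by linarith),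
    Real.rpow_le_rpow_of_nonpos hx hc.1.le (by linarith)⟩

theorem le_sum_Ico_rpow {g : ℝ → ℝ} {β : ℝ} (hβ : β ≤ 1)
    (hg : ∀ x, 0 < x → HasDerivAt g (x ^ (β - 1)) x) {N n : ℕ} (hn : N ≤ n) :
    g (n + 1) - g (N + 1) ≤ ∑ k ∈ Finset.Ico N n, ((k : ℝ) + 1) ^ (β - 1) := by
  induction n, hn using Nat.le_induction with
  | base => simp
  | succ n hn ih =>
    rw [Finset.sum_Ico_succ_top hn]
    have := (rpow_sub_one_sandwich hβ hg (x := (n : ℝ) + 1) (by positivity)).2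
    push_cast
    linarith

theorem sum_Ico_rpow_le {g : ℝ → ℝ} {β : ℝ} (hβ : β ≤ 1)
    (hg : ∀ x, 0 < x → HasDerivAt g (x ^ (β - 1)) x) {N n : ℕ} (hN : 1 ≤ N) (hn : N ≤ n) :
    ∑ k ∈ Finset.Ico N n, ((k : ℝ) + 1) ^ (β - 1) ≤ g n - g N := by
  induction n, hn using Nat.le_induction with
  | base => simp
  | succ n hn ih =>
    rw [Finset.sum_Ico_succ_top hn]
    have := (rpow_sub_one_sandwich hβ hg (x := (n : ℝ)) (by
      have : (1 : ℝ) ≤ n := by exact_mod_cast hN.trans hn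
      linarith)).1
    push_cast
    linarith

theorem tendsto_sum_rpow_div {g : ℝ → ℝ} {β c : ℝ} (hβ : β ≤ 1)
    (hg : ∀ x, 0 < x → HasDerivAt g (x ^ (β - 1)) x) {r : ℕ → ℝ} (hr : Tendsto r atTop atTop)
    (hgr : Tendsto (fun n : ℕ => g n / r n) atTop (𝓝 c)) :
    Tendsto (fun n => (∑ k ∈ Finset.range n, ((k : ℝ) + 1) ^ (β - 1)) / r n) atTop (𝓝 c) := by
  have h1 : Tendsto (fun n : ℕ => g n / r n + (-g 1) / r n) atTop (𝓝 c) := by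
    simpa using hgr.add (hr.const_div_atTop (-g 1))
  have h2 : Tendsto (fun n : ℕ => g n / r n + (1 - g 1) / r n) atTop (𝓝 c) := by
    simpa using hgr.add (hr.const_div_atTop (1 - g 1))
  refine tendsto_of_tendsto_of_tendsto_of_le_of_le' h1 h2 ?_ ?_ <;>
    filter_upwards [hr.eventually_gt_atTop 0, eventually_ge_atTop 1] with n hn hn1 <;>
    rw [← add_div] <;> refine div_le_div_of_nonneg_right ?_ hn.le <;> rw [Finset.range_eq_Ico]
  · have := le_sum_Ico_rpow hβ hg (Nat.zero_le n)
    have h3 := (rpow_sub_one_sandwich hβ hg (x := (n : ℝ)) (by exact_mod_cast hn1)).1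
    have h4 : 0 ≤ ((n : ℝ) + 1) ^ (β - 1) := by positivity
    simp only [Nat.cast_zero, zero_add] at this
    linarith
  -- The antiderivative is controlled only on positive reals, so the first term, equal to `1`, is
  -- split off.
  · rw [← Finset.sum_Ico_consecutive _ (Nat.zero_le 1) hn1]
    have := sum_Ico_rpow_le hβ hg le_rfl hn1
    simp only [Nat.Ico_zero_eq_range, Finset.sum_range_one, Nat.cast_zero, zero_add,
      Real.one_rpow, Nat.cast_one] at this ⊢
    linarith

theorem hasDerivAt_rpow_div {β : ℝ} (hβ : β ≠ 0) {x : ℝ} (hx : 0 < x) :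
    HasDerivAt (fun y => y ^ β / β) (x ^ (β - 1)) x := by
  have := (Real.hasDerivAt_rpow_const (p := β) (Or.inl hx.ne')).div_const β
  rwa [mul_div_cancel_left₀ _ hβ] at this

theorem summable_rpow_sub_one {β : ℝ} (hβ : β < 0) :
    Summable fun k : ℕ => ((k : ℝ) + 1) ^ (β - 1) := by
  have := (summable_nat_add_iff 1).2 (Real.summable_nat_rpow.2 (by linarith : β - 1 < -1))
  simpa using this

/-- The integral comparison on `n ≤ k < l + n`, with `l → ∞`, encloses the tail between multiples of
`(n + 1) ^ β` and `n ^ β`. -/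
theorem tendsto_tsum_rpow_div {β : ℝ} (hβ : β < 0) :
    Tendsto (fun n : ℕ => (∑' k : ℕ, (((k + n : ℕ) : ℝ) + 1) ^ (β - 1)) / (n : ℝ) ^ β) atTop
      (𝓝 (1 / -β)) := by
  have hg : ∀ x, 0 < x → HasDerivAt (fun y : ℝ => y ^ β / β) (x ^ (β - 1)) x := fun x hx =>
    hasDerivAt_rpow_div hβ.ne hx
  have hlim : ∀ n : ℕ, Tendsto (fun l : ℕ => ∑ k ∈ Finset.Ico n (l + n), ((k : ℝ) + 1) ^ (β - 1))
      atTop (𝓝 (∑' k : ℕ, (((k + n : ℕ) : ℝ) + 1) ^ (β - 1))) := fun n => by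
    refine (((summable_nat_add_iff n).2 (summable_rpow_sub_one hβ)).hasSum.tendsto_sum_nat).congr
      fun l => ?_
    rw [Finset.sum_Ico_eq_sum_range, Nat.add_sub_cancel]
    exact Finset.sum_congr rfl fun k _ => by rw [add_comm n k]
  have h0 : Tendsto (fun l : ℕ => (l : ℝ) ^ β / β) atTop (𝓝 0) := by
    have : Tendsto (fun l : ℕ => (l : ℝ) ^ (-(-β))) atTop (𝓝 0) :=
      (tendsto_rpow_neg_atTop (by linarith)).comp tendsto_natCast_atTop_atTop
    simpa using this.div_const β
  have hup : ∀ n : ℕ, 1 ≤ n →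
      ∑' k : ℕ, (((k + n : ℕ) : ℝ) + 1) ^ (β - 1) ≤ (n : ℝ) ^ β * (1 / -β) := fun n hn => by
    refine (le_of_tendsto_of_tendsto (hlim n)
      ((h0.comp (tendsto_add_atTop_nat n)).sub_const ((n : ℝ) ^ β / β))
      (Eventually.of_forall fun l => sum_Ico_rpow_le (by linarith) hg hn (by omega))).trans
        (le_of_eq ?_)
    field_simp
    ring
  have hlo : ∀ n : ℕ, ((n : ℝ) + 1) ^ β * (1 / -β) ≤
      ∑' k : ℕ, (((k + n : ℕ) : ℝ) + 1) ^ (β - 1) := fun n => by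
    refine (le_of_eq ?_).trans (le_of_tendsto_of_tendsto
      ((h0.comp (tendsto_add_atTop_nat (n + 1))).sub_const (((n : ℝ) + 1) ^ β / β)) (hlim n)
      (Eventually.of_forall fun l => ?_))
    · field_simp
      ring
    · have := le_sum_Ico_rpow (by linarith) hg (show n ≤ l + n by omega)
      refine (le_of_eq ?_).trans this
      simp only [Function.comp]
      push_cast
      ring_nf
  have h1 : Tendsto (fun n : ℕ => (((n : ℝ) + 1) / n) ^ β * (1 / -β)) atTop (𝓝 (1 / -β)) := by
    have h2 : Tendsto (fun n : ℕ => ((n : ℝ) + 1) / n) atTop (𝓝 1) := by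
      have := tendsto_one_div_atTop_nhds_zero_nat (𝕜 := ℝ)
      refine Tendsto.congr' ?_ (by simpa using this.const_add 1)
      filter_upwards [eventually_gt_atTop 0] with n hn
      have : (n : ℝ) ≠ 0 := by positivity
      field_simp
    have h3 := (h2.rpow_const (p := β) (Or.inl one_ne_zero)).mul_const (1 / -β)
    simpa using h3
  refine tendsto_of_tendsto_of_tendsto_of_le_of_le' h1 tendsto_const_nhds ?_ ?_ <;>
    filter_upwards [eventually_ge_atTop 1] with n hn
  · have hn' : (0 : ℝ) < n := by exact_mod_cast hn
    rw [le_div_iff₀ (by positivity), Real.div_rpow (by positivity) hn'.le]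
    refine (le_of_eq ?_).trans (hlo n)
    have := Real.rpow_pos_of_pos hn' β
    field_simp
  · have hn' : (0 : ℝ) < n := by exact_mod_cast hn
    rw [div_le_iff₀ (by positivity), mul_comm]
    exact hup n hn

/-! ### Clocks -/

theorem isClock_natCast : IsClock fun n => (n : ℝ) where
  mono := Nat.mono_cast
  tendsto := tendsto_natCast_atTop_atTop
  le_self _ := le_rfl
  ratio := by
    have := tendsto_one_div_atTop_nhds_zero_nat (𝕜 := ℝ)
    refine Tendsto.congr' ?_ (by simpa using this.const_add 1)
    filter_upwards [eventually_gt_atTop 0] with n hn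
    have : (n : ℝ) ≠ 0 := by positivity
    push_cast
    field_simp

theorem isClock_log : IsClock fun n => Real.log n where
  mono := monotone_nat_of_le_succ fun n => by
    rcases Nat.eq_zero_or_pos n with rfl | hn
    · simp
    · exact Real.log_le_log (by exact_mod_cast hn) (by simp)
  tendsto := Real.tendsto_log_atTop.comp tendsto_natCast_atTop_atTop
  le_self n := Real.log_le_self n.cast_nonneg
  ratio := by
    have h1 : Tendsto (fun n : ℕ => Real.log n) atTop atTop :=
      Real.tendsto_log_atTop.comp tendsto_natCast_atTop_atTop
    have h2 := (Real.tendsto_log_nat_add_one_sub_log.div_atTop h1).const_add 1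
    rw [add_zero] at h2
    refine h2.congr' ?_
    filter_upwards [h1.eventually_gt_atTop 0] with n hn
    push_cast
    field_simp
    ring

/-! ### Polynomial weights -/

theorem CLT.congr_ae {Ω : Type*} [MeasurableSpace Ω] {μ : Measure Ω} [IsProbabilityMeasure μ]
    {Y Z : ℕ → Ω → ℝ} {v : ℝ} (h : CLT μ Y v) (hYZ : ∀ᵐ ω ∂μ, ∀ n, Y n ω = Z n ω) : CLT μ Z v :=
  TendstoInDistribution.congr (fun n => hYZ.mono fun _ hω => hω n) (ae_eq_refl _) h

theorem LimsupPM.neg {y : ℕ → ℝ} {c : ℝ} (h : LimsupPM y c) : LimsupPM (fun n => -y n) c :=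
  ⟨h.2, by simpa only [neg_neg] using h.1⟩

/-- The weights `(k + 1) ^ (-γ)`. -/
noncomputable def powWeight (γ : ℝ) (k : ℕ) : ℝ := ((k : ℝ) + 1) ^ (-γ)

theorem powWeight_sq (γ : ℝ) (k : ℕ) :
    powWeight γ k ^ 2 = ((k : ℝ) + 1) ^ ((1 - 2 * γ) - 1) := by
  rw [powWeight, ← Real.rpow_mul_natCast (by positivity)]
  congr 1
  push_cast
  ring

theorem powWeight_pos (γ : ℝ) (k : ℕ) : 0 < powWeight γ k := by
  unfold powWeight; positivity

theorem powWeight_le {γ : ℝ} (hγ : 0 < γ) {n k : ℕ} (h : n ≤ k) :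
    powWeight γ k ≤ powWeight γ n :=
  Real.rpow_le_rpow_of_nonpos (by positivity) (by gcongr) (by linarith)

theorem powWeight_sq_le {γ : ℝ} (hγ : 0 < γ) {n k : ℕ} (hn : 0 < n) (h : n ≤ k) :
    powWeight γ k ^ 2 ≤ (n : ℝ) ^ ((1 - 2 * γ) - 1) := by
  rw [powWeight_sq]
  have : (n : ℝ) ≤ k := by exact_mod_cast h
  exact Real.rpow_le_rpow_of_nonpos (by exact_mod_cast hn) (by linarith) (by linarith)

theorem abs_powWeight_le_one {γ : ℝ} (hγ : 0 < γ) (k : ℕ) : |powWeight γ k| ≤ 1 := by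
  rw [abs_of_pos (powWeight_pos γ k)]
  simpa [powWeight] using powWeight_le hγ (Nat.zero_le k)

theorem natCast_rpow_half_sq (γ : ℝ) (n : ℕ) :
    ((n : ℝ) ^ (1 / 2 - γ)) ^ 2 = (n : ℝ) ^ (1 - 2 * γ) := by
  rw [← Real.rpow_mul_natCast n.cast_nonneg]
  congr 1
  push_cast
  ring

theorem tendsto_powWeight_atTop {s : ℝ} (hs : 0 < s) : Tendsto (powWeight s) atTop (𝓝 0) :=
  (tendsto_rpow_neg_atTop hs).comp
    (tendsto_atTop_add_const_right _ 1 tendsto_natCast_atTop_atTop)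

namespace IsPredictedSigns

variable {Ω : Type*} [mΩ : MeasurableSpace Ω] {μ : Measure Ω} [IsProbabilityMeasure μ]
  {ℱ : Filtration ℕ mΩ} {x m : ℕ → Ω → ℝ}

theorem isScaledProcess_centredSum (h : IsPredictedSigns μ ℱ x m)
    (hm : ∃ K s : ℝ, 0 < K ∧ 0 < s ∧ ∀ k : ℕ, ∫ ω, m k ω ^ 2 ∂μ ≤ K * ((k : ℝ) + 1) ^ (-s))
    {a φ : ℕ → ℝ} (hφ : IsClock φ) {β c : ℝ} (hβ : 0 < β) (hc : 0 < c)
    (ha : ∃ C : ℝ, 0 < C ∧ ∀ᶠ n in atTop, ∀ k, n ≤ k → a k ^ 2 ≤ C * φ n ^ (β - 1))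
    (hw : Tendsto (fun n => (∑ k ∈ Finset.range n, a k ^ 2) / φ n ^ β) atTop (𝓝 c)) :
    IsScaledProcess μ ℱ x m a (fun n => centredSum x m a 0 n)
      (fun n => ∑ k ∈ Finset.range n, a k ^ 2) φ β c 1 where
  signs := h
  meanSq := hm
  clock := hφ
  sub_eq N n hn ω := by rw [← centredSum_add x m a (Nat.zero_le N) hn]; ring
  sign_eq := Or.inl ⟨hβ, rfl⟩
  subgaussian n := by
    simpa only [Finset.range_eq_Ico] using h.hasSubgaussianMGF_centredSum a (Nat.zero_le n)
  variance_eq N n hn := by rw [Finset.sum_Ico_eq_sub _ hn, one_mul]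
  weight_le := ha
  scale_pos := hc
  scale := hw

theorem isScaledProcess_remainder (h : IsPredictedSigns μ ℱ x m)
    (hm : ∃ K s : ℝ, 0 < K ∧ 0 < s ∧ ∀ k : ℕ, ∫ ω, m k ω ^ 2 ∂μ ≤ K * ((k : ℝ) + 1) ^ (-s))
    {a φ : ℕ → ℝ} (hφ : IsClock φ) {β c : ℝ} (hβ : β < 0) (hc : 0 < c)
    (ha : ∃ C : ℝ, 0 < C ∧ ∀ᶠ n in atTop, ∀ k, n ≤ k → a k ^ 2 ≤ C * φ n ^ (β - 1))
    (hs : Summable fun k => a k ^ 2) {L : Ω → ℝ} (hLm : Measurable L)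
    (hL : ∀ᵐ ω ∂μ, Tendsto (fun n => centredSum x m a 0 n ω) atTop (𝓝 (L ω)))
    (hw : Tendsto (fun n => (∑' k, a (k + n) ^ 2) / φ n ^ β) atTop (𝓝 c)) :
    IsScaledProcess μ ℱ x m a (fun n ω => L ω - centredSum x m a 0 n ω)
      (fun n => ∑' k, a (k + n) ^ 2) φ β c (-1) where
  signs := h
  meanSq := hm
  clock := hφ
  sub_eq N n hn ω := by rw [← centredSum_add x m a (Nat.zero_le N) hn]; ring
  sign_eq := Or.inr ⟨hβ, rfl⟩
  subgaussian n := h.hasSubgaussianMGF_remainder hs hLm hL n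
  variance_eq N n hn := by rw [sum_Ico_sq_eq hs hn]; ring
  weight_le := ha
  scale_pos := hc
  scale := hw

theorem tendsto_meanSq
    (hm : ∃ K s : ℝ, 0 < K ∧ 0 < s ∧ ∀ k : ℕ, ∫ ω, m k ω ^ 2 ∂μ ≤ K * ((k : ℝ) + 1) ^ (-s)) :
    Tendsto (fun k => ∫ ω, m k ω ^ 2 ∂μ) atTop (𝓝 0) := by
  obtain ⟨K, s, -, hs, h⟩ := hm
  refine squeeze_zero (fun k => integral_nonneg fun ω => sq_nonneg _) h ?_
  simpa [powWeight] using (tendsto_powWeight_atTop hs).const_mul K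

theorem limits_of_lt_half (h : IsPredictedSigns μ ℱ x m)
    (hm : ∃ K s : ℝ, 0 < K ∧ 0 < s ∧ ∀ k : ℕ, ∫ ω, m k ω ^ 2 ∂μ ≤ K * ((k : ℝ) + 1) ^ (-s))
    {γ : ℝ} (hγ : 0 < γ) (hγ' : γ < 1 / 2) :
    CLT μ (fun n ω => centredSum x m (powWeight γ) 0 n ω / (n : ℝ) ^ (1 / 2 - γ))
      (1 / (1 - 2 * γ)) ∧
    ∀ᵐ ω ∂μ, LimsupPM (fun n => centredSum x m (powWeight γ) 0 n ω /
      √(2 * (n : ℝ) ^ (1 - 2 * γ) * Real.log (Real.log n))) (1 / √(1 - 2 * γ)) := by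
  have hβ : 0 < 1 - 2 * γ := by linarith
  have hr : ∀ s : ℝ, 0 < s → Tendsto (fun n : ℕ => (n : ℝ) ^ s) atTop atTop := fun s hs =>
    (tendsto_rpow_atTop hs).comp tendsto_natCast_atTop_atTop
  have hw : Tendsto (fun n : ℕ => (∑ k ∈ Finset.range n, powWeight γ k ^ 2) /
      (n : ℝ) ^ (1 - 2 * γ)) atTop (𝓝 (1 / (1 - 2 * γ))) := by
    simp_rw [powWeight_sq]
    refine tendsto_sum_rpow_div (by linarith) (fun x hx => hasDerivAt_rpow_div hβ.ne' hx)
      (hr _ hβ) ?_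
    refine tendsto_const_nhds.congr' ?_
    filter_upwards [(hr _ hβ).eventually_gt_atTop 0] with n hn
    field_simp
  refine ⟨h.clt_centredSum (abs_powWeight_le_one hγ) (tendsto_meanSq hm)
    (hr _ (by linarith)) (by positivity) (by simpa only [natCast_rpow_half_sq] using hw), ?_⟩
  have hsc := h.isScaledProcess_centredSum hm isClock_natCast hβ (by positivity)
    ⟨1, one_pos, by
      filter_upwards [eventually_gt_atTop 0] with n hn k hk
      rw [one_mul]
      exact powWeight_sq_le hγ hn hk⟩ hw
  simpa only [lilNorm, Real.sqrt_div zero_le_one, Real.sqrt_one] using hsc.ae_limsupPM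

/-- The variance is a harmonic sum, so the clock is `log n` with exponent `1`; the triple logarithm
is `log (log (φ n))` for this clock. -/
theorem limits_half (h : IsPredictedSigns μ ℱ x m)
    (hm : ∃ K s : ℝ, 0 < K ∧ 0 < s ∧ ∀ k : ℕ, ∫ ω, m k ω ^ 2 ∂μ ≤ K * ((k : ℝ) + 1) ^ (-s)) :
    CLT μ (fun n ω => centredSum x m (powWeight (1 / 2)) 0 n ω / √(Real.log n)) 1 ∧
    ∀ᵐ ω ∂μ, LimsupPM (fun n => centredSum x m (powWeight (1 / 2)) 0 n ω /
      √(2 * Real.log n * Real.log (Real.log (Real.log n)))) 1 := by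
  have hlog := isClock_log.tendsto
  have hw : Tendsto (fun n : ℕ => (∑ k ∈ Finset.range n, powWeight (1 / 2) k ^ 2) /
      Real.log n) atTop (𝓝 1) := by
    simp_rw [powWeight_sq]
    refine tendsto_sum_rpow_div (g := Real.log) (by norm_num) (fun x hx => ?_) hlog ?_
    · simpa [Real.rpow_neg_one] using Real.hasDerivAt_log hx.ne'
    · refine tendsto_const_nhds.congr' ?_
      filter_upwards [hlog.eventually_gt_atTop 0] with n hn
      rw [div_self hn.ne']
  refine ⟨h.clt_centredSum (abs_powWeight_le_one (by norm_num)) (tendsto_meanSq hm)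
    (Real.tendsto_sqrt_atTop.comp hlog) one_pos (hw.congr fun n => ?_), ?_⟩
  · rw [Function.comp_apply, Real.sq_sqrt (Real.log_natCast_nonneg n)]
  have hsc := h.isScaledProcess_centredSum hm isClock_log one_pos one_pos
    (a := powWeight (1 / 2)) ⟨1, one_pos, Eventually.of_forall fun n k hk => by
      rw [sub_self, Real.rpow_zero, one_mul, sq_le_one_iff_abs_le_one]
      exact abs_powWeight_le_one (by norm_num) k⟩ (by simpa only [Real.rpow_one] using hw)
  simpa only [lilNorm, Real.sqrt_one, Real.rpow_one] using hsc.ae_limsupPM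

theorem limits_of_half_lt (h : IsPredictedSigns μ ℱ x m)
    (hm : ∃ K s : ℝ, 0 < K ∧ 0 < s ∧ ∀ k : ℕ, ∫ ω, m k ω ^ 2 ∂μ ≤ K * ((k : ℝ) + 1) ^ (-s))
    {γ : ℝ} (hγ : 1 / 2 < γ) :
    ∃ L : Ω → ℝ,
      (∀ᵐ ω ∂μ, Tendsto (fun n => centredSum x m (powWeight γ) 0 n ω) atTop (𝓝 (L ω))) ∧
      MemLp L 2 μ ∧
      Tendsto (fun n => eLpNorm (fun ω => centredSum x m (powWeight γ) 0 n ω - L ω) 2 μ) atTop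
        (𝓝 0) ∧
      0 < variance L μ ∧
      CLT μ (fun n ω => (centredSum x m (powWeight γ) 0 n ω - L ω) / (n : ℝ) ^ (1 / 2 - γ))
        (1 / (2 * γ - 1)) ∧
      ∀ᵐ ω ∂μ, LimsupPM (fun n => (centredSum x m (powWeight γ) 0 n ω - L ω) /
        √(2 * (n : ℝ) ^ (1 - 2 * γ) * Real.log (Real.log n))) (1 / √(2 * γ - 1)) := by
  have hγ0 : 0 < γ := by linarith
  have hβ : 1 - 2 * γ < 0 := by linarith
  have hβ' : 0 < 2 * γ - 1 := by linarith
  have hs : Summable fun k => powWeight γ k ^ 2 := by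
    simp_rw [powWeight_sq]
    exact summable_rpow_sub_one hβ
  obtain ⟨L, hLm, hL⟩ := h.exists_tendsto_centredSum hs
  have hw : Tendsto (fun n : ℕ => (∑' k, powWeight γ (k + n) ^ 2) / (n : ℝ) ^ (1 - 2 * γ)) atTop
      (𝓝 (1 / (2 * γ - 1))) := by
    simp_rw [powWeight_sq]
    simpa only [neg_sub] using tendsto_tsum_rpow_div hβ
  have hle := h.eLpNorm_remainder_le hs hL
  have hLp : MemLp L 2 μ := by
    refine ⟨hLm.aestronglyMeasurable, ?_⟩
    have := hle 0
    simp only [centredSum_self, sub_zero] at this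
    exact this.trans_lt ENNReal.ofReal_lt_top
  have hL2 : Tendsto (fun n => eLpNorm (fun ω => centredSum x m (powWeight γ) 0 n ω - L ω) 2 μ)
      atTop (𝓝 0) := by
    have h1 : Tendsto (fun n => ENNReal.ofReal √(∑' k, powWeight γ (k + n) ^ 2)) atTop (𝓝 0) := by
      have h2 := (Real.continuous_sqrt.tendsto _).comp (tendsto_sum_nat_add fun k => powWeight γ k ^ 2)
      rw [Real.sqrt_zero] at h2
      simpa using ENNReal.tendsto_ofReal h2
    refine tendsto_of_tendsto_of_tendsto_of_le_of_le tendsto_const_nhds h1 (fun _ => zero_le)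
      fun n => ?_
    refine (le_of_eq ?_).trans (hle n)
    rw [← eLpNorm_neg]
    congr 1
    ext ω
    simp
  -- A late index is taken because early steps may be deterministic given the past, as the first one
  -- is when `q` is `0` or `1`.
  obtain ⟨k₀, hk₀⟩ := ((tendsto_meanSq hm).eventually_lt_const zero_lt_one).exists
  refine ⟨L, hL, hLp, hL2, h.variance_limit_pos hLp hL2 (powWeight_pos γ k₀).ne' hk₀, ?_, ?_⟩
  · obtain ⟨K, s, hK, hs0, hms⟩ := hm
    -- The remainder theorem concerns limit minus sum; negating the signs turns it into sum minus
    -- limit.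
    have hL' : ∀ᵐ ω ∂μ, Tendsto (fun n => centredSum (-x) (-m) (powWeight γ) 0 n ω) atTop
        (𝓝 (-L ω)) := by
      filter_upwards [hL] with ω hω
      simpa only [centredSum_neg] using hω.neg
    have hpos : ∀ᶠ n : ℕ in atTop, 0 < (n : ℝ) ^ (1 / 2 - γ) := by
      filter_upwards [eventually_gt_atTop 0] with n hn
      positivity
    have := h.neg.clt_remainder hs hLm.neg hL' (A := powWeight γ)
      (E := fun n => K * ((n : ℝ) + 1) ^ (-s)) (r := fun n => (n : ℝ) ^ (1 / 2 - γ))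
      (v := 1 / (2 * γ - 1))
      (fun n k hk => by rw [abs_of_pos (powWeight_pos γ k)]; exact powWeight_le hγ0 hk)
      (fun n k hk => by
        simp only [Pi.neg_apply, neg_sq]
        exact (hms k).trans (mul_le_mul_of_nonneg_left (powWeight_le hs0 hk) hK.le))
      (by simpa [powWeight] using (tendsto_powWeight_atTop hs0).const_mul K) hpos
      (by
        have h1 : Tendsto (fun n : ℕ => (n : ℝ) ^ (-(1 / 2) : ℝ)) atTop (𝓝 0) :=
          (tendsto_rpow_neg_atTop (by norm_num)).comp tendsto_natCast_atTop_atTop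
        -- The largest weight of the tail is `(n + 1) ^ (-γ) ≤ n ^ (-γ)`, and `n ^ (-γ) / n ^ (1 / 2
        -- - γ) = n ^ (-1 / 2)`.
        refine squeeze_zero' (hpos.mono fun n hn => div_nonneg (powWeight_pos γ n).le hn.le) ?_ h1
        filter_upwards [eventually_gt_atTop 0] with n hn
        have hn' : (0 : ℝ) < n := by exact_mod_cast hn
        rw [div_le_iff₀ (by positivity), ← Real.rpow_add hn']
        refine (Real.rpow_le_rpow_of_nonpos hn' (by linarith) (by linarith)).trans
          (le_of_eq ?_)
        congr 1
        ring)
      (by positivity) (by simpa only [natCast_rpow_half_sq] using hw)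
    simp only [centredSum_neg] at this
    convert this using 4
    rw [Pi.neg_apply]
    ring
  · have hsc := h.isScaledProcess_remainder hm isClock_natCast hβ (by positivity)
      ⟨1, one_pos, by
        filter_upwards [eventually_gt_atTop 0] with n hn k hk
        rw [one_mul]
        exact powWeight_sq_le hγ0 hn hk⟩ hs hLm hL hw
    filter_upwards [hsc.ae_limsupPM] with ω hω
    have := hω.neg
    simp only [lilNorm, Real.sqrt_div zero_le_one, Real.sqrt_one, ← neg_div, neg_sub] at this
    exact this

end IsPredictedSigns

end

end ERW


/-! ### The three regimes for the martingale part of the walk -/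

theorem theorem3 {Ω : Type*} [MeasurableSpace Ω] (μ : Measure Ω) [IsProbabilityMeasure μ]
    (p q α γ : ℝ) (hα : α = 2 * p - 1) (hα_mem : α ∈ Set.Ico (-1 : ℝ) 1)
    (hq : q ∈ Set.Icc (0 : ℝ) 1) (hγ : 0 < γ)
    (X : ℕ → Ω → ℝ) (U : ℕ → Ω → ℕ) (ξ : ℕ → Ω → ℝ)
    (hX : ERW.IsElephantRandomWalk μ p q X U ξ) :
    (γ < 1 / 2 →
      ERW.CLT μ (fun n ω => ERW.martPart μ γ X n ω / (n : ℝ) ^ (1 / 2 - γ)) (1 / (1 - 2 * γ)) ∧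
      ∀ᵐ ω ∂μ, ERW.LimsupPM
        (fun n => ERW.martPart μ γ X n ω /
          √(2 * (n : ℝ) ^ (1 - 2 * γ) * Real.log (Real.log n)))
        (1 / √(1 - 2 * γ))) ∧
    (γ = 1 / 2 →
      ERW.CLT μ (fun n ω => ERW.martPart μ γ X n ω / √(Real.log n)) 1 ∧
      ∀ᵐ ω ∂μ, ERW.LimsupPM
        (fun n => ERW.martPart μ γ X n ω /
          √(2 * Real.log n * Real.log (Real.log (Real.log n))))
        1) ∧
    (1 / 2 < γ →
      ∃ Minf : Ω → ℝ,
        (∀ᵐ ω ∂μ, Tendsto (fun n => ERW.martPart μ γ X n ω) atTop (𝓝 (Minf ω))) ∧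
        (∀ n, MemLp (ERW.martPart μ γ X n) 2 μ) ∧ MemLp Minf 2 μ ∧
        Tendsto (fun n => eLpNorm (fun ω => ERW.martPart μ γ X n ω - Minf ω) 2 μ) atTop (𝓝 0) ∧
        0 < variance Minf μ ∧
        ERW.CLT μ (fun n ω => (ERW.martPart μ γ X n ω - Minf ω) / (n : ℝ) ^ (1 / 2 - γ))
          (1 / (2 * γ - 1)) ∧
        ∀ᵐ ω ∂μ, ERW.LimsupPM
          (fun n => (ERW.martPart μ γ X n ω - Minf ω) /
            √(2 * (n : ℝ) ^ (1 - 2 * γ) * Real.log (Real.log n)))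
          (1 / √(2 * γ - 1))) := by

  subst hα
  have hp : |2 * p - 1| ≤ 1 := abs_le.2 ⟨hα_mem.1, hα_mem.2.le⟩
  have hs := hX.isPredictedSigns hp hq
  have hm := hX.integral_signPred_sq_le hp hα_mem.2 hq
  -- Off one null set the martingale part is the weighted sum of centred signs for all `n`
  -- simultaneously, so pathwise and distributional limits both transfer.
  have hM := hX.ae_martPart_eq hp hq γ
  change ∀ᵐ ω ∂μ, ∀ n, ERW.martPart μ γ X n ω = ERW.centredSum (ERW.signStep X)
    (ERW.signPred (2 * p - 1) q X) (ERW.powWeight γ) 0 n ω at hM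
  refine ⟨fun h => ?_, fun h => ?_, fun h => ?_⟩
  · obtain ⟨h1, h2⟩ := hs.limits_of_lt_half hm hγ h
    refine ⟨h1.congr_ae (hM.mono fun ω hω n => by rw [hω]), ?_⟩
    filter_upwards [h2, hM] with ω h2 hω
    simpa only [hω] using h2
  · subst h
    obtain ⟨h1, h2⟩ := hs.limits_half hm
    refine ⟨h1.congr_ae (hM.mono fun ω hω n => by rw [hω]), ?_⟩
    filter_upwards [h2, hM] with ω h2 hω
    simpa only [hω] using h2
  · obtain ⟨L, hL, hLp, hL2, hvar, h1, h2⟩ := hs.limits_of_half_lt hm h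
    have hMn : ∀ n, ERW.martPart μ γ X n =ᵐ[μ] ERW.centredSum (ERW.signStep X)
      (ERW.signPred (2 * p - 1) q X) (ERW.powWeight γ) 0 n := fun n =>
        hM.mono fun ω hω => hω n
    refine ⟨L, ?_, fun n => (memLp_congr_ae (hMn n)).2 (hs.memLp_centredSum _ 0 n 2), hLp, ?_,
      hvar, h1.congr_ae (hM.mono fun ω hω n => by rw [hω]), ?_⟩
    · filter_upwards [hL, hM] with ω h2 hω
      simpa only [hω] using h2
    · refine hL2.congr fun n => eLpNorm_congr_ae ((hMn n).mono fun ω hω => ?_)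
      simp only [hω]
    · filter_upwards [h2, hM] with ω h2 hω
      simpa only [hω] using h2
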